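/- Consider the Landau–Lifshitz–Gilbert–Slonczewski equation for $\boldsymbol m(x,t)\in\mathbb S^2\subset\mathbb R^3$, $x\in\mathbb R$, $$\partial_t\boldsymbol m-\alpha\,\boldsymbol m\times\partial_t\boldsymbol m=-\boldsymbol m\times\big(\partial_x^2\boldsymbol m+h\boldsymbol e_3-\mu m_3\boldsymbol e_3\big)+\boldsymbol m\times\Big(\boldsymbol m\times\frac{\beta}{1+c_{\rm cp}m_3}\boldsymbol e_3\Big).$$ A (right-moving) domain wall (DW) at the parameters $P=(c_{\rm cp},\alpha,\beta,h,\mu,s,\Omega)$ is a smooth profile $\boldsymbol m:\mathbb R\to\mathbb S^2$ with $\boldsymbol m(\xi)\to\boldsymbol e_3$ as $\xi\to-\infty$ and $\boldsymbol m(\xi)\to-\boldsymbol e_3$ as $\xi\to+\infty$, such that $R_{\Omega t}\,\boldsymbol m(x-st)$ solves the equation, where $R_a$ is the rotation by the angle $a$ about $\boldsymbol e_3$. Its local wavenumber is $q=\langle(m_1',m_2'),(-m_2,m_1)\rangle/(1-m_3^2)$ (defined where $\boldsymbol m\ne\pm\boldsymbol e_3$). The DW is homogeneous if $q\equiv0$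 and inhomogeneous otherwise; it is flat if $|q(\xi)|$ has a limit in $\mathbb R\cup\{\infty\}$ as $\xi\to-\infty$ and as $\xi\to+\infty$, and non-flat otherwise. For $\mu<0$ let $\boldsymbol m_0(\xi)=(\sin\theta_0,0,\cos\theta_0)$ with $\theta_0(\xi)=2\arctan(e^{\sqrt{-\mu}\,\xi})$, and put $$s_0(\alpha,\beta,h,\mu)=\frac{\alpha h-\beta}{\sqrt{-\mu}\,(1+\alpha^2)},\qquad \Omega_0(\alpha,\beta,h)=\frac{h+\alpha\beta}{1+\alpha^2},\qquad \boldsymbol\beta^-=\frac{\beta}{1-c_{\rm cp}}.$$ **Corollary.** Let $(\alpha_0,\beta_0,h_0,\mu_0)$ be in the center case, i.e. $\alpha_0>0$, $\beta_0\ge0$, $\mu_0<0$ and $h_0=\beta_0/\alpha_0-2\mu_0-2\mu_0/\alpha_0^2$, and let $P_0=(0,\alpha_0,\beta_0,h_0,\mu_0,s_0,\Omega_0)$ with $s_0,\Omega_0$ evaluated at $(\alpha_0,\beta_0,h_0,\mu_0)$. There are an open neighbourhood $U$ of $P_0$ in $\mathbb R^7$ and a family $(\boldsymbol m_P)_{P\in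 U}$ of maps $\mathbb R\to\mathbb R^3$, smooth jointly in $(P,\xi)\in U\times\mathbb R$, with $\boldsymbol m_{P_0}=\boldsymbol m_0$ (for $\mu=\mu_0$), such that the following holds for $P=(c_{\rm cp},\alpha,\beta,h,\mu,s,\Omega)\in U$. 1. If $\Omega>s^2/2+\boldsymbol\beta^- /\alpha$, and likewise if $\Omega<s^2/2+\boldsymbol\beta^- /\alpha$, then $\boldsymbol m_P$ is a flat DW at $P$. 2. If $\Omega=s^2/2+\boldsymbol\beta^- /\alpha$ and $\Omega<h+\mu+\frac{s^2}{4}(1+\alpha^2)$, then $\boldsymbol m_P$ is a DW at $P$, possibly non-flat. More precisely, $\boldsymbol m_P=(\cos\varphi\sin\theta,\sin\varphi\sin\theta,\cos\theta)$ with $0<\theta<\pi$, where $q=\varphi'$ and $(\theta,p,q)$ is a solution on $\mathbb R$ of the desingularized system $$\theta'=p\sin\theta,\quad p'=h-\Omega-\alpha sp+sq-(p^2-q^2+\mu)\cos\theta,\quad q'=\alpha\Omega-\frac{\beta}{1+c_{\rm cp}\cos\theta}-sp-\alpha sq-2pq\cos\theta .$$ As $\xi\to-\infty$, $\theta\to0$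 and $p+\mathrm iq\to\frac12\big(B+\mathrm i\sqrt{-4C^0-B^2}\big)$. As $\xi\to+\infty$, $\theta\to\pi$, and either $p+\mathrm iq\to\frac12\big(-B-\mathrm i\sqrt{4C^\pi-B^2}\big)$ and $\boldsymbol m_P$ is flat, or $p+\mathrm iq$ is asymptotic to a non-constant periodic solution of the $(p,q)$-system in the invariant plane (blow-up chart) $\theta=\pi$ and $\boldsymbol m_P$ is non-flat. Here $B=-(\alpha+\mathrm i)s$, $C^0=h-\Omega-\mu+\mathrm i\big(\alpha\Omega-\frac{\beta}{1+c_{\rm cp}}\big)$, $C^\pi=h-\Omega+\mu+\mathrm i\big(\alpha\Omega-\frac{\beta}{1-c_{\rm cp}}\big)$, with principal square roots. 3. In both cases $\boldsymbol m_P$ is inhomogeneous if $\beta c_{\rm cp}\neq0$, or if $(s,\Omega)\ne(s_0,\Omega_0)$ evaluated at $(\alpha,\beta,h,\mu)$. -/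

import Mathlib

open Real Set Filter Topology
open scoped ContDiff

noncomputable section

namespace LLGS

/-- Vectors of `ℝ³`. -/
abbrev Vec : Type := Fin 3 → ℝ

/-- The third unit vector. -/
def e3 : Vec := ![0, 0, 1]

/-- The full parameter vector `(c_cp, α, β, h, μ, s, Ω)`. -/
abbrev Param : Type := Fin 7 → ℝ

namespace Param

/-- Ratio of the polarization `c_cp`. -/
def c (P : Param) : ℝ := P 0
/-- Gilbert damping. -/
def α (P : Param) : ℝ := P 1
/-- Strength of the spin transfer. -/
def β (P : Param) : ℝ := P 2
/-- Applied field. -/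
def h (P : Param) : ℝ := P 3
/-- Anisotropy. -/
def μ (P : Param) : ℝ := P 4
/-- Speed. -/
def s (P : Param) : ℝ := P 5
/-- Frequency. -/
def Ω (P : Param) : ℝ := P 6

end Param

open Param

/-! ### The partial differential equation -/

/-- The effective field `∂ₓ²m + h e₃ - μ m₃ e₃`; the argument `mxx` is the value of `∂ₓ²m`. -/
def effField (P : Param) (m mxx : Vec) : Vec := mxx + P.h • e3 - (P.μ * m 2) • e3

/-- The polarized current `J = β / (1 + c_cp m₃) e₃`. -/
def current (P : Param) (m : Vec) : Vec := (P.β / (1 + P.c * m 2)) • e3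

/-- `u x t` solves the Landau-Lifshitz-Gilbert-Slonczewski equation
`∂ₜm - α m × ∂ₜm = - m × h_eff + m × (m × J)` for all `x, t`
(only used for smooth sphere-valued `u`; the speed and frequency entries of `P` are irrelevant). -/
def SolvesLLGS (P : Param) (u : ℝ → ℝ → Vec) : Prop :=
  ∀ x t : ℝ,
    deriv (fun τ => u x τ) t - P.α • crossProduct (u x t) (deriv (fun τ => u x τ) t)
      = - crossProduct (u x t) (effField P (u x t) (iteratedDeriv 2 (fun y => u y t) x))
        + crossProduct (u x t) (crossProduct (u x t) (current P (u x t)))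

/-- Rotation about the `e₃`-axis by the angle `a`. -/
def rot (a : ℝ) (v : Vec) : Vec :=
  ![cos a * v 0 - sin a * v 1, sin a * v 0 + cos a * v 1, v 2]

/-- The relative equilibrium with profile `m`, translating with speed `s` and rotating about the
`e₃`-axis with frequency `Ω`. -/
def relEquilibrium (P : Param) (m : ℝ → Vec) (x t : ℝ) : Vec :=
  rot (P.Ω * t) (m (x - P.s * t))

/-! ### Domain walls -/

/-- `m` is the profile of a domain wall at the parameters `P`: a smooth map to the unit sphere whose
relative equilibrium solves the equation, and which connects `e₃` at `-∞` with `-e₃` at `+∞`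
(the orientation of right-moving walls). -/
structure IsDomainWall (P : Param) (m : ℝ → Vec) : Prop where
  smooth : ContDiff ℝ ∞ m
  sphere : ∀ ξ, m ξ 0 ^ 2 + m ξ 1 ^ 2 + m ξ 2 ^ 2 = 1
  solves : SolvesLLGS P (relEquilibrium P m)
  left : Tendsto m atBot (𝓝 e3)
  right : Tendsto m atTop (𝓝 (-e3))

/-- The local wavenumber `q = ⟨(m₁', m₂'), (-m₂, m₁)⟩ / (1 - m₃²)`, the derivative of the azimuthal
angle. It is meaningful where `m` is not at a pole; at a pole the formula returns `0`. -/
def localWavenumber (m : ℝ → Vec) (ξ : ℝ) : ℝ :=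
  (deriv m ξ 0 * (-(m ξ 1)) + deriv m ξ 1 * m ξ 0) / (1 - m ξ 2 ^ 2)

/-- Homogeneous walls: `q ≡ 0`. -/
def Homogeneous (m : ℝ → Vec) : Prop := ∀ ξ, localWavenumber m ξ = 0

/-- Inhomogeneous walls. -/
def Inhomogeneous (m : ℝ → Vec) : Prop := ¬ Homogeneous m

/-- Flat walls: `|q|` has a limit in `ℝ ∪ {∞}` at each of the two ends. -/
def Flat (m : ℝ → Vec) : Prop :=
  (∃ L : EReal, Tendsto (fun ξ => ((|localWavenumber m ξ| : ℝ) : EReal)) atBot (𝓝 L)) ∧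
  (∃ L : EReal, Tendsto (fun ξ => ((|localWavenumber m ξ| : ℝ) : EReal)) atTop (𝓝 L))

/-- The point of the sphere with altitude angle `θ` and azimuthal angle `φ`. -/
def spherical (θ φ : ℝ) : Vec := ![cos φ * sin θ, sin φ * sin θ, cos θ]

/-- The profile of the explicit homogeneous wall: `θ = 2 arctan (exp (√(-μ) ξ))`, `φ = 0`. -/
def explicitWall (μ ξ : ℝ) : Vec := spherical (2 * arctan (exp (√(-μ) * ξ))) 0

/-- Speed of the explicit homogeneous wall. -/
def wallSpeed (α β h μ : ℝ) : ℝ := (α * h - β) / (√(-μ) * (1 + α ^ 2))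

/-- Frequency of the explicit homogeneous wall. -/
def wallFrequency (α β h : ℝ) : ℝ := (h + α * β) / (1 + α ^ 2)

/-- The parameter point `(0, α, β, h, μ, s₀, Ω₀)` of the explicit homogeneous wall. -/
def wallParam (α β h μ : ℝ) : Param :=
  ![0, α, β, h, μ, wallSpeed α β h μ, wallFrequency α β h]

/-- The frequency `s² / 2 + β⁻ / α` with `β⁻ = β / (1 - c_cp)`. -/
def centerFrequency (P : Param) : ℝ := P.s ^ 2 / 2 + P.β / (1 - P.c) / P.α

/-! ### The desingularized coherent structure system and its blow-up charts -/

/-- `(θ, p, q)` is a solution on all of `ℝ` of the desingularized system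
`θ' = sin θ p`, `p' = h - Ω - α s p + s q - (p² - q² + μ) cos θ`,
`q' = α Ω - β / (1 + c_cp cos θ) - s p - α s q - 2 p q cos θ`. -/
structure IsBlowupOrbit (P : Param) (θ p q : ℝ → ℝ) : Prop where
  theta_eq : ∀ ξ, HasDerivAt θ (sin (θ ξ) * p ξ) ξ
  p_eq : ∀ ξ, HasDerivAt p
    (P.h - P.Ω - P.α * P.s * p ξ + P.s * q ξ - (p ξ ^ 2 - q ξ ^ 2 + P.μ) * cos (θ ξ)) ξ
  q_eq : ∀ ξ, HasDerivAt q
    (P.α * P.Ω - P.β / (1 + P.c * cos (θ ξ)) - P.s * p ξ - P.α * P.s * q ξ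
      - 2 * p ξ * q ξ * cos (θ ξ)) ξ

/-- `B = -(α + i) s`. -/
def coeffB (P : Param) : ℂ := -((P.α : ℂ) + Complex.I) * (P.s : ℂ)

/-- `C⁰`, the coefficient `C` in the chart `θ = 0`. -/
def coeffC0 (P : Param) : ℂ :=
  ((P.h - P.Ω - P.μ : ℝ) : ℂ) + Complex.I * ((P.α * P.Ω - P.β / (1 + P.c) : ℝ) : ℂ)

/-- `C^π`, the coefficient `C` in the chart `θ = π`. -/
def coeffCpi (P : Param) : ℂ :=
  ((P.h - P.Ω + P.μ : ℝ) : ℂ) + Complex.I * ((P.α * P.Ω - P.β / (1 - P.c) : ℝ) : ℂ)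

/-- The equilibrium `p + i q = z⁰₋ = (B + i γ⁰) / 2` in the chart `θ = 0`, where
`γ⁰ = √(-4 C⁰ - B²)` (principal root). -/
def zZeroMinus (P : Param) : ℂ :=
  (coeffB P + Complex.I * (-4 * coeffC0 P - coeffB P ^ 2) ^ (1 / 2 : ℂ)) / 2

/-- The equilibrium `p + i q = z^π₋ = (-B - i γ^π) / 2` in the chart `θ = π`, where
`γ^π = √(4 C^π - B²)` (principal root). -/
def zPiMinus (P : Param) : ℂ :=
  (-coeffB P - Complex.I * (4 * coeffCpi P - coeffB P ^ 2) ^ (1 / 2 : ℂ)) / 2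

/-- `(π, p, q)` is a non-constant periodic orbit in the blow-up chart `θ = π`. -/
def IsChartPeriodicOrbit (P : Param) (p q : ℝ → ℝ) : Prop :=
  IsBlowupOrbit P (fun _ => π) p q ∧
  (∃ T : ℝ, 0 < T ∧ Function.Periodic p T ∧ Function.Periodic q T) ∧
  ∃ ξ₁ ξ₂ : ℝ, (p ξ₁, q ξ₁) ≠ (p ξ₂, q ξ₂)

/-- The profile `m` avoids the poles and is given by the orbit `(θ, p, q)` of the desingularized
system, with `q` the derivative of the azimuthal angle. -/
def IsGivenBy (P : Param) (m : ℝ → Vec) (θ p q : ℝ → ℝ) : Prop :=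
  IsBlowupOrbit P θ p q ∧ (∀ ξ, 0 < θ ξ ∧ θ ξ < π) ∧
  ∃ φ : ℝ → ℝ, (∀ ξ, HasDerivAt φ (q ξ) ξ) ∧ ∀ ξ, m ξ = spherical (θ ξ) (φ ξ)

/-- `m` is given by an orbit that converges to the equilibrium `Z⁰₋` at `-∞`, and at `+∞` either to
the equilibrium `Z^π₋` (and then `m` is flat) or to a periodic orbit in the chart `θ = π` (and then
`m` is non-flat). -/
def PointToPointOrCycle (P : Param) (m : ℝ → Vec) : Prop :=
  ∃ θ p q : ℝ → ℝ, IsGivenBy P m θ p q ∧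
    Tendsto (fun ξ => (θ ξ, p ξ, q ξ)) atBot (𝓝 (0, (zZeroMinus P).re, (zZeroMinus P).im)) ∧
    Tendsto θ atTop (𝓝 π) ∧
    ((Flat m ∧ Tendsto (fun ξ => (p ξ, q ξ)) atTop (𝓝 ((zPiMinus P).re, (zPiMinus P).im))) ∨
     (¬ Flat m ∧ ∃ p' q' : ℝ → ℝ, IsChartPeriodicOrbit P p' q' ∧
        Tendsto (fun ξ => (p ξ - p' ξ, q ξ - q' ξ)) atTop (𝓝 (0, 0))))

/-- The parameters at which the walls of the family are claimed to be inhomogeneous: the torque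
really depends on the polarization (`β c_cp ≠ 0`), or `(s, Ω)` differs from the speed and frequency
of the explicit homogeneous wall at the same `(α, β, h, μ)`. -/
def OffHomogeneous (P : Param) : Prop :=
  P.β * P.c ≠ 0 ∨
  (P.s, P.Ω) ≠ (wallSpeed P.α P.β P.h P.μ, wallFrequency P.α P.β P.h)

end LLGS

end

open Real Set Filter Topology
open scoped ContDiff ComplexConjugate

noncomputable section

namespace LLGS

/-! In the stereographic chart around the pole `ε e₃` the profile equation is `x'' = B x' + K x`
plus a cubic term, with `K = C⁰` at the left pole and `K = -C^π` at the right pole. At the center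
point the growth rates at the left pole are `σ = √(-μ)` and one with real part `-3σ`, while both
rates at the right pole have real part `-σ`. So the right pole is a sink, and the explicit wall lies
on an unstable manifold, of complex dimension one, that runs into it. This is an open situation. For
all parameters near `P₀`, including independent changes of `s` and `Ω`, the unstable manifold still
runs into the sink, which gives a domain wall.

The perturbation is carried out with the implicit function theorem in the Banach algebra `C([0,1],
ℂ)`, in variables that compactify the two ends: `ρ = exp (2 κ ξ)` on the left, with `κ` the real
part of the left rate, and `exp (-ν t)` on the right, with `ν = 2σ/3`. The unknowns are chosen so
that both fixed point maps have zero derivative at the explicit solution (`hasFDerivAt_leftMap`,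
`hasFDerivAt_rightMap`); on the left this holds for a cut-off of any size. Regularity in the space
variable comes from symmetry: a dilation on the left and a time translation on the right map fixed
points to fixed points with changed parameters, and by local uniqueness these belong to the same
analytic family. The two pieces are glued at a point `T` where the explicit wall is already close to
`-e₃` (`exists_wall_curves`).

On the right the solution is `exp (l₁ t) U₁ + exp (l₂ t) U₂` with exponentially convergent
amplitudes, and `p + i q` is minus its logarithmic derivative. If the two decay rates differ, one
mode wins and `q` converges. By `eig_re_mul_im` the rates agree exactly when `Ω = s²/2 + β⁻/α`. In
that case either the second limiting amplitude vanishes and `q` converges, or `p + i q` approaches a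
non-constant periodic solution of a Riccati equation for which `|q|` is not constant.

If `q ≡ 0`, then the imaginary part of the equation expresses `p` through `y = cos θ`, and the real
part becomes a polynomial identity in `y`. Since `y` takes infinitely many values, the polynomial is
zero, and this is impossible off the explicit family (`IsWallCurve.inhomogeneous`). -/

/-! ### Analytic fixed points -/

/-- An analytic fixed point equation whose partial derivative in the unknown vanishes at a known
solution has an analytic family of solutions, unique near the known one. -/
theorem exists_analytic_fixedPoint {Q A : Type*} [NormedAddCommGroup Q] [NormedSpace ℝ Q]
    [CompleteSpace Q] [NormedAddCommGroup A] [NormedSpace ℝ A] [CompleteSpace A]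
    {Φ : Q × A → A} {q₀ : Q} {a₀ : A} (hΦ : ContDiffAt ℝ ω Φ (q₀, a₀)) (h₀ : Φ (q₀, a₀) = a₀)
    (hd : HasFDerivAt (fun a => Φ (q₀, a)) (0 : A →L[ℝ] A) a₀) :
    ∃ ψ : Q → A, ContDiffAt ℝ ω ψ q₀ ∧ ψ q₀ = a₀ ∧ (∀ᶠ q in 𝓝 q₀, Φ (q, ψ q) = ψ q) ∧
      ∀ᶠ v in 𝓝 (q₀, a₀), Φ v = v.2 → v.2 = ψ v.1 := by
  set f : Q × A → A := fun v => v.2 - Φ v with hf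
  have cdf : ContDiffAt ℝ ω f (q₀, a₀) := contDiffAt_snd.sub hΦ
  have hf0 : f (q₀, a₀) = 0 := by simp [hf, h₀]
  have hD : fderiv ℝ f (q₀, a₀) ∘L .inr ℝ Q A = ContinuousLinearMap.id ℝ A := by
    have h1 : HasFDerivAt (fun a : A => f (q₀, a)) (fderiv ℝ f (q₀, a₀) ∘L .inr ℝ Q A) a₀ :=
      (cdf.differentiableAt (by simp)).hasFDerivAt.comp a₀ (hasFDerivAt_prodMk_right q₀ a₀)
    have h2 : HasFDerivAt (fun a : A => f (q₀, a)) (ContinuousLinearMap.id ℝ A - 0) a₀ :=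
      (hasFDerivAt_id a₀).sub hd
    simpa using h1.unique h2
  have inv : (fderiv ℝ f (q₀, a₀) ∘L .inr ℝ Q A).IsInvertible := by
    rw [hD]; exact ⟨.refl ℝ A, rfl⟩
  have pn : (ω : WithTop ℕ∞) ≠ 0 := by simp
  refine ⟨cdf.implicitFunction pn inv, cdf.contDiffAt_implicitFunction pn inv,
    cdf.implicitFunction_apply_self pn inv, ?_, ?_⟩
  · filter_upwards [cdf.eventually_apply_implicitFunction pn inv] with q hq
    rw [hf0] at hq
    exact (sub_eq_zero.1 hq).symm
  · filter_upwards [cdf.eventually_apply_eq_iff_implicitFunction pn inv] with v hv hfix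
    refine (hv.1 ?_).symm
    rw [hf0]
    exact sub_eq_zero.2 hfix.symm

/-- A product of a function vanishing to first order and a continuous factor vanishing at the base
point has zero derivative. -/
theorem hasFDerivAt_zero_of_mul {E A : Type*} [NormedAddCommGroup E] [NormedSpace ℝ E]
    [NormedRing A] [NormedAlgebra ℝ A] {f g : E → A} {x₀ : E} (hf : DifferentiableAt ℝ f x₀)
    (hf0 : f x₀ = 0) (hg : DifferentiableAt ℝ g x₀) (hg0 : g x₀ = 0) :
    HasFDerivAt (fun x => f x * g x) (0 : E →L[ℝ] A) x₀ := by
  convert! hf.hasFDerivAt.mul' hg.hasFDerivAt using 1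
  rw [hf0, hg0]
  ext x
  simp

/-! ### The Banach algebra of continuous functions on the unit interval -/

/-- Continuous complex valued functions on the unit interval. -/
abbrev UnitFun : Type := C(unitInterval, ℂ)

namespace UnitFun

/-- Extension of a function on the unit interval to the line, constant on both sides. -/
def extend (g : UnitFun) (t : ℝ) : ℂ := g (projIcc 0 1 zero_le_one t)

theorem continuous_extend (g : UnitFun) : Continuous g.extend :=
  g.continuous.comp continuous_projIcc

theorem extend_of_mem (g : UnitFun) {t : ℝ} (ht : t ∈ Icc (0 : ℝ) 1) : g.extend t = g ⟨t, ht⟩ := by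
  rw [extend, projIcc_of_mem zero_le_one ht]

theorem norm_extend_le (g : UnitFun) (t : ℝ) : ‖g.extend t‖ ≤ ‖g‖ := g.norm_coe_le_norm _

/-- The inclusion of the unit interval into `ℂ`. -/
def ident : UnitFun := ⟨fun t => ((t : ℝ) : ℂ), by fun_prop⟩

@[simp] theorem ident_apply (t : unitInterval) : ident t = ((t : ℝ) : ℂ) := rfl

/-- Dilation `g ↦ g(s ·)`. -/
def dilate (s : unitInterval) (g : UnitFun) : UnitFun := ⟨fun t => g (s * t), by fun_prop⟩

@[simp] theorem dilate_apply (s : unitInterval) (g : UnitFun) (t : unitInterval) :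
    dilate s g t = g (s * t) := rfl

theorem norm_dilate_le (s : unitInterval) (g : UnitFun) : ‖dilate s g‖ ≤ ‖g‖ :=
  (ContinuousMap.norm_le _ (norm_nonneg g)).2 fun _ => g.norm_coe_le_norm _

theorem extend_dilate (s : unitInterval) (g : UnitFun) {t : ℝ} (ht : t ∈ Icc (0 : ℝ) 1) :
    (dilate s g).extend t = g.extend (s * t) := by
  have h : (s : ℝ) * t ∈ Icc (0 : ℝ) 1 := (s * ⟨t, ht⟩ : unitInterval).2
  rw [extend_of_mem _ ht, extend_of_mem _ h, dilate_apply]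
  rfl

/-- The primitive that vanishes at `0`. -/
def primitive : UnitFun →L[ℂ] UnitFun :=
  LinearMap.mkContinuous
    { toFun := fun g => ⟨fun t => ∫ u in (0 : ℝ)..t, g.extend u,
        (intervalIntegral.continuous_primitive
          (fun a b => g.continuous_extend.intervalIntegrable a b) 0).comp continuous_subtype_val⟩
      map_add' := fun f g => by
        ext t
        exact intervalIntegral.integral_add (f.continuous_extend.intervalIntegrable _ _)
          (g.continuous_extend.intervalIntegrable _ _)
      map_smul' := fun c g => by
        ext t
        exact intervalIntegral.integral_smul c _ } 1 <| fun g => by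
    rw [one_mul, ContinuousMap.norm_le _ (norm_nonneg g)]
    intro t
    refine (intervalIntegral.norm_integral_le_of_norm_le_const
      (fun u _ => g.norm_extend_le u)).trans ?_
    rw [sub_zero, abs_of_nonneg t.2.1]
    exact mul_le_of_le_one_right (norm_nonneg g) t.2.2

theorem primitive_apply (g : UnitFun) (t : unitInterval) :
    primitive g t = ∫ u in (0 : ℝ)..t, g.extend u := rfl

/-- The averaging operator `g ↦ ∫₀¹ k(v) g(· v) dv`. -/
def average (k : UnitFun) : UnitFun →L[ℂ] UnitFun :=
  have hc : ∀ g : UnitFun, Continuous (Function.uncurry fun (t : unitInterval) (v : ℝ) =>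
      k.extend v * g.extend (t * v)) := fun g => by
    have h1 := k.continuous_extend
    have h2 := g.continuous_extend
    simp only [Function.uncurry_def]
    fun_prop
  have hi : ∀ (g : UnitFun) (t : unitInterval), IntervalIntegrable
      (fun v => k.extend v * g.extend (t * v)) MeasureTheory.volume 0 1 := fun g t =>
    ((hc g).comp (Continuous.prodMk_right t)).intervalIntegrable 0 1
  LinearMap.mkContinuous
    { toFun := fun g => ⟨fun t => ∫ v in (0 : ℝ)..1, k.extend v * g.extend (t * v),
        intervalIntegral.continuous_parametric_intervalIntegral_of_continuous' (hc g) 0 1⟩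
      map_add' := fun f g => by
        ext t
        simp only [ContinuousMap.coe_mk, ContinuousMap.add_apply]
        rw [← intervalIntegral.integral_add (hi f t) (hi g t)]
        congr 1
        ext v
        exact mul_add _ _ _
      map_smul' := fun c g => by
        ext t
        simp only [ContinuousMap.coe_mk, ContinuousMap.smul_apply, RingHom.id_apply]
        rw [← intervalIntegral.integral_smul]
        congr 1
        ext v
        exact mul_left_comm _ _ _ } ‖k‖ <| fun g => by
    rw [ContinuousMap.norm_le _ (by positivity)]
    intro t
    refine (intervalIntegral.norm_integral_le_of_norm_le_const (C := ‖k‖ * ‖g‖)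
      (fun u _ => ?_)).trans (by simp)
    rw [norm_mul]
    exact mul_le_mul (k.norm_extend_le u) (g.norm_extend_le _) (norm_nonneg _) (norm_nonneg _)

theorem average_apply (k g : UnitFun) (t : unitInterval) :
    average k g t = ∫ v in (0 : ℝ)..1, k.extend v * g.extend (t * v) := rfl

/-- Substitution `u ↦ s u`. Together with `average_dilate` it transports the scaling symmetries of
the differential equations to the integral equations. -/
theorem primitive_dilate (s : unitInterval) (g : UnitFun) (t : unitInterval) :
    (s : ℝ) * primitive (dilate s g) t = primitive g (s * t) := by
  simp only [primitive_apply]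
  have h : ∫ u in (0 : ℝ)..t, (dilate s g).extend u = ∫ u in (0 : ℝ)..t, g.extend (s * u) := by
    refine intervalIntegral.integral_congr fun u hu => ?_
    rw [uIcc_of_le t.2.1] at hu
    exact extend_dilate s g ⟨hu.1, hu.2.trans t.2.2⟩
  rw [h]
  have := intervalIntegral.smul_integral_comp_mul_left (a := 0) (b := t) g.extend (s : ℝ)
  rw [mul_zero, Complex.real_smul] at this
  exact this

theorem average_dilate (k : UnitFun) (s : unitInterval) (g : UnitFun) :
    average k (dilate s g) = dilate s (average k g) := by
  ext t
  rw [dilate_apply, average_apply, average_apply]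
  refine intervalIntegral.integral_congr fun v hv => ?_
  rw [uIcc_of_le zero_le_one] at hv
  have : (t : ℝ) * v ∈ Icc (0 : ℝ) 1 := (t * ⟨v, hv⟩ : unitInterval).2
  rw [extend_dilate s g this, ← mul_assoc]
  rfl

theorem hasDerivAt_primitive (g : UnitFun) {t : ℝ} (ht : t ∈ Ioo (0 : ℝ) 1) :
    HasDerivAt (primitive g).extend (g.extend t) t := by
  have h := intervalIntegral.integral_hasDerivAt_right
    (g.continuous_extend.intervalIntegrable 0 t)
    g.continuous_extend.stronglyMeasurable.stronglyMeasurableAtFilter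
    g.continuous_extend.continuousAt
  refine h.congr_of_eventuallyEq ?_
  filter_upwards [Ioo_mem_nhds ht.1 ht.2] with u hu
  rw [extend_of_mem _ ⟨hu.1.le, hu.2.le⟩, primitive_apply]

/-! ### Complex powers as elements of the function algebra, analytic in the exponent. -/

theorem norm_real_cpow_le {p : ℂ} {t : ℝ} (ht : 0 ≤ t) (hp : 0 < p.re) :
    ‖(t : ℂ) ^ p‖ = t ^ p.re :=
  Complex.norm_cpow_eq_rpow_re_of_nonneg ht hp.ne'

/-- The power `t ↦ tᵖ` for exponents with positive real part. -/
def pow (p : ℂ) : UnitFun :=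
  if hp : 0 < p.re then ⟨fun t => ((t : ℝ) : ℂ) ^ p, by
    refine continuous_iff_continuousAt.2 fun t => ?_
    rcases t.2.1.eq_or_lt with h | h
    · rw [ContinuousAt, ← h, Complex.ofReal_zero, Complex.zero_cpow (by rintro rfl; simp at hp)]
      rw [tendsto_zero_iff_norm_tendsto_zero]
      simp only [norm_real_cpow_le (Subtype.property _ : _ ∈ Icc (0:ℝ) 1).1 hp]
      have : ContinuousAt (fun x : unitInterval => (x : ℝ) ^ p.re) t :=
        (Real.continuousAt_rpow_const _ _ (Or.inr hp.le)).comp continuous_subtype_val.continuousAt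
      rw [ContinuousAt, ← h, Real.zero_rpow hp.ne'] at this
      exact this
    · exact (continuousAt_cpow_const (Or.inl (by simpa using h))).comp
        (Complex.continuous_ofReal.comp continuous_subtype_val).continuousAt⟩
  else 0

theorem pow_apply {p : ℂ} (hp : 0 < p.re) (t : unitInterval) : pow p t = ((t : ℝ) : ℂ) ^ p := by
  simp [pow, hp]

/-- The derivative in the exponent is `tᵖ log t`. Half of the decay of `tᵖ` at `0` suffices to
control the logarithms in the remainder, uniformly in `t`. -/
theorem exists_norm_pow_add_sub_le {p : ℂ} (hp : 0 < p.re) :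
    ∃ D : UnitFun, ∀ h : ℂ, ‖h‖ ≤ p.re / 2 →
      ‖pow (p + h) - pow p - h • D‖ ≤ 8 / p.re ^ 2 * ‖h‖ ^ 2 := by
  set r : ℝ := p.re / 2 with hr
  have hr0 : 0 < r := by positivity
  have hpr : 0 < (p - (r : ℂ)).re := by simp [hr]; linarith
  -- The product `t^(p-r) * L` is `tᵖ log t`; writing it through `u log u` with `u = t^r` makes
  -- continuity at `0` automatic.
  let L : UnitFun := ⟨fun t => (((1 / r) * ((t : ℝ) ^ r * Real.log ((t : ℝ) ^ r)) : ℝ) : ℂ), by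
    refine Complex.continuous_ofReal.comp (continuous_const.mul (Real.continuous_mul_log.comp ?_))
    exact (Real.continuous_rpow_const hr0.le).comp continuous_subtype_val⟩
  refine ⟨pow (p - r) * L, fun h hh => ?_⟩
  rw [ContinuousMap.norm_le _ (by positivity)]
  intro t
  have hph : 0 < (p + h).re := by
    have := (abs_le.1 ((Complex.abs_re_le_norm h).trans hh)).1
    simp only [Complex.add_re]; linarith
  simp only [ContinuousMap.sub_apply, ContinuousMap.smul_apply, ContinuousMap.mul_apply,
    pow_apply hp, pow_apply hph, pow_apply hpr]
  have hL : L t = (((1 / r) * ((t : ℝ) ^ r * Real.log ((t : ℝ) ^ r)) : ℝ) : ℂ) := rfl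
  rw [hL]
  rcases t.2.1.eq_or_lt with h0 | h0
  · rw [← h0, Complex.ofReal_zero, Complex.zero_cpow (by rintro e; simp [e] at hph),
      Complex.zero_cpow (by rintro rfl; simp at hp), Complex.zero_cpow (by rintro e; simp [e] at hpr)]
    simp only [zero_mul, smul_zero, sub_zero, norm_zero]
    positivity
  · set x : ℝ := (t : ℝ) with hx
    have hx0 : (x : ℂ) ≠ 0 := by exact_mod_cast h0.ne'
    have hlog : Real.log x ≤ 0 := Real.log_nonpos h0.le t.2.2
    have e1 : (x : ℂ) ^ (p - r) * (((1 / r) * (x ^ r * Real.log (x ^ r)) : ℝ) : ℂ)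
        = (x : ℂ) ^ p * (Real.log x : ℂ) := by
      rw [Real.log_rpow h0, Complex.cpow_sub _ _ hx0]
      have hxr : (x : ℂ) ^ (r : ℂ) ≠ 0 := by rw [Complex.cpow_ne_zero_iff]; exact Or.inl hx0
      push_cast [Complex.ofReal_cpow h0.le]
      have : (r : ℂ) ≠ 0 := by exact_mod_cast hr0.ne'
      field_simp
    have e2 : (x : ℂ) ^ (p + h) = (x : ℂ) ^ p * Complex.exp (h * Real.log x) := by
      rw [Complex.cpow_add _ _ hx0, Complex.cpow_def_of_ne_zero hx0 h, Complex.ofReal_log h0.le,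
        mul_comm h]
    rw [e1, e2]
    have e3 : (x : ℂ) ^ p * Complex.exp (h * Real.log x) - (x : ℂ) ^ p
        - h • ((x : ℂ) ^ p * (Real.log x : ℂ))
        = (x : ℂ) ^ p * (Complex.exp (h * Real.log x)
          - ∑ m ∈ Finset.range 2, (h * Real.log x) ^ m / (m.factorial : ℂ)) := by
      simp [Finset.sum_range_succ]; ring
    rw [e3, norm_mul, Complex.norm_cpow_eq_rpow_re_of_pos h0]
    set u : ℝ := - Real.log x with hu
    have hu0 : 0 ≤ u := by linarith
    have hn : ‖h * (Real.log x : ℂ)‖ = ‖h‖ * u := by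
      rw [norm_mul, Complex.norm_real, Real.norm_eq_abs, abs_of_nonpos hlog]
    have key := Complex.norm_exp_sub_sum_le_norm_mul_exp (h * Real.log x) 2
    rw [hn] at key
    have hxe : x ^ p.re = Real.exp (-(2 * r * u)) := by
      rw [Real.rpow_def_of_pos h0, hu, hr]; congr 1; ring
    have hexp : (r * u) ^ 2 / 2 ≤ Real.exp (r * u) := by
      have := Real.quadratic_le_exp_of_nonneg (mul_nonneg hr0.le hu0)
      have h3 := mul_nonneg hr0.le hu0
      linarith
    have hexp2 : Real.exp (‖h‖ * u) ≤ Real.exp (r * u) :=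
      Real.exp_le_exp.2 (mul_le_mul_of_nonneg_right hh hu0)
    -- With `x = exp (-u)` the power contributes `exp (-2ru)` and the exponential remainder `(‖h‖
    -- u)² exp (ru)`. The constant is `u² exp (-ru) ≤ 2 / r² = 8 / (re p)²`.
    calc x ^ p.re * _ ≤ Real.exp (-(2 * r * u)) * ((‖h‖ * u) ^ 2 * Real.exp (r * u)) := by
          rw [hxe]
          gcongr
          exact key.trans (by gcongr)
      _ = ‖h‖ ^ 2 * (u ^ 2 * Real.exp (-(r * u))) := by
          have : Real.exp (-(2 * r * u)) = Real.exp (-(r * u)) * Real.exp (-(r * u)) := by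
            rw [← Real.exp_add]; congr 1; ring
          rw [this, Real.exp_neg]
          field_simp
      _ ≤ ‖h‖ ^ 2 * (8 / p.re ^ 2) := by
          gcongr
          have hpe : p.re = 2 * r := by rw [hr]; ring
          rw [Real.exp_neg, hpe, ← div_eq_mul_inv, div_le_div_iff₀ (Real.exp_pos _) (by positivity)]
          nlinarith
      _ = _ := mul_comm _ _

/-- Complex differentiability on an open half plane gives analyticity. It is needed because the
exponents at the right pole move with the parameters. -/
theorem analyticAt_pow {p : ℂ} (hp : 0 < p.re) : AnalyticAt ℂ pow p := by
  have hd : DifferentiableOn ℂ pow {q : ℂ | 0 < q.re} := by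
    intro q hq
    obtain ⟨D, hD⟩ := exists_norm_pow_add_sub_le hq
    refine HasDerivAt.differentiableAt (f' := D) ?_ |>.differentiableWithinAt
    rw [hasDerivAt_iff_isLittleO_nhds_zero]
    have h1 : (fun h : ℂ => pow (q + h) - pow q - h • D) =O[𝓝 0] fun h : ℂ => h ^ 2 := by
      refine Asymptotics.IsBigO.of_bound (8 / q.re ^ 2) ?_
      have hq' : (0 : ℝ) < q.re / 2 := half_pos hq
      filter_upwards [Metric.closedBall_mem_nhds (0 : ℂ) hq'] with h hh
      rw [norm_pow]
      exact hD h (by simpa using hh)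
    exact h1.trans_isLittleO (by simpa using Asymptotics.isLittleO_pow_id (𝕜 := ℂ) one_lt_two)
  exact hd.analyticAt ((isOpen_lt continuous_const Complex.continuous_re).mem_nhds hp)

theorem contDiffAt_pow {p : ℂ} (hp : 0 < p.re) : ContDiffAt ℝ ω pow p :=
  (analyticAt_pow hp).restrictScalars.contDiffAt

/-- Substitution `u = t v`: the average is `t^(-(q+1)) ∫₀ᵗ u^q g(u) du`, the solution of the
singular equation that stays bounded at `t = 0`. -/
theorem cpow_mul_average_pow {q : ℂ} (hq : 0 < q.re) (g : UnitFun) (t : unitInterval)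
    (ht : 0 < (t : ℝ)) :
    ((t : ℝ) : ℂ) ^ (q + 1) * average (pow q) g t = primitive (pow q * g) t := by
  have h0 : ((t : ℝ) : ℂ) ≠ 0 := by exact_mod_cast ht.ne'
  have h1 := primitive_dilate t (pow q * g) 1
  rw [mul_one] at h1
  rw [← h1, Complex.cpow_add _ _ h0, Complex.cpow_one, mul_comm (_ ^ q), mul_assoc]
  congr 1
  rw [primitive_apply, average_apply, ← intervalIntegral.integral_const_mul]
  refine intervalIntegral.integral_congr fun v hv => ?_
  rw [uIcc_of_le zero_le_one] at hv
  have hm : (t : ℝ) * v ∈ Icc (0 : ℝ) 1 := (t * ⟨v, hv⟩ : unitInterval).2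
  rw [extend_dilate _ _ hv, extend_of_mem _ hv, extend_of_mem _ hm, extend_of_mem _ hm,
    ContinuousMap.mul_apply, pow_apply hq, pow_apply hq, ← mul_assoc]
  congr 1
  simp only [Complex.ofReal_mul]
  rw [Complex.mul_cpow_ofReal_nonneg t.2.1 hv.1]

/-- The average against `vᵠ` solves `t x' + (q + 1) x = g`. -/
theorem hasDerivAt_average_pow {q : ℂ} (hq : 0 < q.re) (g : UnitFun) {t : ℝ}
    (ht : t ∈ Ioo (0 : ℝ) 1) :
    HasDerivAt (average (pow q) g).extend
      ((g.extend t - (q + 1) * (average (pow q) g).extend t) / t) t := by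
  have h0 : ∀ s ∈ Ioo (0 : ℝ) 1, (average (pow q) g).extend s
      = (s : ℂ) ^ (-(q + 1)) * (primitive (pow q * g)).extend s := by
    intro s hs
    have hs0 : (s : ℂ) ≠ 0 := by exact_mod_cast hs.1.ne'
    have hm : s ∈ Icc (0 : ℝ) 1 := ⟨hs.1.le, hs.2.le⟩
    rw [extend_of_mem _ hm, extend_of_mem _ hm, ← cpow_mul_average_pow hq g ⟨s, hm⟩ hs.1,
      ← mul_assoc, ← Complex.cpow_add _ _ hs0]
    simp
  have ht0 : (t : ℂ) ≠ 0 := by exact_mod_cast ht.1.ne'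
  have hm : t ∈ Icc (0 : ℝ) 1 := ⟨ht.1.le, ht.2.le⟩
  have h1 : HasDerivAt (fun s : ℝ => (s : ℂ) ^ (-(q + 1)))
      (-(q + 1) * (t : ℂ) ^ (-(q + 1) - 1)) t := by
    have := (hasDerivAt_id (t : ℂ)).cpow_const (c := -(q + 1))
      (Or.inl (by simpa using ht.1) : id (t : ℂ) ∈ Complex.slitPlane)
    simpa using this.comp_ofReal
  have h2 := (h1.mul (hasDerivAt_primitive (pow q * g) ht)).congr_of_eventuallyEq
    (f₁ := (average (pow q) g).extend) (by
      filter_upwards [Ioo_mem_nhds ht.1 ht.2] with s hs using h0 s hs)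
  convert! h2 using 1
  have h3 : (pow q * g).extend t = (t : ℂ) ^ q * g.extend t := by
    rw [extend_of_mem _ hm, extend_of_mem _ hm, ContinuousMap.mul_apply, pow_apply hq]
  have h4 : (t : ℂ) ^ (-(q + 1)) * (t : ℂ) ^ q = 1 / t := by
    rw [← Complex.cpow_add _ _ ht0]
    have : -(q + 1) + q = -1 := by ring
    rw [this, Complex.cpow_neg_one, one_div]
  have h5 : (t : ℂ) ^ (-(q + 1) - 1) = (t : ℂ) ^ (-(q + 1)) / t := by
    rw [Complex.cpow_sub _ _ ht0, Complex.cpow_one]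
  rw [h3, h0 t ht, h5, ← mul_assoc _ ((t : ℂ) ^ q), h4]
  field_simp
  ring

end UnitFun

/-! ### Real analyticity of the basic operations on `ℂ`, on the function algebra and on the
parameters. -/

section ContDiffAt

variable {E : Type*} [NormedAddCommGroup E] [NormedSpace ℝ E] {x₀ : E}

@[fun_prop]
theorem contDiffAt_ofReal {f : E → ℝ} (hf : ContDiffAt ℝ ω f x₀) :
    ContDiffAt ℝ ω (fun x => (f x : ℂ)) x₀ :=
  Complex.ofRealCLM.contDiff.contDiffAt.comp x₀ hf

@[fun_prop]
theorem contDiffAt_conj {f : E → ℂ} (hf : ContDiffAt ℝ ω f x₀) :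
    ContDiffAt ℝ ω (fun x => conj (f x)) x₀ :=
  Complex.conjCLE.contDiff.contDiffAt.comp x₀ hf

@[fun_prop]
theorem contDiffAt_re {f : E → ℂ} (hf : ContDiffAt ℝ ω f x₀) :
    ContDiffAt ℝ ω (fun x => (f x).re) x₀ :=
  Complex.reCLM.contDiff.contDiffAt.comp x₀ hf

@[fun_prop]
theorem contDiffAt_im {f : E → ℂ} (hf : ContDiffAt ℝ ω f x₀) :
    ContDiffAt ℝ ω (fun x => (f x).im) x₀ :=
  Complex.imCLM.contDiff.contDiffAt.comp x₀ hf

theorem contDiffAt_cdiv {f g : E → ℂ} (hf : ContDiffAt ℝ ω f x₀) (hg : ContDiffAt ℝ ω g x₀)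
    (h : g x₀ ≠ 0) : ContDiffAt ℝ ω (fun x => f x / g x) x₀ := by
  simp only [div_eq_mul_inv]
  exact hf.mul (hg.inv h)

theorem contDiffAt_cexp {f : E → ℂ} (hf : ContDiffAt ℝ ω f x₀) :
    ContDiffAt ℝ ω (fun x => Complex.exp (f x)) x₀ :=
  ((Complex.contDiff_exp (𝕜 := ℝ)).contDiffAt).comp x₀ hf

theorem contDiffAt_cpow_const {f : E → ℂ} (hf : ContDiffAt ℝ ω f x₀) (h : f x₀ ∈ Complex.slitPlane)
    (c : ℂ) : ContDiffAt ℝ ω (fun x => f x ^ c) x₀ := by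
  have : AnalyticAt ℂ (fun z : ℂ => z ^ c) (f x₀) := analyticAt_id.cpow analyticAt_const h
  exact (this.restrictScalars (𝕜 := ℝ)).contDiffAt.comp x₀ hf

@[fun_prop]
theorem contDiffAt_star {f : E → UnitFun} (hf : ContDiffAt ℝ ω f x₀) :
    ContDiffAt ℝ ω (fun x => star (f x)) x₀ :=
  (starL' ℝ : UnitFun ≃L[ℝ] UnitFun).contDiff.contDiffAt.comp x₀ hf

@[fun_prop]
theorem contDiffAt_primitive {f : E → UnitFun} (hf : ContDiffAt ℝ ω f x₀) :
    ContDiffAt ℝ ω (fun x => UnitFun.primitive (f x)) x₀ :=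
  (UnitFun.primitive.restrictScalars ℝ).contDiff.contDiffAt.comp x₀ hf

@[fun_prop]
theorem contDiffAt_average {f : E → UnitFun} (k : UnitFun) (hf : ContDiffAt ℝ ω f x₀) :
    ContDiffAt ℝ ω (fun x => UnitFun.average k (f x)) x₀ :=
  ((UnitFun.average k).restrictScalars ℝ).contDiff.contDiffAt.comp x₀ hf

@[fun_prop]
theorem contDiffAt_eval {f : E → UnitFun} (t : unitInterval) (hf : ContDiffAt ℝ ω f x₀) :
    ContDiffAt ℝ ω (fun x => f x t) x₀ :=
  ((ContinuousMap.evalCLM ℝ t : UnitFun →L[ℝ] ℂ)).contDiff.contDiffAt.comp x₀ hf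

/-- A continuous function without zeros on the unit interval is a unit, and inversion is analytic at
units of a Banach algebra. -/
theorem contDiffAt_ringInverse_comp {f : E → UnitFun} (hf : ContDiffAt ℝ ω f x₀)
    (h : ∀ t, f x₀ t ≠ 0) : ContDiffAt ℝ ω (fun x => Ring.inverse (f x)) x₀ := by
  obtain ⟨u, hu⟩ := (ContinuousMap.isUnit_iff_forall_ne_zero (f x₀)).2 h
  have := contDiffAt_ringInverse ℝ (n := ω) u
  rw [hu] at this
  exact this.comp x₀ hf

variable {P : E → Param}

@[fun_prop]
theorem contDiffAt_param_c (hP : ContDiffAt ℝ ω P x₀) : ContDiffAt ℝ ω (fun x => (P x).c) x₀ :=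
  contDiffAt_pi.1 hP 0
@[fun_prop]
theorem contDiffAt_param_α (hP : ContDiffAt ℝ ω P x₀) : ContDiffAt ℝ ω (fun x => (P x).α) x₀ :=
  contDiffAt_pi.1 hP 1
@[fun_prop]
theorem contDiffAt_param_β (hP : ContDiffAt ℝ ω P x₀) : ContDiffAt ℝ ω (fun x => (P x).β) x₀ :=
  contDiffAt_pi.1 hP 2
@[fun_prop]
theorem contDiffAt_param_h (hP : ContDiffAt ℝ ω P x₀) : ContDiffAt ℝ ω (fun x => (P x).h) x₀ :=
  contDiffAt_pi.1 hP 3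
@[fun_prop]
theorem contDiffAt_param_μ (hP : ContDiffAt ℝ ω P x₀) : ContDiffAt ℝ ω (fun x => (P x).μ) x₀ :=
  contDiffAt_pi.1 hP 4
@[fun_prop]
theorem contDiffAt_param_s (hP : ContDiffAt ℝ ω P x₀) : ContDiffAt ℝ ω (fun x => (P x).s) x₀ :=
  contDiffAt_pi.1 hP 5
@[fun_prop]
theorem contDiffAt_param_Ω (hP : ContDiffAt ℝ ω P x₀) : ContDiffAt ℝ ω (fun x => (P x).Ω) x₀ :=
  contDiffAt_pi.1 hP 6

end ContDiffAt

theorem UnitFun.ringInverse_apply {f : UnitFun} (h : ∀ t, f t ≠ 0) (t : unitInterval) :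
    Ring.inverse f t = (f t)⁻¹ := by
  have hu := (ContinuousMap.isUnit_iff_forall_ne_zero f).2 h
  have := congrArg (fun g : UnitFun => g t) (Ring.inverse_mul_cancel f hu)
  exact eq_inv_of_mul_eq_one_left this

/-! ### The cubic nonlinearity in the stereographic charts -/

/-- The coefficient of the polarization dependent part of the nonlinearity. -/
def polarCoeff (ε : ℝ) (P : Param) : ℂ := 2 * Complex.I * P.β * P.c / (1 + P.c * ε : ℝ)

/-- The nonlinearity of the chart equation, with the weight `r` in front of `|y|²`. -/
def cubic (ε : ℝ) (P : Param) (r : ℝ) (y v : ℂ) : ℂ :=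
  conj y * (y * y * (2 * P.μ * (1 + r * (conj y * y))⁻¹
      - polarCoeff ε P * ((1 + P.c * ε : ℝ) + (1 - P.c * ε : ℝ) * (r * (conj y * y)))⁻¹)
    + 2 * (v * v * (1 + r * (conj y * y))⁻¹))

/-- The nonlinearity as an operator on functions. -/
def cubicOp (ε : ℝ) (P : Param) (ρ y v : UnitFun) : UnitFun :=
  star y * (y * y * ((2 * P.μ : ℂ) • Ring.inverse (1 + ρ * (star y * y))
      - polarCoeff ε P • Ring.inverse (((1 + P.c * ε : ℝ) : ℂ) • (1 : UnitFun)
          + ((1 - P.c * ε : ℝ) : ℂ) • (ρ * (star y * y))))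
    + (2 : ℂ) • (v * v * Ring.inverse (1 + ρ * (star y * y))))

theorem conj_mul_self_eq (y : ℂ) : conj y * y = ((Complex.normSq y : ℝ) : ℂ) := by
  rw [Complex.normSq_eq_conj_mul_self]

theorem one_add_mul_conj_ne_zero {r : ℝ} (hr : 0 ≤ r) (y : ℂ) :
    (1 : ℂ) + r * (conj y * y) ≠ 0 := by
  rw [conj_mul_self_eq]
  have : 0 < 1 + r * Complex.normSq y := by
    have := mul_nonneg hr (Complex.normSq_nonneg y); linarith
  exact_mod_cast this.ne'

theorem abs_mul_lt_one {c ε : ℝ} (hε : ε = 1 ∨ ε = -1) (hc : |c| < 1) :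
    0 < 1 + c * ε ∧ 0 < 1 - c * ε := by
  rw [abs_lt] at hc
  rcases hε with rfl | rfl <;> constructor <;> linarith

/-- For `r = 1` this is `(1 + c cos θ)(1 + |y|²)`, a sum of a positive and a nonnegative term when
`|c| < 1`. -/
theorem polarDenom_ne_zero {c ε r : ℝ} (hε : ε = 1 ∨ ε = -1) (hc : |c| < 1) (hr : 0 ≤ r) (y : ℂ) :
    ((1 + c * ε : ℝ) : ℂ) + ((1 - c * ε : ℝ) : ℂ) * (r * (conj y * y)) ≠ 0 := by
  obtain ⟨h1, h2⟩ := abs_mul_lt_one hε hc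
  rw [conj_mul_self_eq]
  have : 0 < (1 + c * ε) + (1 - c * ε) * (r * Complex.normSq y) := by
    have := mul_nonneg h2.le (mul_nonneg hr (Complex.normSq_nonneg y)); linarith
  exact_mod_cast this.ne'

section cubicOp

variable {ε : ℝ}

theorem cubicOp_apply (hε : ε = 1 ∨ ε = -1) {P : Param} (hc : |P.c| < 1) {ρ : UnitFun}
    {r : unitInterval → ℝ} (hr : ∀ t, 0 ≤ r t) (hρ : ∀ t, ρ t = r t) (y v : UnitFun)
    (t : unitInterval) : cubicOp ε P ρ y v t = cubic ε P (r t) (y t) (v t) := by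
  have h1 : ∀ t, (1 + ρ * (star y * y)) t ≠ 0 := fun t => by
    simpa [hρ] using one_add_mul_conj_ne_zero (hr t) (y t)
  have h2 : ∀ t, (((1 + P.c * ε : ℝ) : ℂ) • (1 : UnitFun)
          + ((1 - P.c * ε : ℝ) : ℂ) • (ρ * (star y * y))) t ≠ 0 := fun t => by
    simpa [hρ] using polarDenom_ne_zero hε hc (hr t) (y t)
  simp only [cubicOp, cubic, ContinuousMap.mul_apply, ContinuousMap.add_apply,
    ContinuousMap.sub_apply, ContinuousMap.smul_apply, UnitFun.ringInverse_apply h1,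
    UnitFun.ringInverse_apply h2, ContinuousMap.one_apply, hρ, smul_eq_mul, mul_one,
    ContinuousMap.star_apply]
  rfl

variable {E : Type*} [NormedAddCommGroup E] [NormedSpace ℝ E] {x₀ : E}

theorem contDiffAt_polarCoeff {P : E → Param} (hP : ContDiffAt ℝ ω P x₀)
    (hε : ε = 1 ∨ ε = -1) (hc : |(P x₀).c| < 1) :
    ContDiffAt ℝ ω (fun x => polarCoeff ε (P x)) x₀ := by
  have h1 : ((1 + (P x₀).c * ε : ℝ) : ℂ) ≠ 0 := by
    exact_mod_cast (abs_mul_lt_one hε hc).1.ne'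
  simp only [polarCoeff]
  exact contDiffAt_cdiv (by fun_prop) (by fun_prop) h1

theorem contDiffAt_cubicOp {P : E → Param} {ρ y v : E → UnitFun} (hP : ContDiffAt ℝ ω P x₀)
    (hρ : ContDiffAt ℝ ω ρ x₀) (hy : ContDiffAt ℝ ω y x₀) (hv : ContDiffAt ℝ ω v x₀)
    (hε : ε = 1 ∨ ε = -1) (hc : |(P x₀).c| < 1)
    {r : unitInterval → ℝ} (hr : ∀ t, 0 ≤ r t) (hρr : ∀ t, ρ x₀ t = r t) :
    ContDiffAt ℝ ω (fun x => cubicOp ε (P x) (ρ x) (y x) (v x)) x₀ := by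
  have h1 : ∀ t, (1 + ρ x₀ * (star (y x₀) * y x₀)) t ≠ 0 := fun t => by
    simpa [hρr] using one_add_mul_conj_ne_zero (hr t) (y x₀ t)
  have h2 : ∀ t, (((1 + (P x₀).c * ε : ℝ) : ℂ) • (1 : UnitFun)
          + ((1 - (P x₀).c * ε : ℝ) : ℂ) • (ρ x₀ * (star (y x₀) * y x₀))) t ≠ 0 := fun t => by
    simpa [hρr] using polarDenom_ne_zero hε hc (hr t) (y x₀ t)
  have h3 := contDiffAt_ringInverse_comp
    (f := fun x => 1 + ρ x * (star (y x) * y x)) (by fun_prop) h1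
  have h4 := contDiffAt_ringInverse_comp
    (f := fun x => (((1 + (P x).c * ε : ℝ) : ℂ) • (1 : UnitFun)
          + ((1 - (P x).c * ε : ℝ) : ℂ) • (ρ x * (star (y x) * y x)))) (by fun_prop) h2
  have h5 := contDiffAt_polarCoeff hP hε hc
  simp only [cubicOp]
  fun_prop

end cubicOp

/-- The nonlinearity is homogeneous if the weight is adapted. -/
theorem cubic_mul (ε : ℝ) (P : Param) (r : ℝ) (e y v : ℂ) :
    cubic ε P r (e * y) (e * v) = e * (conj e * e) * cubic ε P (r * Complex.normSq e) y v := by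
  have h : (r : ℂ) * (conj (e * y) * (e * y))
      = ((r * Complex.normSq e : ℝ) : ℂ) * (conj y * y) := by
    rw [Complex.ofReal_mul, ← conj_mul_self_eq, map_mul]; ring
  unfold cubic
  rw [h, map_mul]
  ring

/-! ### The parameter point of the center case -/

/-- The relations between the parameters of the explicit wall in the center case, with
`σ = √(-μ)`. -/
structure IsCenterPoint (P : Param) (σ : ℝ) : Prop where
  σ_pos : 0 < σ
  α_pos : 0 < P.α
  c_eq : P.c = 0
  μ_eq : P.μ = -σ ^ 2
  s_eq : P.s = 2 * σ / P.α
  hΩ_eq : P.h - P.Ω = 2 * σ ^ 2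
  αΩ_eq : P.α * P.Ω - P.β = 2 * σ ^ 2 / P.α

/-- The center condition implies `Ω₀ = s₀²/2 + β₀/α₀`. Solved for `h₀`, it turns all coefficients
into expressions in `σ` and `α`. -/
theorem isCenterPoint_wallParam {α₀ β₀ h₀ μ₀ : ℝ} (hα : 0 < α₀) (hμ : μ₀ < 0)
    (hcenter : h₀ = β₀ / α₀ - 2 * μ₀ - 2 * μ₀ / α₀ ^ 2) :
    IsCenterPoint (wallParam α₀ β₀ h₀ μ₀) √(-μ₀) := by
  have hs : √(-μ₀) ^ 2 = -μ₀ := Real.sq_sqrt (by linarith)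
  have hp : 0 < √(-μ₀) := Real.sqrt_pos.2 (by linarith)
  have h1 : (0 : ℝ) < 1 + α₀ ^ 2 := by positivity
  have hm : μ₀ = -√(-μ₀) ^ 2 := by linarith
  refine ⟨hp, hα, rfl, hm, ?_, ?_, ?_⟩
  · change (α₀ * h₀ - β₀) / (√(-μ₀) * (1 + α₀ ^ 2)) = 2 * √(-μ₀) / α₀
    rw [div_eq_div_iff (by positivity) hα.ne', hcenter]
    field_simp
    linear_combination (-2 * (1 + α₀ ^ 2)) * hs
  · change h₀ - (h₀ + α₀ * β₀) / (1 + α₀ ^ 2) = 2 * √(-μ₀) ^ 2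
    rw [hs, hcenter]
    field_simp
    ring
  · change α₀ * ((h₀ + α₀ * β₀) / (1 + α₀ ^ 2)) - β₀ = 2 * √(-μ₀) ^ 2 / α₀
    rw [hs, hcenter]
    field_simp
    ring

theorem cpow_half_sq (w : ℂ) : (w ^ (1 / 2 : ℂ)) ^ 2 = w := by
  rw [one_div]; exact Complex.cpow_nat_inv_pow w two_ne_zero

theorem sq_cpow_half {w : ℂ} (hw : 0 < w.re) : (w ^ 2) ^ (1 / 2 : ℂ) = w := by
  rw [one_div]
  refine Complex.pow_cpow_nat_inv two_ne_zero ?_ ?_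
  · have := (abs_lt.1 (Complex.abs_arg_lt_pi_div_two_iff.2 (Or.inl hw))).1
    simp; linarith
  · have := (abs_lt.1 (Complex.abs_arg_lt_pi_div_two_iff.2 (Or.inl hw))).2
    simp; linarith

/-- Squaring maps the right half plane off the branch cut, so the principal root is analytic at such
a square. -/
theorem sq_mem_slitPlane {w : ℂ} (hw : 0 < w.re) : w ^ 2 ∈ Complex.slitPlane := by
  rw [Complex.mem_slitPlane_iff]
  by_cases h : w.im = 0
  · left; simp [sq, h]; positivity
  · right
    have : (w ^ 2).im = 2 * (w.re * w.im) := by simp [sq]; ring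
    rw [this]
    exact mul_ne_zero two_ne_zero (mul_ne_zero hw.ne' h)

theorem zZeroMinus_sq (P : Param) :
    zZeroMinus P ^ 2 = coeffB P * zZeroMinus P + coeffC0 P := by
  have h := cpow_half_sq (-4 * coeffC0 P - coeffB P ^ 2)
  unfold zZeroMinus
  linear_combination (Complex.I ^ 2 / 4) * h + ((-4 * coeffC0 P - coeffB P ^ 2) / 4) * Complex.I_sq

theorem zPiMinus_sq (P : Param) :
    zPiMinus P ^ 2 = -coeffB P * zPiMinus P - coeffCpi P := by
  have h := cpow_half_sq (4 * coeffCpi P - coeffB P ^ 2)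
  unfold zPiMinus
  linear_combination (Complex.I ^ 2 / 4) * h + ((4 * coeffCpi P - coeffB P ^ 2) / 4) * Complex.I_sq

theorem contDiffAt_coeffB (P : Param) : ContDiffAt ℝ ω coeffB P := by
  unfold coeffB
  fun_prop

namespace IsCenterPoint

variable {P : Param} {σ : ℝ} (hP : IsCenterPoint P σ)
include hP

theorem coeffB_eq : coeffB P = -(2 * σ) - (2 * σ / P.α : ℝ) * Complex.I := by
  have := hP.α_pos.ne'
  rw [coeffB, hP.s_eq]
  push_cast
  have : (P.α : ℂ) ≠ 0 := by exact_mod_cast this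
  field_simp
  ring

theorem coeffC0_eq : coeffC0 P = 3 * σ ^ 2 + (2 * σ ^ 2 / P.α : ℝ) * Complex.I := by
  rw [coeffC0, hP.c_eq, add_zero, div_one, hP.αΩ_eq, hP.hΩ_eq, hP.μ_eq]
  push_cast
  ring

theorem coeffCpi_eq : coeffCpi P = σ ^ 2 + (2 * σ ^ 2 / P.α : ℝ) * Complex.I := by
  rw [coeffCpi, hP.c_eq, sub_zero, div_one, hP.αΩ_eq, hP.hΩ_eq, hP.μ_eq]
  push_cast
  ring

/-- Exhibiting the discriminant as the square of a number with positive real part identifies its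
principal root and keeps it away from the cut. -/
theorem discr_zero_eq : -4 * coeffC0 P - coeffB P ^ 2
    = ((2 * σ / P.α : ℝ) - 4 * σ * Complex.I) ^ 2 := by
  rw [hP.coeffB_eq, hP.coeffC0_eq]
  have : (P.α : ℂ) ≠ 0 := by exact_mod_cast hP.α_pos.ne'
  push_cast
  field_simp
  ring_nf
  rw [Complex.I_sq]
  ring

/-- The root is real here, so the two rates at the right pole, which differ by `i` times this root,
have equal real parts. -/
theorem discr_pi_eq : 4 * coeffCpi P - coeffB P ^ 2 = ((2 * σ / P.α : ℝ) : ℂ) ^ 2 := by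
  rw [hP.coeffB_eq, hP.coeffCpi_eq]
  have : (P.α : ℂ) ≠ 0 := by exact_mod_cast hP.α_pos.ne'
  push_cast
  field_simp
  ring_nf
  rw [Complex.I_sq]
  ring

theorem div_pos' : 0 < 2 * σ / P.α := div_pos (mul_pos two_pos hP.σ_pos) hP.α_pos

theorem re_discr_zero_pos : 0 < ((2 * σ / P.α : ℝ) - 4 * σ * Complex.I : ℂ).re := by
  have := hP.div_pos'
  simpa using this

theorem zZeroMinus_eq : zZeroMinus P = σ := by
  rw [zZeroMinus, hP.discr_zero_eq, sq_cpow_half hP.re_discr_zero_pos, hP.coeffB_eq]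
  ring_nf
  rw [Complex.I_sq]
  ring

theorem zPiMinus_eq : zPiMinus P = σ := by
  rw [zPiMinus, hP.discr_pi_eq, sq_cpow_half (by simpa using hP.div_pos'), hP.coeffB_eq]
  ring

theorem contDiffAt_zZeroMinus : ContDiffAt ℝ ω zZeroMinus P := by
  have hc : ContDiffAt ℝ ω (fun P : Param => (1 + P.c)) P := by fun_prop
  have h1 : ContDiffAt ℝ ω coeffC0 P := by
    unfold coeffC0
    have : ContDiffAt ℝ ω (fun P : Param => P.β / (1 + P.c)) P :=
      ContDiffAt.div (by fun_prop) (by fun_prop) (by simp [hP.c_eq])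
    fun_prop
  have h2 : ContDiffAt ℝ ω coeffB P := by
    unfold coeffB
    fun_prop
  have h3 := contDiffAt_cpow_const (f := fun P => -4 * coeffC0 P - coeffB P ^ 2) (x₀ := P)
    (by fun_prop) (by rw [hP.discr_zero_eq]; exact sq_mem_slitPlane hP.re_discr_zero_pos)
    (1 / 2 : ℂ)
  unfold zZeroMinus
  exact contDiffAt_cdiv (by fun_prop) contDiffAt_const two_ne_zero

theorem contDiffAt_zPiMinus : ContDiffAt ℝ ω zPiMinus P := by
  have h1 : ContDiffAt ℝ ω coeffCpi P := by
    unfold coeffCpi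
    have : ContDiffAt ℝ ω (fun P : Param => P.β / (1 - P.c)) P :=
      ContDiffAt.div (by fun_prop) (by fun_prop) (by simp [hP.c_eq])
    fun_prop
  have h2 := contDiffAt_coeffB P
  have h3 := contDiffAt_cpow_const (f := fun P => 4 * coeffCpi P - coeffB P ^ 2) (x₀ := P)
    (by fun_prop) (by rw [hP.discr_pi_eq]; exact sq_mem_slitPlane (by simpa using hP.div_pos'))
    (1 / 2 : ℂ)
  unfold zPiMinus
  exact contDiffAt_cdiv (by fun_prop) contDiffAt_const two_ne_zero

end IsCenterPoint

/-- The right hand side of the equation `x'' = F(x, x')` in the stereographic chart around the pole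
`ε e₃`, up to the linear coefficient `K`. -/
def chartField (ε : ℝ) (P : Param) (K x v : ℂ) : ℂ := coeffB P * v + K * x + cubic ε P 1 x v

/-! ### The unstable manifold of the left pole -/

/-- The rate of decay of the wall at the left end. -/
def leftRate (P : Param) : ℝ := (zZeroMinus P).re

/-- The exponent of the singular equation for the correction on the left. -/
def leftExponent (P : Param) : ℂ :=
  (2 * leftRate P - coeffB P + 2 * zZeroMinus P) / (2 * leftRate P)

/-- The derivative of the profile with respect to `ρ`, up to normalization. -/
def leftSlope (R : ℝ) (x : UnitFun) : UnitFun :=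
  (1 + (R : ℂ) • UnitFun.ident) * (1 + (R : ℂ) • UnitFun.ident) * x

/-- The profile of the wall relative to the exponential. -/
def leftProfile (P : Param) (R : ℝ) (x : UnitFun) : UnitFun :=
  1 + ((R : ℂ) / (2 * leftRate P)) • UnitFun.primitive (leftSlope R x)

/-- The integrand of the fixed point equation on the left. -/
def leftIntegrand (a₀ : ℂ) (P : Param) (R : ℝ) (x : UnitFun) : UnitFun :=
  Ring.inverse (1 + (R : ℂ) • UnitFun.ident) * Ring.inverse (1 + (R : ℂ) • UnitFun.ident) *
    ((1 / (2 * leftRate P) : ℂ) • cubicOp 1 P ((R : ℂ) • UnitFun.ident) (leftProfile P R x)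
        ((R : ℂ) • UnitFun.ident * leftSlope R x + zZeroMinus P • leftProfile P R x)
      + (a₀ - leftExponent P) • leftSlope R x)
    - (2 : ℂ) • ((R : ℂ) • UnitFun.ident * Ring.inverse (1 + (R : ℂ) • UnitFun.ident) * x)

theorem one_add_smul_ident_ne_zero {R : ℝ} (hR : 0 ≤ R) (t : unitInterval) :
    (1 + (R : ℂ) • UnitFun.ident) t ≠ 0 := by
  have : 0 < 1 + R * t := by have := mul_nonneg hR t.2.1; linarith
  simp only [ContinuousMap.add_apply, ContinuousMap.one_apply, ContinuousMap.smul_apply,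
    UnitFun.ident_apply, smul_eq_mul]
  exact_mod_cast this.ne'

/-- With `ρ = R t` and `x = S / (1 + ρ)²`, where `S` is the slope, this is the right hand side of `t
x' + a₀ x = …`. The last term comes from differentiating the weight `(1 + ρ)²`; the term with `a₀ -
leftExponent P` allows the exponent of the kernel to be frozen at `a₀`. -/
theorem leftIntegrand_apply (a₀ : ℂ) {P : Param} (hc : |P.c| < 1) {R : ℝ} (hR : 0 ≤ R)
    (x : UnitFun) (t : unitInterval) :
    leftIntegrand a₀ P R x t =
      (1 + (R * t : ℝ) : ℂ)⁻¹ * (1 + (R * t : ℝ) : ℂ)⁻¹ *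
        ((1 / (2 * leftRate P)) * cubic 1 P (R * t) (leftProfile P R x t)
          ((R * t : ℝ) * leftSlope R x t + zZeroMinus P * leftProfile P R x t)
        + (a₀ - leftExponent P) * leftSlope R x t)
      - 2 * ((R * t : ℝ) * (1 + (R * t : ℝ) : ℂ)⁻¹ * x t) := by
  have h := one_add_smul_ident_ne_zero hR
  have hi := UnitFun.ringInverse_apply h
  simp only [leftIntegrand, ContinuousMap.sub_apply, ContinuousMap.mul_apply,
    ContinuousMap.add_apply, ContinuousMap.smul_apply, hi]
  rw [cubicOp_apply (Or.inl rfl) hc (r := fun t => R * t) (fun t => mul_nonneg hR t.2.1)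
    (fun t => by simp)]
  simp

theorem leftSlope_apply (R : ℝ) (x : UnitFun) (t : unitInterval) :
    leftSlope R x t = (1 + (R * t : ℝ) : ℂ) * (1 + (R * t : ℝ) : ℂ) * x t := by
  simp [leftSlope]

/-- The cut-off and the variable enter only through the product `R t`; the next two lemmas rest on
the same fact. -/
theorem leftSlope_dilate (R : ℝ) (s : unitInterval) (x : UnitFun) :
    leftSlope (s * R) (UnitFun.dilate s x) = UnitFun.dilate s (leftSlope R x) := by
  ext t
  simp only [leftSlope_apply, UnitFun.dilate_apply]
  have : ((s * t : unitInterval) : ℝ) = s * t := rfl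
  rw [this, show (s : ℝ) * R * t = R * (s * t) by ring]

theorem leftProfile_dilate (P : Param) (R : ℝ) (s : unitInterval) (x : UnitFun) :
    leftProfile P (s * R) (UnitFun.dilate s x) = UnitFun.dilate s (leftProfile P R x) := by
  ext t
  simp only [leftProfile, leftSlope_dilate, ContinuousMap.add_apply, ContinuousMap.smul_apply,
    ContinuousMap.one_apply, UnitFun.dilate_apply, smul_eq_mul]
  rw [← UnitFun.primitive_dilate]
  push_cast
  ring

theorem leftIntegrand_dilate (a₀ : ℂ) {P : Param} (hc : |P.c| < 1) {R : ℝ} (hR : 0 ≤ R)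
    (s : unitInterval) (x : UnitFun) :
    leftIntegrand a₀ P (s * R) (UnitFun.dilate s x)
      = UnitFun.dilate s (leftIntegrand a₀ P R x) := by
  ext t
  have : ((s * t : unitInterval) : ℝ) = s * t := rfl
  rw [leftIntegrand_apply a₀ hc (mul_nonneg s.2.1 hR),
    UnitFun.dilate_apply s (leftIntegrand a₀ P R x), leftIntegrand_apply a₀ hc hR, leftSlope_dilate, leftProfile_dilate]
  simp only [UnitFun.dilate_apply, this, show (s : ℝ) * R * t = R * (s * t) by ring]

/-- The fixed point map on the left. -/
def leftMap (a₀ : ℂ) (v : (Param × ℝ) × UnitFun) : UnitFun :=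
  UnitFun.average (UnitFun.pow (a₀ - 1)) (leftIntegrand a₀ v.1.1 v.1.2 v.2)

/-- Restricting a solution to a smaller range of `ρ` and rescaling to the unit interval gives the
solution for the smaller cut-off. -/
theorem leftMap_dilate (a₀ : ℂ) {P : Param} (hc : |P.c| < 1) {R : ℝ} (hR : 0 ≤ R)
    (s : unitInterval) {x : UnitFun} (hx : leftMap a₀ ((P, R), x) = x) :
    leftMap a₀ ((P, s * R), UnitFun.dilate s x) = UnitFun.dilate s x := by
  simp only [leftMap] at hx ⊢
  rw [leftIntegrand_dilate a₀ hc hR, UnitFun.average_dilate, hx]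

theorem leftRate_ne_zero {P : Param} {σ : ℝ} (hc : IsCenterPoint P σ) :
    ((2 : ℂ) * leftRate P) ≠ 0 := by
  have := hc.σ_pos.ne'
  simp [leftRate, hc.zZeroMinus_eq, this]

/-! ### Solving the left fixed point equation. -/

section Analytic

variable {E : Type*} [NormedAddCommGroup E] [NormedSpace ℝ E] {e₀ : E}

theorem contDiffAt_leftSlope {R : E → ℝ} {x : E → UnitFun} (hR : ContDiffAt ℝ ω R e₀)
    (hx : ContDiffAt ℝ ω x e₀) : ContDiffAt ℝ ω (fun e => leftSlope (R e) (x e)) e₀ := by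
  unfold leftSlope
  fun_prop

variable {σ : ℝ} {P : E → Param} (hc : IsCenterPoint (P e₀) σ) (hP : ContDiffAt ℝ ω P e₀)
include hc hP

theorem contDiffAt_leftRate : ContDiffAt ℝ ω (fun e => leftRate (P e)) e₀ := by
  have := hc.contDiffAt_zZeroMinus.comp e₀ hP
  unfold leftRate
  exact contDiffAt_re this

theorem contDiffAt_leftProfile {R : E → ℝ} {x : E → UnitFun} (hR : ContDiffAt ℝ ω R e₀)
    (hx : ContDiffAt ℝ ω x e₀) :
    ContDiffAt ℝ ω (fun e => leftProfile (P e) (R e) (x e)) e₀ := by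
  have h1 := contDiffAt_leftSlope hR hx
  have h2 := contDiffAt_leftRate hc hP
  have h3 : ContDiffAt ℝ ω (fun e => (R e : ℂ) / (2 * leftRate (P e))) e₀ :=
    contDiffAt_cdiv (by fun_prop) (by fun_prop) (leftRate_ne_zero hc)
  unfold leftProfile
  fun_prop

theorem contDiffAt_leftExponent : ContDiffAt ℝ ω (fun e => leftExponent (P e)) e₀ := by
  have h2 := contDiffAt_leftRate hc hP
  have h3 := hc.contDiffAt_zZeroMinus.comp e₀ hP
  have h4 := (contDiffAt_coeffB (P e₀)).comp e₀ hP
  unfold leftExponent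
  simp only [Function.comp_def] at h3 h4
  exact contDiffAt_cdiv (by fun_prop) (by fun_prop) (leftRate_ne_zero hc)

theorem contDiffAt_leftIntegrand (a₀ : ℂ) {R : E → ℝ} {x : E → UnitFun}
    (hR : ContDiffAt ℝ ω R e₀) (hx : ContDiffAt ℝ ω x e₀) (hR0 : 0 ≤ R e₀) :
    ContDiffAt ℝ ω (fun e => leftIntegrand a₀ (P e) (R e) (x e)) e₀ := by
  have h1 := contDiffAt_leftSlope hR hx
  have h2 := contDiffAt_leftRate hc hP
  have h3 := contDiffAt_leftProfile hc hP hR hx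
  have h4 := contDiffAt_leftExponent hc hP
  have h5 : ContDiffAt ℝ ω (fun e => (1 / (2 * leftRate (P e)) : ℂ)) e₀ :=
    contDiffAt_cdiv (by fun_prop) (by fun_prop) (leftRate_ne_zero hc)
  have h6 := contDiffAt_ringInverse_comp (f := fun e => 1 + (R e : ℂ) • UnitFun.ident)
    (by fun_prop) (one_add_smul_ident_ne_zero hR0)
  have h7 : ContDiffAt ℝ ω (fun e => zZeroMinus (P e)) e₀ := hc.contDiffAt_zZeroMinus.comp e₀ hP
  have h8 := contDiffAt_cubicOp (ε := 1) hP (ρ := fun e => (R e : ℂ) • UnitFun.ident)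
    (v := fun e => (R e : ℂ) • UnitFun.ident * leftSlope (R e) (x e)
      + zZeroMinus (P e) • leftProfile (P e) (R e) (x e))
    (by fun_prop) h3 (by fun_prop) (Or.inl rfl) (by simp [hc.c_eq])
    (r := fun t => R e₀ * t) (fun t => mul_nonneg hR0 t.2.1) (fun t => by simp)
  unfold leftIntegrand
  fun_prop

end Analytic

theorem leftSlope_zero (R : ℝ) : leftSlope R 0 = 0 := by simp [leftSlope]

theorem leftProfile_zero (P : Param) (R : ℝ) : leftProfile P R 0 = 1 := by
  rw [leftProfile, leftSlope_zero, map_zero]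
  ext t
  simp

namespace IsCenterPoint

variable {P₀ : Param} {σ : ℝ} (hc : IsCenterPoint P₀ σ)
include hc

theorem leftRate_eq : leftRate P₀ = σ := by simp [leftRate, hc.zZeroMinus_eq]

/-- At the center point the integrand vanishes to second order. -/
theorem leftIntegrand_eq {R : ℝ} (hR : 0 ≤ R) (x : UnitFun) :
    leftIntegrand (leftExponent P₀) P₀ R x = x *
      ((1 / σ : ℂ) • (star (leftProfile P₀ R x) * Ring.inverse (1 + (R : ℂ) • UnitFun.ident *
          (star (leftProfile P₀ R x) * leftProfile P₀ R x)) * ((R : ℂ) • UnitFun.ident) *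
          ((R : ℂ) • UnitFun.ident * leftSlope R x + (2 * σ : ℂ) • leftProfile P₀ R x))
        - (2 : ℂ) • ((R : ℂ) • UnitFun.ident * Ring.inverse (1 + (R : ℂ) • UnitFun.ident))) := by
  -- Here `c = 0`, `μ = -σ²` and `z = σ`, so the cubic term contains `v² - σ² y² = (v - σ y)(v + σ
  -- y)`, and `v - σ y` is `ρ` times the slope, which carries the factor `x`.
  have hσ : (σ : ℂ) ≠ 0 := by exact_mod_cast hc.σ_pos.ne'
  ext t
  have hd : ∀ t, (1 + (R : ℂ) • UnitFun.ident *
      (star (leftProfile P₀ R x) * leftProfile P₀ R x)) t ≠ 0 := fun t => by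
    have := one_add_mul_conj_ne_zero (mul_nonneg hR t.2.1) (leftProfile P₀ R x t)
    simpa using this
  rw [leftIntegrand_apply _ (by simp [hc.c_eq]) hR]
  simp only [ContinuousMap.sub_apply, ContinuousMap.mul_apply, ContinuousMap.add_apply,
    ContinuousMap.smul_apply, UnitFun.ringInverse_apply hd,
    UnitFun.ringInverse_apply (one_add_smul_ident_ne_zero hR), smul_eq_mul,
    ContinuousMap.one_apply, UnitFun.ident_apply, ContinuousMap.star_apply, hc.leftRate_eq,
    sub_self, zero_mul, add_zero, cubic, polarCoeff, hc.c_eq, Complex.ofReal_zero, mul_zero,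
    zero_div, sub_zero, hc.zZeroMinus_eq, hc.μ_eq, leftSlope_apply]
  have h1 := one_add_mul_conj_ne_zero (mul_nonneg hR t.2.1) (leftProfile P₀ R x t)
  have h2 : (1 : ℂ) + R * t ≠ 0 := by simpa using one_add_smul_ident_ne_zero hR t
  push_cast at h1 ⊢
  have : star (leftProfile P₀ R x t) = conj (leftProfile P₀ R x t) := rfl
  rw [this]
  field_simp
  ring

/-- The weight `(1 + ρ)²` in the slope solves the linearized equation along the explicit wall, so
nothing linear is left. This holds for every cut-off, hence the unstable manifold is controlled on
arbitrarily long pieces and not only near the pole. -/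
theorem hasFDerivAt_leftMap {R : ℝ} (hR : 0 ≤ R) :
    HasFDerivAt (fun x => leftMap (leftExponent P₀) ((P₀, R), x))
      (0 : UnitFun →L[ℝ] UnitFun) 0 := by
  have h1 : ContDiffAt ℝ ω (fun x : UnitFun => leftSlope R x) 0 :=
    contDiffAt_leftSlope contDiffAt_const contDiffAt_id
  have h2 : ContDiffAt ℝ ω (fun x : UnitFun => leftProfile P₀ R x) 0 :=
    contDiffAt_leftProfile (P := fun _ => P₀) hc contDiffAt_const contDiffAt_const contDiffAt_id
  have hσ : (σ : ℂ) ≠ 0 := by exact_mod_cast hc.σ_pos.ne'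
  have hd : ∀ t, (1 + (R : ℂ) • UnitFun.ident *
      (star (leftProfile P₀ R 0) * leftProfile P₀ R 0)) t ≠ 0 := fun t => by
    rw [leftProfile_zero]
    simpa using one_add_smul_ident_ne_zero hR t
  have h3 := contDiffAt_ringInverse_comp (f := fun x : UnitFun => 1 + (R : ℂ) • UnitFun.ident *
      (star (leftProfile P₀ R x) * leftProfile P₀ R x)) (x₀ := 0) (by fun_prop) hd
  have h4 : HasFDerivAt (fun x => leftIntegrand (leftExponent P₀) P₀ R x)
      (0 : UnitFun →L[ℝ] UnitFun) 0 := by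
    have := hasFDerivAt_zero_of_mul (f := fun x : UnitFun => x) (x₀ := (0 : UnitFun))
      (g := fun x => ((1 / σ : ℂ) • (star (leftProfile P₀ R x) *
        Ring.inverse (1 + (R : ℂ) • UnitFun.ident *
          (star (leftProfile P₀ R x) * leftProfile P₀ R x)) * ((R : ℂ) • UnitFun.ident) *
          ((R : ℂ) • UnitFun.ident * leftSlope R x + (2 * σ : ℂ) • leftProfile P₀ R x))
        - (2 : ℂ) • ((R : ℂ) • UnitFun.ident * Ring.inverse (1 + (R : ℂ) • UnitFun.ident))))
      differentiableAt_id rfl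
      (ContDiffAt.differentiableAt (n := ω) (by fun_prop) (by simp)) (by
        -- At `x = 0` the factor is `(1/σ) (2σρ) / (1 + ρ) - 2ρ / (1 + ρ) = 0`.
        simp only [leftProfile_zero, leftSlope_zero, star_one, mul_one, one_mul, mul_zero, zero_add]
        ext t
        simp only [ContinuousMap.sub_apply, ContinuousMap.smul_apply, ContinuousMap.mul_apply,
          ContinuousMap.one_apply, smul_eq_mul, mul_one, ContinuousMap.zero_apply]
        field_simp
        ring)
    exact this.congr_of_eventuallyEq (Eventually.of_forall fun x => hc.leftIntegrand_eq hR x)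
  have h5 := (((UnitFun.average (UnitFun.pow (leftExponent P₀ - 1))).restrictScalars
    ℝ).hasFDerivAt (x := leftIntegrand (leftExponent P₀) P₀ R 0)).comp (0 : UnitFun) h4
  rw [ContinuousLinearMap.comp_zero] at h5
  exact h5

theorem leftMap_zero {R : ℝ} (hR : 0 ≤ R) : leftMap (leftExponent P₀) ((P₀, R), 0) = 0 := by
  simp [leftMap, hc.leftIntegrand_eq hR]

/-- Analytic family of fixed points on the left. -/
theorem exists_left_fixedPoint {R : ℝ} (hR : 0 ≤ R) :
    ∃ ψ : Param × ℝ → UnitFun, ContDiffAt ℝ ω ψ (P₀, R) ∧ ψ (P₀, R) = 0 ∧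
      (∀ᶠ q in 𝓝 (P₀, R), leftMap (leftExponent P₀) (q, ψ q) = ψ q) ∧
      ∀ᶠ v in 𝓝 ((P₀, R), (0 : UnitFun)), leftMap (leftExponent P₀) v = v.2 → v.2 = ψ v.1 := by
  refine exists_analytic_fixedPoint ?_ (hc.leftMap_zero hR) (hc.hasFDerivAt_leftMap hR)
  exact contDiffAt_average _ (contDiffAt_leftIntegrand (P := fun v : (Param × ℝ) × UnitFun => v.1.1)
    (R := fun v => v.1.2) (x := fun v => v.2) (e₀ := ((P₀, R), (0 : UnitFun))) hc (by fun_prop) _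
    (by fun_prop) (by fun_prop) hR)

end IsCenterPoint

/-! ### From left fixed points back to solutions on the line. -/

/-- The rescaled variable `τ = ρ / R` with `ρ = exp (2 κ ξ)`. -/
def leftTime (P : Param) (R ξ : ℝ) : ℝ := exp (2 * leftRate P * ξ) / R

theorem hasDerivAt_leftTime (P : Param) (R ξ : ℝ) :
    HasDerivAt (leftTime P R) (2 * leftRate P * leftTime P R ξ) ξ := by
  have h := (((hasDerivAt_id ξ).const_mul (2 * leftRate P)).exp).div_const R
  convert! h using 1
  simp [leftTime]; ring

/-- The chart coordinate on the left in terms of the fixed point. -/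
def leftCoord (P : Param) (R : ℝ) (x : UnitFun) (ξ : ℝ) : ℂ :=
  Complex.exp (zZeroMinus P * ξ) * (leftProfile P R x).extend (leftTime P R ξ)

/-- The derivative of the chart coordinate on the left. -/
def leftVelocity (P : Param) (R : ℝ) (x : UnitFun) (ξ : ℝ) : ℂ :=
  Complex.exp (zZeroMinus P * ξ) * (zZeroMinus P * (leftProfile P R x).extend (leftTime P R ξ)
    + exp (2 * leftRate P * ξ) * (leftSlope R x).extend (leftTime P R ξ))

theorem normSq_exp_zZeroMinus (P : Param) (ξ : ℝ) :
    Complex.normSq (Complex.exp (zZeroMinus P * ξ)) = exp (2 * leftRate P * ξ) := by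
  rw [Complex.normSq_eq_norm_sq, Complex.norm_exp, ← Real.exp_nat_mul]
  congr 1
  simp [leftRate]
  ring

theorem hasDerivAt_cexp_mul (z : ℂ) (ξ : ℝ) :
    HasDerivAt (fun ξ : ℝ => Complex.exp (z * ξ)) (z * Complex.exp (z * ξ)) ξ := by
  have h := ((hasDerivAt_id (ξ : ℂ)).const_mul z).cexp.comp_ofReal
  convert! h using 1
  simp; ring

section

variable {P : Param} {R ξ : ℝ} {x : UnitFun} {a₀ : ℂ}

theorem leftTime_mem (hR : 0 < R) (hξ : exp (2 * leftRate P * ξ) < R) :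
    leftTime P R ξ ∈ Ioo (0 : ℝ) 1 :=
  ⟨div_pos (exp_pos _) hR, (div_lt_one hR).2 hξ⟩

theorem hasDerivAt_leftProfile_time (hR : 0 < R) (hκ : leftRate P ≠ 0)
    (hξ : exp (2 * leftRate P * ξ) < R) :
    HasDerivAt (fun ξ => (leftProfile P R x).extend (leftTime P R ξ))
      (exp (2 * leftRate P * ξ) * (leftSlope R x).extend (leftTime P R ξ)) ξ := by
  have hm := leftTime_mem hR hξ
  have h1 : HasDerivAt (leftProfile P R x).extend
      (((R : ℂ) / (2 * leftRate P)) * (leftSlope R x).extend (leftTime P R ξ))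
      (leftTime P R ξ) :=
    ((UnitFun.hasDerivAt_primitive (leftSlope R x) hm).const_mul
      ((R : ℂ) / (2 * leftRate P))).const_add 1
  have h2 := h1.scomp ξ (hasDerivAt_leftTime P R ξ)
  convert! h2 using 1
  rw [Complex.real_smul, leftTime]
  have h3 : (leftRate P : ℂ) ≠ 0 := by exact_mod_cast hκ
  have h4 : (R : ℂ) ≠ 0 := by exact_mod_cast hR.ne'
  push_cast
  field_simp

/-- Since `τ' = 2 κ τ`, the singular equation for `x` becomes regular in `ξ`. The auxiliary exponent
`a₀` and the weight `(1 + ρ)²` both drop out. -/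
theorem hasDerivAt_leftSlope_time (hR : 0 < R) (hκ : leftRate P ≠ 0) (hcP : |P.c| < 1)
    (ha : 0 < (a₀ - 1).re) (hx : leftMap a₀ ((P, R), x) = x)
    (hξ : exp (2 * leftRate P * ξ) < R) :
    HasDerivAt (fun ξ => (leftSlope R x).extend (leftTime P R ξ))
      (cubic 1 P (exp (2 * leftRate P * ξ)) ((leftProfile P R x).extend (leftTime P R ξ))
          (exp (2 * leftRate P * ξ) * (leftSlope R x).extend (leftTime P R ξ)
            + zZeroMinus P * (leftProfile P R x).extend (leftTime P R ξ))
        - (2 * leftRate P - coeffB P + 2 * zZeroMinus P)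
          * (leftSlope R x).extend (leftTime P R ξ)) ξ := by
  have hm := leftTime_mem hR hξ
  have hm' : leftTime P R ξ ∈ Icc (0 : ℝ) 1 := ⟨hm.1.le, hm.2.le⟩
  set τ := leftTime P R ξ with hτ
  have hRτ : R * τ = exp (2 * leftRate P * ξ) := by
    rw [hτ, leftTime]; field_simp
  have h1 := UnitFun.hasDerivAt_average_pow ha (leftIntegrand a₀ P R x) hm
  have hx' : UnitFun.average (UnitFun.pow (a₀ - 1)) (leftIntegrand a₀ P R x) = x := hx
  rw [hx'] at h1
  have h2 : HasDerivAt (fun t : ℝ => (1 + ((R * t : ℝ) : ℂ))) (R : ℂ) τ := by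
    have := (((hasDerivAt_id τ).const_mul R).ofReal_comp).const_add (1 : ℂ)
    simpa using this
  have h3 := ((h2.mul h2).mul h1).congr_of_eventuallyEq (f₁ := (leftSlope R x).extend) (by
    filter_upwards [Ioo_mem_nhds hm.1 hm.2] with t ht
    have ht' : t ∈ Icc (0 : ℝ) 1 := ⟨ht.1.le, ht.2.le⟩
    rw [UnitFun.extend_of_mem _ ht', leftSlope_apply]
    simp only [Pi.mul_apply]
    rw [UnitFun.extend_of_mem _ ht'])
  have h4 := h3.scomp ξ (hasDerivAt_leftTime P R ξ)
  convert! h4 using 1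
  rw [Complex.real_smul, ← hτ, UnitFun.extend_of_mem _ hm', UnitFun.extend_of_mem _ hm',
    UnitFun.extend_of_mem _ hm', UnitFun.extend_of_mem _ hm', leftIntegrand_apply a₀ hcP hR.le,
    leftSlope_apply]
  simp only [hRτ]
  have e1 : (1 : ℂ) + (exp (2 * leftRate P * ξ) : ℝ) ≠ 0 := by
    have : (0 : ℝ) < 1 + exp (2 * leftRate P * ξ) := by positivity
    exact_mod_cast this.ne'
  have e2 : (leftRate P : ℂ) ≠ 0 := by exact_mod_cast hκ
  have e3 : (τ : ℂ) ≠ 0 := by exact_mod_cast hm.1.ne'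
  have e4 : (R : ℂ) * τ = (exp (2 * leftRate P * ξ) : ℝ) := by exact_mod_cast hRτ
  simp only [Pi.mul_apply, leftExponent]
  simp only [hRτ]
  generalize cubic 1 P _ _ _ = N
  generalize x ⟨τ, hm'⟩ = X
  generalize (exp (2 * leftRate P * ξ) : ℝ) = ρ at *
  rw [← e4] at e1 ⊢
  push_cast
  field_simp
  ring

theorem hasDerivAt_leftCoord (hR : 0 < R) (hκ : leftRate P ≠ 0)
    (hξ : exp (2 * leftRate P * ξ) < R) :
    HasDerivAt (leftCoord P R x) (leftVelocity P R x ξ) ξ := by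
  convert! (hasDerivAt_cexp_mul (zZeroMinus P) ξ).mul
    (hasDerivAt_leftProfile_time (x := x) hR hκ hξ) using 1
  rw [leftVelocity]
  ring

theorem hasDerivAt_leftVelocity (hR : 0 < R) (hκ : leftRate P ≠ 0) (hcP : |P.c| < 1)
    (ha : 0 < (a₀ - 1).re) (hx : leftMap a₀ ((P, R), x) = x)
    (hξ : exp (2 * leftRate P * ξ) < R) :
    HasDerivAt (leftVelocity P R x)
      (chartField 1 P (coeffC0 P) (leftCoord P R x ξ) (leftVelocity P R x ξ)) ξ := by
  have h1 := hasDerivAt_leftProfile_time (x := x) hR hκ hξ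
  have h2 := hasDerivAt_leftSlope_time hR hκ hcP ha hx hξ
  have h3 : HasDerivAt (fun ξ : ℝ => ((exp (2 * leftRate P * ξ) : ℝ) : ℂ))
      (2 * leftRate P * exp (2 * leftRate P * ξ) : ℝ) ξ := by
    have := ((hasDerivAt_id ξ).const_mul (2 * leftRate P)).exp.ofReal_comp
    convert! this using 1
    simp; ring
  convert! (hasDerivAt_cexp_mul (zZeroMinus P) ξ).mul
    ((h1.const_mul (zZeroMinus P)).add (h3.mul h2)) using 1
  -- The characteristic equation `z² = B z + C⁰` removes the terms that are linear in the profile.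
  have hz := zZeroMinus_sq P
  rw [chartField, leftCoord, leftVelocity, cubic_mul, one_mul, normSq_exp_zZeroMinus,
    conj_mul_self_eq, normSq_exp_zZeroMinus]
  simp only [Pi.add_apply, Pi.mul_apply]
  rw [add_comm (zZeroMinus P * _)]
  generalize cubic 1 P _ _ _ = N
  generalize (leftProfile P R x).extend _ = Y
  push_cast
  linear_combination -(Complex.exp (zZeroMinus P * ξ) * Y) * hz

end

/-- The value is `2 + i/α`; positivity makes the kernel `v^(a₀-1)` an element of the function
algebra. -/
theorem zero_lt_re_leftExponent {P₀ : Param} {σ : ℝ} (hc : IsCenterPoint P₀ σ) :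
    0 < (leftExponent P₀ - 1).re := by
  have hσ : (σ : ℂ) ≠ 0 := by exact_mod_cast hc.σ_pos.ne'
  have hα : (P₀.α : ℂ) ≠ 0 := by exact_mod_cast hc.α_pos.ne'
  have : leftExponent P₀ - 1 = (2 : ℝ) + (1 / P₀.α : ℝ) * Complex.I := by
    rw [leftExponent, hc.leftRate_eq, hc.zZeroMinus_eq, hc.coeffB_eq]
    push_cast
    field_simp
    ring
  rw [this]
  simp

theorem abs_c_lt_one_eventually {P₀ : Param} {σ : ℝ} (hc : IsCenterPoint P₀ σ) :
    ∀ᶠ P in 𝓝 P₀, |P.c| < 1 := by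
  have h : Continuous fun P : Param => |P.c| := (continuous_apply 0).abs
  exact h.continuousAt.eventually_lt continuousAt_const (by simp [hc.c_eq])

theorem continuousAt_zZeroMinus {P₀ : Param} {σ : ℝ} (hc : IsCenterPoint P₀ σ) :
    ContinuousAt zZeroMinus P₀ := hc.contDiffAt_zZeroMinus.continuousAt

theorem leftRate_pos_eventually {P₀ : Param} {σ : ℝ} (hc : IsCenterPoint P₀ σ) :
    ∀ᶠ P in 𝓝 P₀, 0 < leftRate P := by
  have h : ContinuousAt leftRate P₀ :=
    Complex.continuous_re.continuousAt.comp (continuousAt_zZeroMinus hc)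
  exact continuousAt_const.eventually_lt h (by simp [hc.leftRate_eq, hc.σ_pos])

/-- The fixed points for different cut-offs are dilations of each other, hence depend analytically
on the parameters and the independent variable. -/
theorem eventually_contDiffAt_left {P₀ : Param} {σ : ℝ} (hc : IsCenterPoint P₀ σ) {R : ℝ}
    (hR : 0 < R) {x : Param → UnitFun} (hx : ContinuousAt x P₀) (hx0 : x P₀ = 0)
    (hfix : ∀ᶠ P in 𝓝 P₀, leftMap (leftExponent P₀) ((P, R), x P) = x P)
    {r : ℝ} (hr : r ∈ Ico 0 R) :
    ∀ᶠ q in 𝓝 (P₀, r), 0 < q.2 →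
      ContDiffAt ℝ ω (fun q : Param × ℝ => (leftProfile q.1 R (x q.1)).extend (q.2 / R)) q ∧
      ContDiffAt ℝ ω (fun q : Param × ℝ => (leftSlope R (x q.1)).extend (q.2 / R)) q := by
  -- A second analytic family, now with the cut-off near `r` as a parameter; its uniqueness clause
  -- will absorb the dilated fixed points.
  obtain ⟨ψ, hψ, hψ0, -, huniq⟩ := hc.exists_left_fixedPoint hr.1
  let sc : ℝ → unitInterval := fun t => projIcc 0 1 zero_le_one (t / R)
  have htend : Tendsto (fun q : Param × ℝ => (q, UnitFun.dilate (sc q.2) (x q.1)))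
      (𝓝 (P₀, r)) (𝓝 ((P₀, r), (0 : UnitFun))) := by
    refine (nhds_prod_eq (x := (P₀, r)) (y := (0 : UnitFun))).symm ▸ tendsto_id.prodMk ?_
    have h1 : Tendsto (fun q : Param × ℝ => ‖x q.1‖) (𝓝 (P₀, r)) (𝓝 0) := by
      have : ContinuousAt (fun q : Param × ℝ => ‖x q.1‖) (P₀, r) :=
        (ContinuousAt.comp (f := Prod.fst) (by exact hx) continuousAt_fst).norm
      simpa [ContinuousAt, hx0] using this
    exact squeeze_zero_norm (fun q => UnitFun.norm_dilate_le _ _) h1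
  have e1 := htend.eventually huniq
  have e2 : ∀ᶠ q : Param × ℝ in 𝓝 (P₀, r),
      leftMap (leftExponent P₀) ((q.1, R), x q.1) = x q.1 ∧ |q.1.c| < 1 := by
    have hf : ContinuousAt (Prod.fst : Param × ℝ → Param) (P₀, r) := continuousAt_fst
    exact hf.eventually (hfix.and (abs_c_lt_one_eventually hc))
  have e3 : ∀ᶠ q : Param × ℝ in 𝓝 (P₀, r), q.2 < R :=
    continuousAt_snd.eventually (gt_mem_nhds hr.2)
  -- The base point `r = 0` is allowed, so that a compact range of `r` can be covered, but a
  -- dilation factor `q.2 / R` makes sense only for `q.2 > 0`; hence the implication.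
  have e4 : ∀ᶠ q : Param × ℝ in 𝓝 (P₀, r), 0 < q.2 →
      UnitFun.dilate (sc q.2) (x q.1) = ψ q := by
    filter_upwards [e1, e2, e3] with q h1 h2 h3 h4
    have hs : ((sc q.2 : unitInterval) : ℝ) * R = q.2 := by
      have : q.2 / R ∈ Icc (0 : ℝ) 1 := ⟨(div_pos h4 hR).le, (div_lt_one hR).2 h3 |>.le⟩
      simp only [sc, projIcc_of_mem zero_le_one this]
      field_simp
    refine h1 ?_
    have := leftMap_dilate (leftExponent P₀) h2.2 hR.le (sc q.2) h2.1
    rwa [hs] at this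
  have e5 : ∀ᶠ q : Param × ℝ in 𝓝 (P₀, r), ContDiffAt ℝ ω ψ q := hψ.eventually (by simp)
  have e6 : ∀ᶠ q : Param × ℝ in 𝓝 (P₀, r), ContDiffAt ℝ ω zZeroMinus q.1 ∧ 0 < leftRate q.1 :=
    (continuousAt_fst : ContinuousAt (Prod.fst : Param × ℝ → Param) (P₀, r)).eventually
      ((hc.contDiffAt_zZeroMinus.eventually (by simp)).and (leftRate_pos_eventually hc))
  filter_upwards [e3, e4.eventually_nhds, e5, e6] with q h3 h4 h5 h6 hq
  have hpos : ∀ᶠ p : Param × ℝ in 𝓝 q, 0 < p.2 ∧ p.2 < R :=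
    continuousAt_snd.eventually ((lt_mem_nhds hq).and (gt_mem_nhds h3))
  -- The value at `ρ = p.2` is the value at the end point `1` of the fixed point with cut-off `p.2`.
  -- Dependence on the variable has thus become dependence on a parameter.
  have key : ∀ᶠ p : Param × ℝ in 𝓝 q,
      (leftProfile p.1 R (x p.1)).extend (p.2 / R) = leftProfile p.1 p.2 (ψ p) 1 ∧
      (leftSlope R (x p.1)).extend (p.2 / R) = leftSlope p.2 (ψ p) 1 := by
    filter_upwards [h4, hpos] with p h4 hp
    have hm : p.2 / R ∈ Icc (0 : ℝ) 1 := ⟨(div_pos hp.1 hR).le, ((div_lt_one hR).2 hp.2).le⟩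
    have hs : ((sc p.2 : unitInterval) : ℝ) * R = p.2 := by
      simp only [sc, projIcc_of_mem zero_le_one hm]
      field_simp
    rw [← h4 hp.1]
    have a1 := leftProfile_dilate p.1 R (sc p.2) (x p.1)
    have a2 := leftSlope_dilate R (sc p.2) (x p.1)
    rw [hs] at a1 a2
    rw [a1, a2]
    simp [UnitFun.extend, sc]
  have hR2 : ContDiffAt ℝ ω (fun p : Param × ℝ => leftSlope p.2 (ψ p)) q :=
    contDiffAt_leftSlope contDiffAt_snd h5
  have hκ : ContDiffAt ℝ ω (fun p : Param × ℝ => leftRate p.1) q :=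
    contDiffAt_re (h6.1.comp q contDiffAt_fst)
  have hR1 : ContDiffAt ℝ ω (fun p : Param × ℝ => leftProfile p.1 p.2 (ψ p)) q := by
    have : ContDiffAt ℝ ω (fun p : Param × ℝ => (p.2 : ℂ) / (2 * leftRate p.1)) q :=
      contDiffAt_cdiv (by fun_prop) (by fun_prop)
        (mul_ne_zero two_ne_zero (by exact_mod_cast h6.2.ne'))
    unfold leftProfile
    fun_prop
  exact ⟨(contDiffAt_eval 1 hR1).congr_of_eventuallyEq (key.mono fun p hp => hp.1),
    (contDiffAt_eval 1 hR2).congr_of_eventuallyEq (key.mono fun p hp => hp.2)⟩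

/-- The unstable manifold of the left pole, up to the cut-off `ρ ≤ R`. -/
theorem exists_left_solution {P₀ : Param} {σ : ℝ} (hc : IsCenterPoint P₀ σ) {R : ℝ} (hR : 0 < R) :
    ∃ ζ v : Param → ℝ → ℂ,
      (∀ ξ, ζ P₀ ξ = Complex.exp (σ * ξ) ∧ v P₀ ξ = σ * Complex.exp (σ * ξ)) ∧
      ∀ᶠ P in 𝓝 P₀,
        (∀ ξ, exp (2 * leftRate P * ξ) ≤ R →
          ContDiffAt ℝ ω (Function.uncurry ζ) (P, ξ) ∧ ContDiffAt ℝ ω (Function.uncurry v) (P, ξ) ∧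
          HasDerivAt (ζ P) (v P ξ) ξ ∧
          HasDerivAt (v P) (chartField 1 P (coeffC0 P) (ζ P ξ) (v P ξ)) ξ ∧ ζ P ξ ≠ 0) ∧
        Tendsto (ζ P) atBot (𝓝 0) ∧
        Tendsto (fun ξ => v P ξ / ζ P ξ) atBot (𝓝 (zZeroMinus P)) := by
  -- The cut-off `R + 1` keeps all points with `ρ ≤ R` in the interior of the interval.
  have hR' : 0 < R + 1 := by linarith
  obtain ⟨ψ, hψ, hψ0, hfix, -⟩ := hc.exists_left_fixedPoint hR'.le
  set x : Param → UnitFun := fun P => ψ (P, R + 1) with hx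
  have hxc : ContDiffAt ℝ ω x P₀ := hψ.comp P₀ (f := fun P => (P, R + 1)) (by fun_prop)
  have hfix' : ∀ᶠ P in 𝓝 P₀, leftMap (leftExponent P₀) ((P, R + 1), x P) = x P := by
    have : ContinuousAt (fun P : Param => (P, R + 1)) P₀ := by fun_prop
    exact this.eventually hfix
  -- Compactness of `[0, R]` yields one neighbourhood of `P₀` for all `ρ`.
  have hjoint : ∀ᶠ P in 𝓝 P₀, ∀ r ∈ Icc 0 R, 0 < r →
      ContDiffAt ℝ ω (fun q : Param × ℝ => (leftProfile q.1 (R + 1) (x q.1)).extend (q.2 / (R + 1)))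
        (P, r) ∧
      ContDiffAt ℝ ω (fun q : Param × ℝ => (leftSlope (R + 1) (x q.1)).extend (q.2 / (R + 1)))
        (P, r) :=
    isCompact_Icc.eventually_forall_of_forall_eventually
      (P := fun P r => 0 < r → ContDiffAt ℝ ω (fun q : Param × ℝ =>
          (leftProfile q.1 (R + 1) (x q.1)).extend (q.2 / (R + 1))) (P, r) ∧
        ContDiffAt ℝ ω (fun q : Param × ℝ => (leftSlope (R + 1) (x q.1)).extend (q.2 / (R + 1)))
          (P, r))
      fun r hr => eventually_contDiffAt_left hc hR' hxc.continuousAt hψ0 hfix'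
        ⟨hr.1, by linarith [hr.2]⟩
  -- The profile is identically `1` at `P₀`, so nearby it stays within distance `1` of it in the
  -- uniform norm.
  have hne : ∀ᶠ P in 𝓝 P₀, ∀ t, (leftProfile P (R + 1) (x P)).extend t ≠ 0 := by
    have h1 : ContinuousAt (fun P => leftProfile P (R + 1) (x P)) P₀ :=
      (contDiffAt_leftProfile (P := fun P => P) (R := fun _ => R + 1) hc contDiffAt_id
        contDiffAt_const hxc).continuousAt
    have h2 : leftProfile P₀ (R + 1) (x P₀) = 1 := by
      rw [hx]; simp only; rw [hψ0, leftProfile_zero]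
    have h3 := Metric.continuousAt_iff'.1 h1 1 one_pos
    filter_upwards [h3] with P hP t h0
    rw [h2, dist_eq_norm] at hP
    have h4 := UnitFun.norm_extend_le (leftProfile P (R + 1) (x P) - 1) t
    have h5 : (leftProfile P (R + 1) (x P) - 1).extend t
        = (leftProfile P (R + 1) (x P)).extend t - 1 := rfl
    rw [h5, h0] at h4
    simp at h4
    linarith
  refine ⟨fun P => leftCoord P (R + 1) (x P), fun P => leftVelocity P (R + 1) (x P), fun ξ => ?_, ?_⟩
  · have h2 : x P₀ = 0 := hψ0
    simp only [leftCoord, leftVelocity, h2, leftProfile_zero, leftSlope_zero, hc.zZeroMinus_eq]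
    simp only [UnitFun.extend, ContinuousMap.one_apply, ContinuousMap.zero_apply]
    constructor <;> ring
  · filter_upwards [hfix', hjoint, hne, abs_c_lt_one_eventually hc, leftRate_pos_eventually hc,
      hc.contDiffAt_zZeroMinus.eventually (by simp)] with P h1 h2 h3 h4 h5 h6
    have hρ : Tendsto (fun ξ : ℝ => exp (2 * leftRate P * ξ)) atBot (𝓝 0) :=
      tendsto_exp_atBot.comp (tendsto_id.const_mul_atBot (by positivity))
    have hτ : Tendsto (leftTime P (R + 1)) atBot (𝓝 0) := by
      have := hρ.div_const (R + 1)
      rw [zero_div] at this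
      exact this
    have hE : ∀ ξ : ℝ, Complex.exp (zZeroMinus P * ξ) ≠ 0 := fun ξ => Complex.exp_ne_zero _
    refine ⟨fun ξ hξ => ⟨?_, ?_, ?_, ?_, ?_⟩, ?_, ?_⟩
    · have hz : ContDiffAt ℝ ω (fun q : Param × ℝ => zZeroMinus q.1) (P, ξ) :=
        h6.comp (P, ξ) contDiffAt_fst
      have hk : ContDiffAt ℝ ω (fun q : Param × ℝ => leftRate q.1) (P, ξ) := contDiffAt_re hz
      have he : ContDiffAt ℝ ω (fun q : Param × ℝ => exp (2 * leftRate q.1 * q.2)) (P, ξ) :=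
        ContDiffAt.exp (by fun_prop)
      have h7 := (h2 _ ⟨(exp_pos _).le, hξ⟩ (exp_pos _)).1.comp (P, ξ)
        (f := fun q : Param × ℝ => (q.1, exp (2 * leftRate q.1 * q.2))) (by fun_prop)
      exact (contDiffAt_cexp (f := fun q : Param × ℝ => zZeroMinus q.1 * q.2) (by fun_prop)).mul h7
    · have hz : ContDiffAt ℝ ω (fun q : Param × ℝ => zZeroMinus q.1) (P, ξ) :=
        h6.comp (P, ξ) contDiffAt_fst
      have hk : ContDiffAt ℝ ω (fun q : Param × ℝ => leftRate q.1) (P, ξ) := contDiffAt_re hz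
      have he : ContDiffAt ℝ ω (fun q : Param × ℝ => exp (2 * leftRate q.1 * q.2)) (P, ξ) :=
        ContDiffAt.exp (by fun_prop)
      have h7 := (h2 _ ⟨(exp_pos _).le, hξ⟩ (exp_pos _)).1.comp (P, ξ)
        (f := fun q : Param × ℝ => (q.1, exp (2 * leftRate q.1 * q.2))) (by fun_prop)
      have h8 := (h2 _ ⟨(exp_pos _).le, hξ⟩ (exp_pos _)).2.comp (P, ξ)
        (f := fun q : Param × ℝ => (q.1, exp (2 * leftRate q.1 * q.2))) (by fun_prop)
      exact (contDiffAt_cexp (f := fun q : Param × ℝ => zZeroMinus q.1 * q.2) (by fun_prop)).mul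
        ((hz.mul h7).add ((contDiffAt_ofReal he).mul h8))
    · exact hasDerivAt_leftCoord hR' h5.ne' (by linarith)
    · exact hasDerivAt_leftVelocity hR' h5.ne' h4 (zero_lt_re_leftExponent hc) h1 (by linarith)
    · exact mul_ne_zero (hE ξ) (h3 _)
    · have h7 : Tendsto (fun ξ : ℝ => Complex.exp (zZeroMinus P * ξ)) atBot (𝓝 0) := by
        rw [tendsto_zero_iff_norm_tendsto_zero]
        simp only [Complex.norm_exp]
        refine tendsto_exp_atBot.comp ?_
        simp only [Complex.re_mul_ofReal]
        exact tendsto_id.const_mul_atBot h5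
      have h8 := ((leftProfile P (R + 1) (x P)).continuous_extend.tendsto 0).comp hτ
      have h9 := h7.mul h8
      rw [zero_mul] at h9
      exact h9
    -- The quotient is `z` plus `ρ` times slope over profile, and `ρ → 0`.
    · have h7 := ((leftProfile P (R + 1) (x P)).continuous_extend.tendsto 0).comp hτ
      have h8 := ((leftSlope (R + 1) (x P)).continuous_extend.tendsto 0).comp hτ
      have h9 := (((Complex.continuous_ofReal.tendsto 0).comp hρ).mul h8).div h7 (h3 0)
      have h10 := h9.const_add (zZeroMinus P)
      simp only [Complex.ofReal_zero, zero_mul, zero_div, add_zero] at h10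
      refine h10.congr fun ξ => ?_
      have := h3 (leftTime P (R + 1) ξ)
      have := hE ξ
      simp only [leftVelocity, leftCoord, Function.comp_apply, Pi.div_apply]
      field_simp

/-! ### The stable manifold of the right pole -/

/-- The first eigenvalue of the linearization at the right pole. -/
def eigOne (P : Param) : ℂ := -zPiMinus P

/-- The second eigenvalue of the linearization at the right pole. -/
def eigTwo (P : Param) : ℂ := coeffB P + zPiMinus P

/-- The coordinate around `-e₃` is the inverse of the one around `e₃`, so its rates are minus the
limits of `p + i q`. Both roots of `l² = B l - C^π` are used. -/
theorem eigOne_sq (P : Param) : eigOne P ^ 2 = coeffB P * eigOne P - coeffCpi P := by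
  have := zPiMinus_sq P
  unfold eigOne
  linear_combination this

theorem eigTwo_sq (P : Param) : eigTwo P ^ 2 = coeffB P * eigTwo P - coeffCpi P := by
  have := zPiMinus_sq P
  unfold eigTwo
  linear_combination this

/-- The reference rate of decay on the right. -/
def rightRate (σ : ℝ) : ℝ := 2 * σ / 3

/-- The exponent of an eigenvalue relative to the reference rate. -/
def relExponent (σ : ℝ) (l : ℂ) : ℂ := -1 - l / rightRate σ

/-- The nonlinearity in terms of the modulated eigencomponents. -/
def rightField (σ : ℝ) (P : Param) (Y : UnitFun × UnitFun) : UnitFun :=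
  cubicOp (-1) P (UnitFun.ident * UnitFun.ident)
    (UnitFun.pow (relExponent σ (eigOne P)) * Y.1 + UnitFun.pow (relExponent σ (eigTwo P)) * Y.2)
    (eigOne P • (UnitFun.pow (relExponent σ (eigOne P)) * Y.1)
      + eigTwo P • (UnitFun.pow (relExponent σ (eigTwo P)) * Y.2))

/-- The normalization in the variation of constants formula. -/
def rightCoeff (σ : ℝ) (P : Param) : ℂ := 1 / (rightRate σ * (eigOne P - eigTwo P))

theorem contDiffAt_unitFun_pow {E : Type*} [NormedAddCommGroup E] [NormedSpace ℝ E] {e₀ : E}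
    {f : E → ℂ} (hf : ContDiffAt ℝ ω f e₀) (h : 0 < (f e₀).re) :
    ContDiffAt ℝ ω (fun e => UnitFun.pow (f e)) e₀ :=
  (UnitFun.contDiffAt_pow h).comp e₀ hf

/-- The fixed point map on the right, with the asymptotic amplitudes as parameters. -/
def rightMap (σ : ℝ) (v : (Param × (ℂ × ℂ)) × (UnitFun × UnitFun)) : UnitFun × UnitFun :=
  (v.1.2.1 • (1 : UnitFun) - rightCoeff σ v.1.1 • UnitFun.primitive
      (UnitFun.pow (1 - relExponent σ (eigOne v.1.1)) * rightField σ v.1.1 v.2),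
   v.1.2.2 • (1 : UnitFun) + rightCoeff σ v.1.1 • UnitFun.primitive
      (UnitFun.pow (1 - relExponent σ (eigTwo v.1.1)) * rightField σ v.1.1 v.2))

theorem rightField_zero (σ : ℝ) (P : Param) : rightField σ P 0 = 0 := by
  simp [rightField, cubicOp]

/-- The exponents are in the range where the fixed point formulation makes sense. -/
structure RightAdmissible (σ : ℝ) (P : Param) : Prop where
  c_lt : |P.c| < 1
  one_pos : 0 < (relExponent σ (eigOne P)).re
  one_lt : (relExponent σ (eigOne P)).re < 1
  two_pos : 0 < (relExponent σ (eigTwo P)).re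
  two_lt : (relExponent σ (eigTwo P)).re < 1
  ne : eigOne P ≠ eigTwo P

namespace IsCenterPoint

variable {P₀ : Param} {σ : ℝ} (hc : IsCenterPoint P₀ σ)
include hc

theorem eigOne_eq : eigOne P₀ = -σ := by rw [eigOne, hc.zPiMinus_eq]

theorem eigTwo_eq : eigTwo P₀ = -σ - (2 * σ / P₀.α : ℝ) * Complex.I := by
  rw [eigTwo, hc.zPiMinus_eq, hc.coeffB_eq]; ring

theorem contDiffAt_eigOne : ContDiffAt ℝ ω eigOne P₀ := hc.contDiffAt_zPiMinus.neg

theorem contDiffAt_eigTwo : ContDiffAt ℝ ω eigTwo P₀ :=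
  (contDiffAt_coeffB P₀).add hc.contDiffAt_zPiMinus

theorem rightRate_pos : 0 < rightRate σ := by
  have := hc.σ_pos
  unfold rightRate; positivity

/-- With `s = exp (-ν t)` one has `exp (l t) = s^(1+p)`, where `p` is the relative exponent.
Continuity of `s^p` requires `re p > 0`, that of `s^(1-p)` in the integral equation requires `re p <
1`; the choice `ν = 2σ/3` puts `re p` in the middle. -/
theorem relExponent_one : (relExponent σ (eigOne P₀)).re = 1 / 2 := by
  have hσ : (σ : ℂ) ≠ 0 := by exact_mod_cast hc.σ_pos.ne'
  have : relExponent σ (eigOne P₀) = ((1 / 2 : ℝ) : ℂ) := by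
    rw [relExponent, hc.eigOne_eq, rightRate]
    push_cast
    field_simp
    ring
  rw [this, Complex.ofReal_re]

theorem relExponent_two : (relExponent σ (eigTwo P₀)).re = 1 / 2 := by
  have hσ : (σ : ℂ) ≠ 0 := by exact_mod_cast hc.σ_pos.ne'
  have hα : (P₀.α : ℂ) ≠ 0 := by exact_mod_cast hc.α_pos.ne'
  have : relExponent σ (eigTwo P₀) = ((1 / 2 : ℝ) : ℂ) + ((3 / P₀.α : ℝ) : ℂ) * Complex.I := by
    rw [relExponent, hc.eigTwo_eq, rightRate]
    push_cast
    field_simp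
    ring
  rw [this]
  simp

theorem eig_ne : eigOne P₀ ≠ eigTwo P₀ := by
  intro h
  have h1 := congrArg Complex.im h
  rw [hc.eigOne_eq, hc.eigTwo_eq] at h1
  have := hc.div_pos'
  simp at h1
  rcases h1 with h1 | h1
  · exact hc.σ_pos.ne' h1
  · exact hc.α_pos.ne' h1

theorem rightAdmissible : RightAdmissible σ P₀ where
  c_lt := by simp [hc.c_eq]
  one_pos := by rw [hc.relExponent_one]; norm_num
  one_lt := by rw [hc.relExponent_one]; norm_num
  two_pos := by rw [hc.relExponent_two]; norm_num
  two_lt := by rw [hc.relExponent_two]; norm_num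
  ne := hc.eig_ne

theorem contDiffAt_relExponent {l : Param → ℂ} (hl : ContDiffAt ℝ ω l P₀) :
    ContDiffAt ℝ ω (fun P => relExponent σ (l P)) P₀ := by
  have : ((rightRate σ : ℝ) : ℂ) ≠ 0 := by exact_mod_cast hc.rightRate_pos.ne'
  unfold relExponent
  exact contDiffAt_const.sub (contDiffAt_cdiv hl contDiffAt_const this)

theorem rightAdmissible_eventually : ∀ᶠ P in 𝓝 P₀, RightAdmissible σ P := by
  have h1 : ContinuousAt (fun P => (relExponent σ (eigOne P)).re) P₀ :=
    (contDiffAt_re (hc.contDiffAt_relExponent hc.contDiffAt_eigOne)).continuousAt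
  have h2 : ContinuousAt (fun P => (relExponent σ (eigTwo P)).re) P₀ :=
    (contDiffAt_re (hc.contDiffAt_relExponent hc.contDiffAt_eigTwo)).continuousAt
  have h3 := hc.contDiffAt_eigOne.continuousAt.sub hc.contDiffAt_eigTwo.continuousAt
  have h4 := hc.rightAdmissible
  filter_upwards [abs_c_lt_one_eventually hc, h1.eventually (lt_mem_nhds h4.one_pos),
    h1.eventually (gt_mem_nhds h4.one_lt), h2.eventually (lt_mem_nhds h4.two_pos),
    h2.eventually (gt_mem_nhds h4.two_lt), h3.eventually_ne (sub_ne_zero.2 h4.ne)]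
    with P a1 a2 a3 a4 a5 a6
  exact ⟨a1, a2, a3, a4, a5, sub_ne_zero.1 a6⟩

variable {E : Type*} [NormedAddCommGroup E] [NormedSpace ℝ E] {e₀ : E}

theorem contDiffAt_rightField {P : E → Param} {Y : E → UnitFun × UnitFun} (h₀ : P e₀ = P₀)
    (hP : ContDiffAt ℝ ω P e₀) (hY : ContDiffAt ℝ ω Y e₀) :
    ContDiffAt ℝ ω (fun e => rightField σ (P e) (Y e)) e₀ := by
  subst h₀
  have h1 : ContDiffAt ℝ ω (fun e => eigOne (P e)) e₀ := hc.contDiffAt_eigOne.comp e₀ hP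
  have h2 : ContDiffAt ℝ ω (fun e => eigTwo (P e)) e₀ := hc.contDiffAt_eigTwo.comp e₀ hP
  have h3 : ContDiffAt ℝ ω (fun e => UnitFun.pow (relExponent σ (eigOne (P e)))) e₀ :=
    contDiffAt_unitFun_pow (f := fun e => relExponent σ (eigOne (P e)))
      ((hc.contDiffAt_relExponent hc.contDiffAt_eigOne).comp e₀ hP) hc.rightAdmissible.one_pos
  have h4 : ContDiffAt ℝ ω (fun e => UnitFun.pow (relExponent σ (eigTwo (P e)))) e₀ :=
    contDiffAt_unitFun_pow (f := fun e => relExponent σ (eigTwo (P e)))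
      ((hc.contDiffAt_relExponent hc.contDiffAt_eigTwo).comp e₀ hP) hc.rightAdmissible.two_pos
  unfold rightField
  refine contDiffAt_cubicOp hP contDiffAt_const (by fun_prop) (by fun_prop) (Or.inr rfl)
    hc.rightAdmissible.c_lt (r := fun t => (t : ℝ) * t) (fun t => mul_self_nonneg _) (fun t => ?_)
  simp

theorem contDiffAt_rightCoeff : ContDiffAt ℝ ω (rightCoeff σ) P₀ := by
  have h1 := hc.contDiffAt_eigOne
  have h2 := hc.contDiffAt_eigTwo
  have : ((rightRate σ : ℝ) : ℂ) ≠ 0 := by exact_mod_cast hc.rightRate_pos.ne'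
  unfold rightCoeff
  exact contDiffAt_cdiv contDiffAt_const (by fun_prop)
    (mul_ne_zero this (sub_ne_zero.2 hc.eig_ne))

theorem contDiffAt_rightMap {P : E → Param} {a : E → ℂ × ℂ} {Y : E → UnitFun × UnitFun}
    (h₀ : P e₀ = P₀) (hP : ContDiffAt ℝ ω P e₀) (ha : ContDiffAt ℝ ω a e₀)
    (hY : ContDiffAt ℝ ω Y e₀) :
    ContDiffAt ℝ ω (fun e => rightMap σ ((P e, a e), Y e)) e₀ := by
  have h := hc.contDiffAt_rightField h₀ hP hY
  subst h₀
  have hc1 : 0 < (1 - relExponent σ (eigOne (P e₀))).re := by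
    have := hc.rightAdmissible.one_lt
    simp; linarith
  have hc2 : 0 < (1 - relExponent σ (eigTwo (P e₀))).re := by
    have := hc.rightAdmissible.two_lt
    simp; linarith
  have h3 : ContDiffAt ℝ ω (fun e => UnitFun.pow (1 - relExponent σ (eigOne (P e)))) e₀ :=
    contDiffAt_unitFun_pow (f := fun e => 1 - relExponent σ (eigOne (P e)))
      (contDiffAt_const.sub
        ((hc.contDiffAt_relExponent hc.contDiffAt_eigOne).comp e₀ hP)) hc1
  have h4 : ContDiffAt ℝ ω (fun e => UnitFun.pow (1 - relExponent σ (eigTwo (P e)))) e₀ :=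
    contDiffAt_unitFun_pow (f := fun e => 1 - relExponent σ (eigTwo (P e)))
      (contDiffAt_const.sub
        ((hc.contDiffAt_relExponent hc.contDiffAt_eigTwo).comp e₀ hP)) hc2
  have h5 : ContDiffAt ℝ ω (fun e => rightCoeff σ (P e)) e₀ := hc.contDiffAt_rightCoeff.comp e₀ hP
  exact ((ha.fst.smul contDiffAt_const).sub (h5.smul (contDiffAt_primitive (h3.mul h)))).prodMk
    ((ha.snd.smul contDiffAt_const).add (h5.smul (contDiffAt_primitive (h4.mul h))))

/-- The nonlinearity is `conj y` times a factor that also vanishes at zero. -/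
theorem hasFDerivAt_rightField :
    HasFDerivAt (fun Y => rightField σ P₀ Y) (0 : UnitFun × UnitFun →L[ℝ] UnitFun) 0 := by
  have hd := hc.rightAdmissible
  set y : UnitFun × UnitFun → UnitFun := fun Y =>
    UnitFun.pow (relExponent σ (eigOne P₀)) * Y.1 + UnitFun.pow (relExponent σ (eigTwo P₀)) * Y.2
    with hy
  set v : UnitFun × UnitFun → UnitFun := fun Y =>
    eigOne P₀ • (UnitFun.pow (relExponent σ (eigOne P₀)) * Y.1)
      + eigTwo P₀ • (UnitFun.pow (relExponent σ (eigTwo P₀)) * Y.2) with hv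
  have hy1 : ContDiffAt ℝ ω y 0 := by fun_prop
  have hv1 : ContDiffAt ℝ ω v 0 := by fun_prop
  have hy0 : y 0 = 0 := by simp [hy]
  have hv0 : v 0 = 0 := by
    simp only [hv, Prod.fst_zero, Prod.snd_zero, mul_zero]; ext t; simp
  have h1 := contDiffAt_ringInverse_comp (x₀ := (0 : UnitFun × UnitFun))
    (f := fun Y => 1 + UnitFun.ident * UnitFun.ident * (star (y Y) * y Y)) (by fun_prop)
    (fun t => by simp [hy0])
  have h2 := contDiffAt_ringInverse_comp (x₀ := (0 : UnitFun × UnitFun))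
    (f := fun Y => ((1 + P₀.c * (-1) : ℝ) : ℂ) • (1 : UnitFun) + ((1 - P₀.c * (-1) : ℝ) : ℂ) •
      (UnitFun.ident * UnitFun.ident * (star (y Y) * y Y))) (by fun_prop)
    (fun t => by simp [hy0, hc.c_eq])
  refine hasFDerivAt_zero_of_mul (f := fun Y => star (y Y))
    (g := fun Y => y Y * y Y * ((2 * P₀.μ : ℂ) •
        Ring.inverse (1 + UnitFun.ident * UnitFun.ident * (star (y Y) * y Y))
      - polarCoeff (-1) P₀ • Ring.inverse (((1 + P₀.c * (-1) : ℝ) : ℂ) • (1 : UnitFun)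
          + ((1 - P₀.c * (-1) : ℝ) : ℂ) • (UnitFun.ident * UnitFun.ident * (star (y Y) * y Y))))
    + (2 : ℂ) • (v Y * v Y * Ring.inverse (1 + UnitFun.ident * UnitFun.ident * (star (y Y) * y Y))))
    ?_ ?_ ?_ ?_
  · exact ContDiffAt.differentiableAt (n := ω) (by fun_prop) (by simp)
  · simp [hy0]
  · exact ContDiffAt.differentiableAt (n := ω) (by fun_prop) (by simp)
  · simp only [hy0, hv0, zero_mul, zero_add]; ext t; simp

theorem hasFDerivAt_rightMap :
    HasFDerivAt (fun Y => rightMap σ ((P₀, 0), Y))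
      (0 : UnitFun × UnitFun →L[ℝ] UnitFun × UnitFun) 0 := by
  have h := hc.hasFDerivAt_rightField
  have key : ∀ (k : UnitFun) (b c : ℂ), HasFDerivAt (fun Y => b • (1 : UnitFun) +
      c • UnitFun.primitive (k * rightField σ P₀ Y)) (0 : UnitFun × UnitFun →L[ℝ] UnitFun) 0 := by
    intro k b c
    have h1 : HasFDerivAt (fun Y => k * rightField σ P₀ Y)
        (0 : UnitFun × UnitFun →L[ℝ] UnitFun) 0 := by
      have := ((ContinuousLinearMap.mul ℝ UnitFun k).hasFDerivAt
        (x := rightField σ P₀ 0)).comp (0 : UnitFun × UnitFun) h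
      rw [ContinuousLinearMap.comp_zero] at this
      exact this
    have h2 := ((UnitFun.primitive.restrictScalars ℝ).hasFDerivAt
      (x := k * rightField σ P₀ 0)).comp (0 : UnitFun × UnitFun) h1
    rw [ContinuousLinearMap.comp_zero] at h2
    have h3 := (h2.const_smul c).const_add (b • (1 : UnitFun))
    rw [smul_zero] at h3
    exact h3
  have h1 := key (UnitFun.pow (1 - relExponent σ (eigOne P₀))) 0 (-rightCoeff σ P₀)
  have h2 := key (UnitFun.pow (1 - relExponent σ (eigTwo P₀))) 0 (rightCoeff σ P₀)
  have h3 := h1.prodMk h2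
  convert! h3 using 1
  · ext Y t <;> simp [rightMap, sub_eq_add_neg]

/-- Analytic family of fixed points on the right, parametrized by the asymptotic amplitudes. -/
theorem exists_right_fixedPoint : ∃ r > 0, ∃ ψ : Param × (ℂ × ℂ) → UnitFun × UnitFun,
    ψ (P₀, 0) = 0 ∧
    (∀ q ∈ Metric.ball (P₀, (0 : ℂ × ℂ)) r, ContDiffAt ℝ ω ψ q ∧ rightMap σ (q, ψ q) = ψ q) ∧
    ∀ q ∈ Metric.ball (P₀, (0 : ℂ × ℂ)) r, ∀ Y, ‖Y‖ < r → rightMap σ (q, Y) = Y → Y = ψ q := by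
  have h0 : rightMap σ ((P₀, 0), 0) = 0 := by
    simp only [rightMap, rightField_zero, mul_zero, map_zero]
    ext t <;> simp
  obtain ⟨ψ, h1, h2, h3, h4⟩ := exists_analytic_fixedPoint
    (hc.contDiffAt_rightMap (E := (Param × (ℂ × ℂ)) × (UnitFun × UnitFun)) (e₀ := ((P₀, 0), 0))
      (P := fun v => v.1.1) (a := fun v => v.1.2) (Y := fun v => v.2) rfl
      contDiffAt_fst.fst contDiffAt_fst.snd contDiffAt_snd) h0
    hc.hasFDerivAt_rightMap
  obtain ⟨r₁, hr₁, h5⟩ := Metric.eventually_nhds_iff_ball.1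
    ((h1.eventually (by simp)).and h3)
  obtain ⟨r₂, hr₂, h6⟩ := Metric.eventually_nhds_iff_ball.1 h4
  refine ⟨min r₁ r₂, lt_min hr₁ hr₂, ψ, h2, fun q hq => h5 q ?_, fun q hq Y hY => h6 (q, Y) ?_⟩
  · exact Metric.ball_subset_ball (min_le_left _ _) hq
  · rw [Metric.mem_ball, Prod.dist_eq, max_lt_iff]
    exact ⟨(Metric.mem_ball.1 hq).trans_le (min_le_right _ _),
      by simpa using hY.trans_le (min_le_right _ _)⟩

end IsCenterPoint

/-! ### Time translations, and the differential equation solved by the right fixed points. -/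

theorem cpow_one_add_relExponent {σ t : ℝ} (hσ : 0 < rightRate σ) (l : ℂ) :
    ((exp (-rightRate σ * t) : ℝ) : ℂ) ^ (1 + relExponent σ l) = Complex.exp (l * t) := by
  have h0 : ((exp (-rightRate σ * t) : ℝ) : ℂ) ≠ 0 := by exact_mod_cast (exp_pos _).ne'
  have h1 : ((rightRate σ : ℝ) : ℂ) ≠ 0 := by exact_mod_cast hσ.ne'
  rw [Complex.cpow_def_of_ne_zero h0, ← Complex.ofReal_log (exp_pos _).le, Real.log_exp,
    relExponent]
  congr 1
  push_cast
  field_simp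
  ring

theorem rightField_apply {σ : ℝ} {P : Param} (h : RightAdmissible σ P) (Y : UnitFun × UnitFun)
    (t : unitInterval) :
    rightField σ P Y t = cubic (-1) P ((t : ℝ) * t)
      (((t : ℝ) : ℂ) ^ relExponent σ (eigOne P) * Y.1 t
        + ((t : ℝ) : ℂ) ^ relExponent σ (eigTwo P) * Y.2 t)
      (eigOne P * (((t : ℝ) : ℂ) ^ relExponent σ (eigOne P) * Y.1 t)
        + eigTwo P * (((t : ℝ) : ℂ) ^ relExponent σ (eigTwo P) * Y.2 t)) := by
  rw [rightField, cubicOp_apply (Or.inr rfl) h.c_lt (r := fun t => (t : ℝ) * t)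
    (fun t => mul_self_nonneg _) (fun t => by simp)]
  simp [UnitFun.pow_apply h.one_pos, UnitFun.pow_apply h.two_pos]

theorem cubic_real_mul (ε : ℝ) (P : Param) (r s : ℝ) (y v : ℂ) :
    cubic ε P r (s * y) (s * v) = (s : ℂ) ^ 3 * cubic ε P (r * (s * s)) y v := by
  rw [cubic_mul, Complex.conj_ofReal, Complex.normSq_ofReal]
  ring

/-- The action of a time translation on the modulated components. -/
def shift (σ : ℝ) (P : Param) (s : unitInterval) (Y : UnitFun × UnitFun) : UnitFun × UnitFun :=
  (((s : ℝ) : ℂ) ^ (1 + relExponent σ (eigOne P)) • UnitFun.dilate s Y.1,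
    ((s : ℝ) : ℂ) ^ (1 + relExponent σ (eigTwo P)) • UnitFun.dilate s Y.2)

/-- A translation multiplies both modulated components by the same factor `s` after dilation, and
the nonlinearity is homogeneous of degree three if the weight is rescaled with it. -/
theorem rightField_shift {σ : ℝ} {P : Param} (h : RightAdmissible σ P) {s : unitInterval}
    (hs : 0 < (s : ℝ)) (Y : UnitFun × UnitFun) :
    rightField σ P (shift σ P s Y) = ((s : ℝ) : ℂ) ^ 3 • UnitFun.dilate s (rightField σ P Y) := by
  ext t
  have hs0 : ((s : ℝ) : ℂ) ≠ 0 := by exact_mod_cast hs.ne'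
  rw [rightField_apply h, ContinuousMap.smul_apply, UnitFun.dilate_apply, rightField_apply h]
  have e : ((s * t : unitInterval) : ℝ) = s * t := rfl
  have e1 : ∀ (p y : ℂ), ((t : ℝ) : ℂ) ^ p * (((s : ℝ) : ℂ) ^ (1 + p) * y)
      = ((s : ℝ) : ℂ) * ((((s * t : unitInterval) : ℝ) : ℂ) ^ p * y) := fun p y => by
    rw [e, Complex.ofReal_mul, Complex.mul_cpow_ofReal_nonneg s.2.1 t.2.1,
      Complex.cpow_add _ _ hs0, Complex.cpow_one]
    ring
  simp only [shift, ContinuousMap.smul_apply, UnitFun.dilate_apply, smul_eq_mul, e1]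
  have e2 : ∀ a b c d : ℂ, a * (((s : ℝ) : ℂ) * b) + c * (((s : ℝ) : ℂ) * d)
      = ((s : ℝ) : ℂ) * (a * b + c * d) := fun a b c d => by ring
  rw [e2, ← mul_add, cubic_real_mul, e]
  congr 2
  ring

/-- The equation is autonomous: translating time by `t` multiplies the asymptotic amplitudes by `exp
(l t) = s^(1+p)`. -/
theorem rightMap_shift {σ : ℝ} {P : Param} (h : RightAdmissible σ P) {s : unitInterval}
    (hs : 0 < (s : ℝ)) {a : ℂ × ℂ} {Y : UnitFun × UnitFun} (hY : rightMap σ ((P, a), Y) = Y) :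
    rightMap σ ((P, (((s : ℝ) : ℂ) ^ (1 + relExponent σ (eigOne P)) * a.1,
      ((s : ℝ) : ℂ) ^ (1 + relExponent σ (eigTwo P)) * a.2)), shift σ P s Y) = shift σ P s Y := by
  have hs0 : ((s : ℝ) : ℂ) ≠ 0 := by exact_mod_cast hs.ne'
  have key : ∀ p : ℂ, 0 < (1 - p).re → UnitFun.primitive (UnitFun.pow (1 - p) *
      rightField σ P (shift σ P s Y)) = ((s : ℝ) : ℂ) ^ (1 + p) •
        UnitFun.dilate s (UnitFun.primitive (UnitFun.pow (1 - p) * rightField σ P Y)) := by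
    intro p hp
    have e1 : UnitFun.pow (1 - p) * rightField σ P (shift σ P s Y)
        = ((s : ℝ) : ℂ) ^ (2 + p) •
          UnitFun.dilate s (UnitFun.pow (1 - p) * rightField σ P Y) := by
      rw [rightField_shift h hs]
      ext t
      have e : ((s * t : unitInterval) : ℝ) = s * t := rfl
      have e3 : ((s : ℝ) : ℂ) ^ (2 + p) * ((s : ℝ) : ℂ) ^ (1 - p) = ((s : ℝ) : ℂ) ^ 3 := by
        rw [← Complex.cpow_add _ _ hs0, ← Complex.cpow_natCast]
        congr 1
        push_cast; ring
      simp only [ContinuousMap.mul_apply, ContinuousMap.smul_apply, UnitFun.dilate_apply,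
        smul_eq_mul, UnitFun.pow_apply hp, e, Complex.ofReal_mul,
        Complex.mul_cpow_ofReal_nonneg s.2.1 t.2.1]
      rw [← e3]
      ring
    rw [e1, map_smul]
    ext t
    have e2 := UnitFun.primitive_dilate s (UnitFun.pow (1 - p) * rightField σ P Y) t
    simp only [ContinuousMap.smul_apply, UnitFun.dilate_apply, smul_eq_mul]
    -- Of the power `s^(2+p)` one factor `s` is consumed by the substitution in the primitive.
    rw [← e2, show 2 + p = (1 + p) + 1 by ring, Complex.cpow_add _ _ hs0, Complex.cpow_one]
    ring
  have h1 : 0 < (1 - relExponent σ (eigOne P)).re := by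
    have := h.one_lt
    simp; linarith
  have h2 : 0 < (1 - relExponent σ (eigTwo P)).re := by
    have := h.two_lt
    simp; linarith
  have hY1 := congrArg Prod.fst hY
  have hY2 := congrArg Prod.snd hY
  simp only [rightMap] at hY1 hY2
  refine Prod.ext ?_ ?_
  · simp only [rightMap]
    rw [key _ h1]
    ext t
    have := congrArg (fun f : UnitFun => f (s * t)) hY1
    simp only [ContinuousMap.sub_apply, ContinuousMap.smul_apply, smul_eq_mul,
      ContinuousMap.one_apply, mul_one, shift, UnitFun.dilate_apply] at this ⊢
    rw [← this]
    ring
  · simp only [rightMap]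
    rw [key _ h2]
    ext t
    have := congrArg (fun f : UnitFun => f (s * t)) hY2
    simp only [ContinuousMap.add_apply, ContinuousMap.smul_apply, smul_eq_mul,
      ContinuousMap.one_apply, mul_one, shift, UnitFun.dilate_apply] at this ⊢
    rw [← this]
    ring

/-- The chart coordinate on the right in terms of the fixed point. -/
def rightCoord (σ : ℝ) (P : Param) (Y : UnitFun × UnitFun) (t : ℝ) : ℂ :=
  Complex.exp (eigOne P * t) * Y.1.extend (exp (-rightRate σ * t))
    + Complex.exp (eigTwo P * t) * Y.2.extend (exp (-rightRate σ * t))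

/-- The derivative of the chart coordinate on the right. -/
def rightVelocity (σ : ℝ) (P : Param) (Y : UnitFun × UnitFun) (t : ℝ) : ℂ :=
  eigOne P * (Complex.exp (eigOne P * t) * Y.1.extend (exp (-rightRate σ * t)))
    + eigTwo P * (Complex.exp (eigTwo P * t) * Y.2.extend (exp (-rightRate σ * t)))

section

variable {σ : ℝ} {P : Param} {a : ℂ × ℂ} {Y : UnitFun × UnitFun} {t : ℝ}

theorem exp_neg_rate_mem (hσ : 0 < rightRate σ) (ht : 0 < t) :
    exp (-rightRate σ * t) ∈ Ioo (0 : ℝ) 1 :=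
  ⟨exp_pos _, exp_lt_one_iff.2 (by have := mul_pos hσ ht; linarith)⟩

/-- The equations of the two eigencomponents. -/
theorem hasDerivAt_rightComponents (hσ : 0 < rightRate σ) (h : RightAdmissible σ P)
    (hY : rightMap σ ((P, a), Y) = Y) (ht : 0 < t) :
    HasDerivAt (fun t : ℝ => Complex.exp (eigOne P * t) * Y.1.extend (exp (-rightRate σ * t)))
      (eigOne P * (Complex.exp (eigOne P * t) * Y.1.extend (exp (-rightRate σ * t)))
        + cubic (-1) P 1 (rightCoord σ P Y t) (rightVelocity σ P Y t) / (eigOne P - eigTwo P)) t ∧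
    HasDerivAt (fun t : ℝ => Complex.exp (eigTwo P * t) * Y.2.extend (exp (-rightRate σ * t)))
      (eigTwo P * (Complex.exp (eigTwo P * t) * Y.2.extend (exp (-rightRate σ * t)))
        - cubic (-1) P 1 (rightCoord σ P Y t) (rightVelocity σ P Y t) / (eigOne P - eigTwo P)) t := by
  set τ := exp (-rightRate σ * t) with hτ
  have hm : τ ∈ Ioo (0 : ℝ) 1 := exp_neg_rate_mem hσ ht
  have hm' : τ ∈ Icc (0 : ℝ) 1 := ⟨hm.1.le, hm.2.le⟩
  have hτ0 : (τ : ℂ) ≠ 0 := by exact_mod_cast hm.1.ne'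
  have hδ : eigOne P - eigTwo P ≠ 0 := sub_ne_zero.2 h.ne
  have hσ0 : ((rightRate σ : ℝ) : ℂ) ≠ 0 := by exact_mod_cast hσ.ne'
  have e1 : ∀ l, Complex.exp (l * t) = τ * (τ : ℂ) ^ relExponent σ l := fun l => by
    rw [← cpow_one_add_relExponent hσ, ← hτ, Complex.cpow_add _ _ hτ0, Complex.cpow_one]
  -- The solution is `τ` times the argument of `rightField`; homogeneity extracts `τ³`, and the
  -- weight becomes `τ²`.
  have hN : cubic (-1) P 1 (rightCoord σ P Y t) (rightVelocity σ P Y t)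
      = (τ : ℂ) ^ 3 * (rightField σ P Y).extend τ := by
    rw [UnitFun.extend_of_mem _ hm', rightField_apply h, rightCoord, rightVelocity, ← hτ, e1, e1,
      UnitFun.extend_of_mem _ hm', UnitFun.extend_of_mem _ hm']
    have := cubic_real_mul (-1) P 1 τ ((τ : ℂ) ^ relExponent σ (eigOne P) * Y.1 ⟨τ, hm'⟩
        + (τ : ℂ) ^ relExponent σ (eigTwo P) * Y.2 ⟨τ, hm'⟩)
      (eigOne P * ((τ : ℂ) ^ relExponent σ (eigOne P) * Y.1 ⟨τ, hm'⟩)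
        + eigTwo P * ((τ : ℂ) ^ relExponent σ (eigTwo P) * Y.2 ⟨τ, hm'⟩))
    rw [one_mul] at this
    rw [← this]
    congr 1 <;> ring
  have hτd : HasDerivAt (fun t => exp (-rightRate σ * t)) (-rightRate σ * τ) t := by
    have := ((hasDerivAt_id t).const_mul (-rightRate σ)).exp
    convert! this using 1
    simp [hτ]; ring
  have hprim : ∀ p : ℂ, 0 < (1 - p).re →
      HasDerivAt (UnitFun.primitive (UnitFun.pow (1 - p) * rightField σ P Y)).extend
        ((τ : ℂ) ^ (1 - p) * (rightField σ P Y).extend τ) τ := fun p hp => by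
    convert! UnitFun.hasDerivAt_primitive (UnitFun.pow (1 - p) * rightField σ P Y) hm using 1
    rw [UnitFun.extend_of_mem _ hm', UnitFun.extend_of_mem _ hm', ContinuousMap.mul_apply,
      UnitFun.pow_apply hp]
  have h1 : 0 < (1 - relExponent σ (eigOne P)).re := by
    have := h.one_lt
    simp; linarith
  have h2 : 0 < (1 - relExponent σ (eigTwo P)).re := by
    have := h.two_lt
    simp; linarith
  have e2 : ∀ p : ℂ, (τ : ℂ) ^ p * (τ : ℂ) ^ (1 - p) = τ := fun p => by
    rw [← Complex.cpow_add _ _ hτ0]; simp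
  have hY1 := congrArg Prod.fst hY
  have hY2 := congrArg Prod.snd hY
  simp only [rightMap] at hY1 hY2
  constructor
  · have d1 : HasDerivAt Y.1.extend (-(rightCoeff σ P * ((τ : ℂ) ^ (1 - relExponent σ (eigOne P))
        * (rightField σ P Y).extend τ))) τ := by
      have := ((hprim _ h1).const_mul (rightCoeff σ P)).const_sub (a.1 * 1)
      rw [← hY1]
      exact this
    have d2 := (hasDerivAt_cexp_mul (eigOne P) t).mul (d1.scomp t hτd)
    convert! d2 using 1
    have e3 := e2 (relExponent σ (eigOne P))
    rw [hN, Complex.real_smul, rightCoeff]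
    simp only [Function.comp_apply, ← hτ]
    rw [e1 (eigOne P)]
    generalize (τ : ℂ) ^ (1 - relExponent σ (eigOne P)) = A at *
    generalize (τ : ℂ) ^ (relExponent σ (eigOne P)) = B at *
    push_cast
    field_simp
    linear_combination (-(τ : ℂ) * (rightField σ P Y).extend τ) * e3
  · have d1 : HasDerivAt Y.2.extend (rightCoeff σ P * ((τ : ℂ) ^ (1 - relExponent σ (eigTwo P))
        * (rightField σ P Y).extend τ)) τ := by
      have := ((hprim _ h2).const_mul (rightCoeff σ P)).const_add (a.2 * 1)
      rw [← hY2]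
      exact this
    have d2 := (hasDerivAt_cexp_mul (eigTwo P) t).mul (d1.scomp t hτd)
    convert! d2 using 1
    have e3 := e2 (relExponent σ (eigTwo P))
    rw [hN, Complex.real_smul, rightCoeff]
    simp only [Function.comp_apply, ← hτ]
    rw [e1 (eigTwo P)]
    generalize (τ : ℂ) ^ (1 - relExponent σ (eigTwo P)) = A at *
    generalize (τ : ℂ) ^ (relExponent σ (eigTwo P)) = B at *
    push_cast
    field_simp
    linear_combination ((τ : ℂ) * (rightField σ P Y).extend τ) * e3

theorem hasDerivAt_rightCoord (hσ : 0 < rightRate σ) (h : RightAdmissible σ P)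
    (hY : rightMap σ ((P, a), Y) = Y) (ht : 0 < t) :
    HasDerivAt (rightCoord σ P Y) (rightVelocity σ P Y t) t := by
  obtain ⟨h1, h2⟩ := hasDerivAt_rightComponents hσ h hY ht
  convert! h1.add h2 using 1
  rw [rightVelocity]
  ring

/-- The characteristic equations give the linear part; the two forcing terms combine to `(l₁ - l₂) N
/ (l₁ - l₂) = N`. -/
theorem hasDerivAt_rightVelocity (hσ : 0 < rightRate σ) (h : RightAdmissible σ P)
    (hY : rightMap σ ((P, a), Y) = Y) (ht : 0 < t) :
    HasDerivAt (rightVelocity σ P Y)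
      (chartField (-1) P (-coeffCpi P) (rightCoord σ P Y t) (rightVelocity σ P Y t)) t := by
  obtain ⟨h1, h2⟩ := hasDerivAt_rightComponents hσ h hY ht
  convert! (h1.const_mul (eigOne P)).add (h2.const_mul (eigTwo P)) using 1
  have hδ : eigOne P - eigTwo P ≠ 0 := sub_ne_zero.2 h.ne
  have e1 := eigOne_sq P
  have e2 := eigTwo_sq P
  rw [chartField]
  generalize cubic (-1) P 1 (rightCoord σ P Y t) (rightVelocity σ P Y t) = N
  have e3 : N = eigOne P * (N / (eigOne P - eigTwo P)) - eigTwo P * (N / (eigOne P - eigTwo P)) := by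
    field_simp
  rw [rightCoord, rightVelocity]
  linear_combination e3
    - (Complex.exp (eigOne P * t) * Y.1.extend (exp (-rightRate σ * t))) * e1
    - (Complex.exp (eigTwo P * t) * Y.2.extend (exp (-rightRate σ * t))) * e2

end

/-! ### Prescribing the data at a finite time instead of the asymptotic amplitudes. -/

/-- The amplitudes enter affinely, so a fixed point differs from its amplitudes by a term with zero
derivative. -/
theorem rightMap_eq (σ : ℝ) (P : Param) (a : ℂ × ℂ) (Y : UnitFun × UnitFun) :
    rightMap σ ((P, a), Y) = (a.1 • (1 : UnitFun), a.2 • (1 : UnitFun)) + rightMap σ ((P, 0), Y) := by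
  refine Prod.ext ?_ ?_ <;> ext t <;> simp [rightMap, sub_eq_add_neg]

/-- Evaluation of both components at the right end point. -/
def evalOne : UnitFun × UnitFun →L[ℝ] ℂ × ℂ :=
  (ContinuousMap.evalCLM ℝ (1 : unitInterval)).prodMap (ContinuousMap.evalCLM ℝ (1 : unitInterval))

theorem evalOne_apply (Y : UnitFun × UnitFun) : evalOne Y = (Y.1 1, Y.2 1) := rfl

/-- Translation forward in time is a contraction, so translated fixed points remain in the ball
where uniqueness is known. -/
theorem norm_shift_le {σ : ℝ} {P : Param} (h : RightAdmissible σ P) {s : unitInterval}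
    (hs : 0 < (s : ℝ)) (Y : UnitFun × UnitFun) : ‖shift σ P s Y‖ ≤ ‖Y‖ := by
  have key : ∀ (p : ℂ) (f : UnitFun), 0 < p.re →
      ‖((s : ℝ) : ℂ) ^ (1 + p) • UnitFun.dilate s f‖ ≤ ‖f‖ := fun p f hp => by
    rw [norm_smul, Complex.norm_cpow_eq_rpow_re_of_pos hs]
    refine (mul_le_of_le_one_left (norm_nonneg _) (Real.rpow_le_one s.2.1 s.2.2 ?_)).trans
      (UnitFun.norm_dilate_le s f)
    simp; linarith
  exact max_le_max (key _ _ h.one_pos) (key _ _ h.two_pos)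

/-- Evaluated at `exp (-ν t)`, this linear bound becomes the exponential convergence of the
amplitudes. -/
theorem norm_extend_sub_le {g : UnitFun} {c b : ℂ} {f : UnitFun}
    (hf : f = c • (1 : UnitFun) + b • UnitFun.primitive g) (t : unitInterval) :
    ‖f t - c‖ ≤ ‖b‖ * ‖g‖ * t := by
  have h : f t - c = b * UnitFun.primitive g t := by
    rw [hf]; simp
  rw [h, norm_mul, mul_assoc]
  gcongr
  rw [UnitFun.primitive_apply]
  refine (intervalIntegral.norm_integral_le_of_norm_le_const
    (fun u _ => g.norm_extend_le u)).trans ?_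
  rw [sub_zero, abs_of_nonneg t.2.1]

namespace IsCenterPoint

variable {P₀ : Param} {σ : ℝ} (hc : IsCenterPoint P₀ σ)
include hc

/-- For `v = -σ y` and `μ = -σ²` the combination `μ y² + v²` in the nonlinearity vanishes, so pure
multiples of `exp (-σ t)` solve the nonlinear equation exactly. -/
theorem rightMap_explicit (e : ℂ) :
    rightMap σ ((P₀, (e, 0)), (e • (1 : UnitFun), 0)) = (e • (1 : UnitFun), 0) := by
  have h : rightField σ P₀ (e • (1 : UnitFun), 0) = 0 := by
    ext t
    rw [rightField_apply hc.rightAdmissible]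
    simp [cubic, polarCoeff, hc.c_eq, hc.μ_eq, hc.eigOne_eq]
    ring_nf
    simp
  simp only [rightMap, h, mul_zero, map_zero]
  refine Prod.ext ?_ ?_ <;> ext t <;> simp

/-- The amplitudes at time zero determine the asymptotic amplitudes. -/
theorem exists_amplitudes {r : ℝ} (hr : 0 < r) {ψ : Param × (ℂ × ℂ) → UnitFun × UnitFun}
    (h0 : ψ (P₀, 0) = 0)
    (hψ : ∀ q ∈ Metric.ball (P₀, (0 : ℂ × ℂ)) r, ContDiffAt ℝ ω ψ q ∧ rightMap σ (q, ψ q) = ψ q)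
    (hexp : ∀ e : ℂ, ‖e‖ < r → ψ (P₀, (e, 0)) = (e • (1 : UnitFun), 0)) :
    ∃ r' > 0, ∃ Ψ : Param × (ℂ × ℂ) → ℂ × ℂ,
      (∀ q ∈ Metric.ball (P₀, (0 : ℂ × ℂ)) r',
        ContDiffAt ℝ ω Ψ q ∧ evalOne (ψ (q.1, Ψ q)) = q.2) ∧
      ∀ e : ℂ, ‖e‖ < r' → Ψ (P₀, (e, 0)) = (e, 0) := by
  have hq0 : (P₀, (0 : ℂ × ℂ)) ∈ Metric.ball (P₀, (0 : ℂ × ℂ)) r := Metric.mem_ball_self hr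
  have hψ0 := (hψ _ hq0).1
  -- A fixed point `a` of `Φ` is an amplitude whose solution has the prescribed value at the end
  -- point `1`. Evaluation minus identity has zero derivative, so the same fixed point theorem
  -- inverts it.
  set Φ : (Param × (ℂ × ℂ)) × (ℂ × ℂ) → ℂ × ℂ :=
    fun v => v.1.2 - (evalOne (ψ (v.1.1, v.2)) - v.2) with hΦ
  have hcd : ContDiffAt ℝ ω Φ ((P₀, 0), 0) := by
    have h1 : ContDiffAt ℝ ω (fun v : (Param × (ℂ × ℂ)) × (ℂ × ℂ) => ψ (v.1.1, v.2))
        ((P₀, 0), 0) :=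
      ContDiffAt.comp (g := ψ) (f := fun v : (Param × (ℂ × ℂ)) × (ℂ × ℂ) => (v.1.1, v.2))
        ((P₀, 0), 0) hψ0 (by fun_prop)
    have h2 := evalOne.contDiff.contDiffAt.comp _ h1
    exact contDiffAt_fst.snd.sub (h2.sub contDiffAt_snd)
  have hfix : Φ ((P₀, 0), 0) = 0 := by simp [hΦ, h0]
  have hψd : DifferentiableAt ℝ (fun a => ψ (P₀, a)) 0 :=
    (ContDiffAt.comp (g := ψ) (f := fun a : ℂ × ℂ => (P₀, a)) 0 hψ0
      (by fun_prop)).differentiableAt (by simp)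
  have hder : HasFDerivAt (fun a => Φ ((P₀, 0), a)) (0 : ℂ × ℂ →L[ℝ] ℂ × ℂ) 0 := by
    have h1 : HasFDerivAt (fun Y => rightMap σ ((P₀, 0), Y))
        (0 : UnitFun × UnitFun →L[ℝ] UnitFun × UnitFun) (ψ (P₀, 0)) := by
      rw [h0]; exact hc.hasFDerivAt_rightMap
    have h2 := evalOne.hasFDerivAt.comp (0 : ℂ × ℂ) (h1.comp (0 : ℂ × ℂ) hψd.hasFDerivAt)
    have h3 := h2.neg
    rw [ContinuousLinearMap.zero_comp, ContinuousLinearMap.comp_zero, neg_zero] at h3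
    refine h3.congr_of_eventuallyEq ?_
    have hcont : Tendsto (fun a : ℂ × ℂ => (P₀, a)) (𝓝 0) (𝓝 (P₀, 0)) :=
      (Continuous.prodMk_right P₀).tendsto 0
    filter_upwards [hcont.eventually (Metric.ball_mem_nhds _ hr)] with a ha
    have h4 := (hψ _ ha).2
    rw [rightMap_eq] at h4
    have h5 : rightMap σ ((P₀, 0), ψ (P₀, a))
        = ψ (P₀, a) - (a.1 • (1 : UnitFun), a.2 • (1 : UnitFun)) := by
      rw [eq_sub_iff_add_eq, add_comm]; exact h4
    simp only [hΦ, Pi.neg_apply, Function.comp_apply, h5, map_sub]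
    rw [show evalOne (a.1 • (1 : UnitFun), a.2 • (1 : UnitFun)) = a by simp [evalOne_apply]]
    simp
  obtain ⟨Ψ, h1, h2, h3, h4⟩ := exists_analytic_fixedPoint hcd hfix hder
  obtain ⟨r₁, hr₁, h5⟩ := Metric.eventually_nhds_iff_ball.1 ((h1.eventually (by simp)).and h3)
  obtain ⟨r₂, hr₂, h6⟩ := Metric.eventually_nhds_iff_ball.1 h4
  refine ⟨min r (min r₁ r₂), lt_min hr (lt_min hr₁ hr₂), Ψ, fun q hq => ?_, fun e he => ?_⟩
  · obtain ⟨h7, h8⟩ := h5 q (Metric.ball_subset_ball ((min_le_right _ _).trans (min_le_left _ _)) hq)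
    refine ⟨h7, ?_⟩
    simp only [hΦ] at h8
    have : q.2 - (evalOne (ψ (q.1, Ψ q)) - Ψ q) - Ψ q = 0 := by rw [h8, sub_self]
    rw [← sub_eq_zero, ← neg_eq_zero, ← this]
    abel
  · have he1 := he.trans_le (min_le_left _ _)
    have he2 := he.trans_le ((min_le_right _ _).trans (min_le_right _ _))
    have h7 := h6 ((P₀, (e, 0)), (e, 0)) (by
      simp only [Metric.mem_ball, Prod.dist_eq, dist_self,
        dist_zero_right]
      simp [he2])
    refine (h7 ?_).symm
    simp only [hΦ, hexp e he1, evalOne_apply]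
    simp

/-- The solutions near the right pole with prescribed amplitudes at time zero. -/
theorem exists_right_solution : ∃ r > 0, ∀ (b : Param → ℂ × ℂ) (e : ℝ), 0 < e → e < r →
    ContDiffAt ℝ ω b P₀ → b P₀ = ((e : ℂ), 0) → ∃ η v : Param → ℝ → ℂ,
      (∀ t, -1 < t → η P₀ t = e * Complex.exp (-σ * t)) ∧ ∀ᶠ P in 𝓝 P₀,
        (∀ t, -1 < t → ContDiffAt ℝ ω (Function.uncurry η) (P, t) ∧ HasDerivAt (η P) (v P t) t ∧
          HasDerivAt (v P) (chartField (-1) P (-coeffCpi P) (η P t) (v P t)) t) ∧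
        η P 0 = (b P).1 + (b P).2 ∧ v P 0 = eigOne P * (b P).1 + eigTwo P * (b P).2 ∧
        ∃ (a₁ a₂ : ℂ) (U₁ U₂ : ℝ → ℂ) (C : ℝ), ∀ t, 0 ≤ t →
          η P t = Complex.exp (eigOne P * t) * U₁ t + Complex.exp (eigTwo P * t) * U₂ t ∧
          v P t = eigOne P * (Complex.exp (eigOne P * t) * U₁ t)
            + eigTwo P * (Complex.exp (eigTwo P * t) * U₂ t) ∧
          ‖U₁ t - a₁‖ ≤ C * exp (-rightRate σ * t) ∧ ‖U₂ t - a₂‖ ≤ C * exp (-rightRate σ * t) ∧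
          ‖U₁ t - e‖ ≤ e / 4 ∧ ‖U₂ t‖ ≤ e / 4 := by
  obtain ⟨r₁, hr₁, ψ, h0, hψ, huniq⟩ := hc.exists_right_fixedPoint
  have hexp : ∀ e : ℂ, ‖e‖ < r₁ → ψ (P₀, (e, 0)) = (e • (1 : UnitFun), 0) := fun e he => by
    refine (huniq _ ?_ _ ?_ (hc.rightMap_explicit e)).symm
    · simp only [Metric.mem_ball, Prod.dist_eq, dist_self,
        dist_zero_right]
      simp [he]
    · rw [Prod.norm_def]
      refine max_lt ?_ (by simpa using hr₁)
      rw [norm_smul]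
      simpa using he
  obtain ⟨r₂, hr₂, Ψ, hΨ, hΨe⟩ := hc.exists_amplitudes hr₁ h0 hψ hexp
  have hν := hc.rightRate_pos
  -- The factor `exp (-σ)` pays for solving back to time `-1`, which gives an open interval around
  -- the matching time.
  refine ⟨min r₁ r₂ * exp (-σ), by positivity, fun b e he her hb hb0 => ?_⟩
  have hσ1 : (1 : ℝ) ≤ exp σ := Real.one_le_exp hc.σ_pos.le
  have heσ : e * exp σ < min r₁ r₂ := by
    calc e * exp σ < min r₁ r₂ * exp (-σ) * exp σ := by gcongr
      _ = min r₁ r₂ := by rw [mul_assoc, ← Real.exp_add]; simp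
  have he' : e < min r₁ r₂ := lt_of_le_of_lt (le_mul_of_one_le_right he.le hσ1) heσ
  have hne : ∀ x : ℝ, 0 ≤ x → ‖(x : ℂ)‖ = x := fun x hx => by
    rw [Complex.norm_real, Real.norm_eq_abs, abs_of_nonneg hx]
  set a : Param → ℂ × ℂ := fun P => Ψ (P, b P) with ha
  -- The asymptotic amplitudes after the clock is moved back by one unit: the internal time is `t +
  -- 1`, and the data `b` are attained at internal time `1`.
  set d : Param → ℂ × ℂ := fun P =>
    (Complex.exp (-eigOne P) * (a P).1, Complex.exp (-eigTwo P) * (a P).2) with hd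
  set Y : Param → UnitFun × UnitFun := fun P => ψ (P, d P) with hY
  have hball : ∀ (x ρ : ℝ), 0 ≤ x → x < ρ →
      (P₀, ((x : ℂ), (0 : ℂ))) ∈ Metric.ball (P₀, (0 : ℂ × ℂ)) ρ := fun x ρ hx hxr => by
    simp only [Metric.mem_ball, Prod.dist_eq, dist_self,
      dist_zero_right]
    simp [hxr, hx.trans_lt hxr, abs_of_nonneg hx]
  have ha0 : a P₀ = ((e : ℂ), 0) := by
    rw [ha]; simp only; rw [hb0]
    exact hΨe _ (by rw [hne _ he.le]; exact he'.trans_le (min_le_right _ _))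
  have hac : ContDiffAt ℝ ω a P₀ := by
    have := (hΨ (P₀, b P₀) (by
      rw [hb0]; exact hball _ _ he.le (he'.trans_le (min_le_right _ _)))).1
    exact this.comp P₀ (f := fun P => (P, b P)) (contDiffAt_id.prodMk hb)
  have hdc : ContDiffAt ℝ ω d P₀ :=
    ((contDiffAt_cexp hc.contDiffAt_eigOne.neg).mul hac.fst).prodMk
      ((contDiffAt_cexp hc.contDiffAt_eigTwo.neg).mul hac.snd)
  have hd0 : d P₀ = (((e * exp σ : ℝ) : ℂ), 0) := by
    rw [hd]; simp only; rw [ha0, hc.eigOne_eq]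
    simp only [neg_neg, mul_zero]
    push_cast
    rw [mul_comm]
  have heσ0 : 0 ≤ e * exp σ := by positivity
  have hYc : ContDiffAt ℝ ω Y P₀ := by
    have := (hψ (P₀, d P₀) (by
      rw [hd0]; exact hball _ _ heσ0 (heσ.trans_le (min_le_left _ _)))).1
    exact this.comp P₀ (f := fun P => (P, d P)) (contDiffAt_id.prodMk hdc)
  have hY0 : Y P₀ = (((e * exp σ : ℝ) : ℂ) • (1 : UnitFun), 0) := by
    rw [hY]; simp only; rw [hd0]
    exact hexp _ (by rw [hne _ heσ0]; exact heσ.trans_le (min_le_left _ _))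
  have hYn : ∀ᶠ P in 𝓝 P₀, ‖Y P‖ < r₁ := by
    refine hYc.continuousAt.norm.eventually (gt_mem_nhds ?_)
    show ‖Y P₀‖ < r₁
    rw [hY0, Prod.norm_def]
    refine max_lt ?_ (by simpa using hr₁)
    rw [norm_smul, hne _ heσ0]
    simpa using heσ.trans_le (min_le_left _ _)
  have hdn : ∀ᶠ P in 𝓝 P₀, dist P P₀ < r₁ ∧ ‖d P‖ < r₁ := by
    have hd1 : ∀ᶠ P in 𝓝 P₀, dist P P₀ < r₁ := Metric.ball_mem_nhds P₀ hr₁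
    refine hd1.and (hdc.continuousAt.norm.eventually (gt_mem_nhds ?_))
    show ‖d P₀‖ < r₁
    rw [hd0, Prod.norm_def]
    simp only [norm_zero, hne _ heσ0]
    exact max_lt (heσ.trans_le (min_le_left _ _)) hr₁
  have hbn : ∀ᶠ P in 𝓝 P₀, (P, b P) ∈ Metric.ball (P₀, (0 : ℂ × ℂ)) r₂ := by
    have : ContinuousAt (fun P => (P, b P)) P₀ := continuousAt_id.prodMk hb.continuousAt
    refine this.eventually (Metric.isOpen_ball.mem_nhds ?_)
    simp only
    rw [hb0]; exact hball _ _ he.le (he'.trans_le (min_le_right _ _))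
  have hnear : ∀ᶠ P in 𝓝 P₀, ‖Complex.exp (eigOne P) • (Y P).1 - (e : ℂ) • (1 : UnitFun)‖ < e / 4 ∧
      ‖Complex.exp (eigTwo P) • (Y P).2‖ < e / 4 := by
    have c1 : ContinuousAt (fun P => ‖Complex.exp (eigOne P) • (Y P).1 - (e : ℂ) • (1 : UnitFun)‖) P₀ :=
      (((contDiffAt_cexp hc.contDiffAt_eigOne).smul hYc.fst).continuousAt.sub
        continuousAt_const).norm
    have c2 : ContinuousAt (fun P => ‖Complex.exp (eigTwo P) • (Y P).2‖) P₀ :=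
      ((contDiffAt_cexp hc.contDiffAt_eigTwo).smul hYc.snd).continuousAt.norm
    refine (c1.eventually (gt_mem_nhds ?_)).and (c2.eventually (gt_mem_nhds ?_))
    · have : Complex.exp (eigOne P₀) • (Y P₀).1 = (e : ℂ) • (1 : UnitFun) := by
        rw [hY0, hc.eigOne_eq, smul_smul]
        congr 1
        push_cast
        rw [mul_comm, mul_assoc, ← Complex.exp_add]
        simp
      show ‖_ - _‖ < _
      rw [this, sub_self, norm_zero]
      positivity
    · show ‖_ • (Y P₀).2‖ < _
      rw [hY0]
      simp only [norm_smul, norm_zero, mul_zero]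
      positivity
  have hgood : ∀ᶠ P in 𝓝 P₀, RightAdmissible σ P ∧ ContDiffAt ℝ ω d P ∧
      ContDiffAt ℝ ω eigOne P ∧ ContDiffAt ℝ ω eigTwo P ∧ ‖Y P‖ < r₁ ∧ dist P P₀ < r₁ ∧
      ‖d P‖ < r₁ := by
    filter_upwards [hc.rightAdmissible_eventually, hdc.eventually (by simp),
      hc.contDiffAt_eigOne.eventually (by simp), hc.contDiffAt_eigTwo.eventually (by simp), hYn, hdn]
      with P h1 h2 h3 h4 h5 h6
    exact ⟨h1, h2, h3, h4, h5, h6.1, h6.2⟩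
  -- By uniqueness, the components at time `t` are the end point values of the fixed point for the
  -- translated amplitudes. This gives joint regularity in `(P, t)`.
  have hkey : ∀ P, RightAdmissible σ P → ‖Y P‖ < r₁ → dist P P₀ < r₁ → ‖d P‖ < r₁ →
      ∀ t : ℝ, 0 < t →
        (P, (Complex.exp (eigOne P * t) * (d P).1, Complex.exp (eigTwo P * t) * (d P).2))
          ∈ Metric.ball (P₀, (0 : ℂ × ℂ)) r₁ ∧
        evalOne (ψ (P, (Complex.exp (eigOne P * t) * (d P).1, Complex.exp (eigTwo P * t) * (d P).2)))
          = (Complex.exp (eigOne P * t) * (Y P).1.extend (exp (-rightRate σ * t)),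
            Complex.exp (eigTwo P * t) * (Y P).2.extend (exp (-rightRate σ * t))) := by
    intro P hadm hYP hdist hdP t ht
    have hm := exp_neg_rate_mem hν ht
    set s : unitInterval := ⟨exp (-rightRate σ * t), hm.1.le, hm.2.le⟩ with hs
    have hs0 : 0 < (s : ℝ) := hm.1
    have e1 := cpow_one_add_relExponent (t := t) hν (eigOne P)
    have e2 := cpow_one_add_relExponent (t := t) hν (eigTwo P)
    have hdin : (P, d P) ∈ Metric.ball (P₀, (0 : ℂ × ℂ)) r₁ := by
      rw [Metric.mem_ball, Prod.dist_eq, dist_zero_right]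
      exact max_lt hdist hdP
    have h1 := rightMap_shift hadm hs0 (hψ _ hdin).2
    simp only [hs, e1, e2] at h1
    have hn : ∀ l : ℂ, 0 < (relExponent σ l).re → ‖Complex.exp (l * t)‖ ≤ 1 := fun l hl => by
      rw [← cpow_one_add_relExponent hν l, Complex.norm_cpow_eq_rpow_re_of_pos hm.1]
      exact Real.rpow_le_one hm.1.le hm.2.le (by simp; linarith)
    have hin : (P, (Complex.exp (eigOne P * t) * (d P).1, Complex.exp (eigTwo P * t) * (d P).2))
        ∈ Metric.ball (P₀, (0 : ℂ × ℂ)) r₁ := by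
      rw [Metric.mem_ball, Prod.dist_eq, dist_zero_right]
      refine max_lt hdist (lt_of_le_of_lt ?_ hdP)
      refine max_le_max ((norm_mul _ _).trans_le ?_) ((norm_mul _ _).trans_le ?_)
      · exact (mul_le_of_le_one_left (norm_nonneg _) (hn _ hadm.one_pos))
      · exact (mul_le_of_le_one_left (norm_nonneg _) (hn _ hadm.two_pos))
    refine ⟨hin, ?_⟩
    have h2 := huniq _ hin _ ((norm_shift_le hadm hs0 (ψ (P, d P))).trans_lt hYP) h1
    rw [← h2, evalOne_apply]
    simp only [shift, ContinuousMap.smul_apply, UnitFun.dilate_apply, mul_one, smul_eq_mul]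
    have hs' : exp (-rightRate σ * t) ∈ Icc (0 : ℝ) 1 := s.2
    rw [UnitFun.extend_of_mem _ hs', UnitFun.extend_of_mem _ hs']
    exact Prod.ext (congrArg (· * _) e1) (congrArg (· * _) e2)
  refine ⟨fun P t => rightCoord σ P (Y P) (t + 1), fun P t => rightVelocity σ P (Y P) (t + 1),
    fun t ht => ?_, ?_⟩
  · simp only [rightCoord, hY0, hc.eigOne_eq]
    simp only [UnitFun.extend, ContinuousMap.smul_apply, ContinuousMap.one_apply,
      ContinuousMap.zero_apply, smul_eq_mul, mul_zero, add_zero, mul_one]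
    push_cast
    rw [show (-(σ : ℂ)) * (t + 1) = -σ * t + -σ by ring, Complex.exp_add]
    have : Complex.exp (-(σ : ℂ)) * Complex.exp σ = 1 := by rw [← Complex.exp_add]; simp
    linear_combination (Complex.exp (-σ * t) * e) * this
  · filter_upwards [hgood.eventually_nhds, hbn, hnear] with P hP hbP hnP
    obtain ⟨hadm, hdP, hl1, hl2, hYP, hdist, hdnP⟩ := hP.self_of_nhds
    have hdin : (P, d P) ∈ Metric.ball (P₀, (0 : ℂ × ℂ)) r₁ := by
      rw [Metric.mem_ball, Prod.dist_eq, dist_zero_right]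
      exact max_lt hdist hdnP
    have hfix := (hψ _ hdin).2
    have hzero : evalOne (ψ (P, a P)) = b P := (hΨ _ hbP).2
    have hda : (Complex.exp (eigOne P * (1 : ℝ)) * (d P).1, Complex.exp (eigTwo P * (1 : ℝ)) * (d P).2)
        = a P := by
      refine Prod.ext ?_ ?_ <;>
      · simp only [hd, Complex.ofReal_one, mul_one]
        rw [← mul_assoc, ← Complex.exp_add]
        simp
    have hev := (hkey P hadm hYP hdist hdnP 1 one_pos).2
    rw [hda, hzero] at hev
    refine ⟨fun t ht => ⟨?_, ?_, ?_⟩, ?_, ?_, ?_⟩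
    · have ht1 : 0 < t + 1 := by linarith
      have hin := (hkey P hadm hYP hdist hdnP (t + 1) ht1).1
      have hfst : ∀ {g : Param → ℂ}, ContDiffAt ℝ ω g P →
          ContDiffAt ℝ ω (fun q : Param × ℝ => g q.1) (P, t) := fun hg =>
        hg.comp (P, t) contDiffAt_fst
      have hl1' := hfst hl1
      have hl2' := hfst hl2
      have hd1' := hfst hdP.fst
      have hd2' := hfst hdP.snd
      have h1 : ContDiffAt ℝ ω (fun q : Param × ℝ => evalOne (ψ (q.1,
          (Complex.exp (eigOne q.1 * (q.2 + 1 : ℝ)) * (d q.1).1,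
            Complex.exp (eigTwo q.1 * (q.2 + 1 : ℝ)) * (d q.1).2)))) (P, t) := by
        have h2 : ContDiffAt ℝ ω (fun q : Param × ℝ => (q.1,
          (Complex.exp (eigOne q.1 * (q.2 + 1 : ℝ)) * (d q.1).1,
            Complex.exp (eigTwo q.1 * (q.2 + 1 : ℝ)) * (d q.1).2))) (P, t) :=
          contDiffAt_fst.prodMk
            (((contDiffAt_cexp (f := fun q : Param × ℝ => eigOne q.1 * (q.2 + 1 : ℝ))
                (by fun_prop)).mul hd1').prodMk
              ((contDiffAt_cexp (f := fun q : Param × ℝ => eigTwo q.1 * (q.2 + 1 : ℝ))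
                (by fun_prop)).mul hd2'))
        exact evalOne.contDiff.contDiffAt.comp _ (ContDiffAt.comp (P, t) (hψ _ hin).1 h2)
      refine (h1.fst.add h1.snd).congr_of_eventuallyEq ?_
      have c1 : ∀ᶠ q : Param × ℝ in 𝓝 (P, t), -1 < q.2 :=
        continuousAt_snd.eventually (lt_mem_nhds ht)
      have c2 := (continuousAt_fst : ContinuousAt (Prod.fst : Param × ℝ → Param)
        (P, t)).eventually hP
      filter_upwards [c1, c2] with q q1 q6
      obtain ⟨q2, -, -, -, q3, q4, q5⟩ := q6
      have := (hkey q.1 q2 q3 q4 q5 (q.2 + 1) (by linarith)).2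
      rw [this]
      rfl
    · have := hasDerivAt_rightCoord hν hadm hfix (t := t + 1) (by linarith)
      exact this.comp_add_const t 1
    · have := hasDerivAt_rightVelocity hν hadm hfix (t := t + 1) (by linarith)
      exact this.comp_add_const t 1
    · simp only [zero_add]
      rw [hev]
      rfl
    · simp only [zero_add]
      rw [hev]
      rfl
    · have f1 := congrArg Prod.fst hfix
      have f2 := congrArg Prod.snd hfix
      simp only [rightMap] at f1 f2
      set g₁ := UnitFun.pow (1 - relExponent σ (eigOne P)) * rightField σ P (ψ (P, d P)) with hg₁
      set g₂ := UnitFun.pow (1 - relExponent σ (eigTwo P)) * rightField σ P (ψ (P, d P)) with hg₂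
      have k1 := norm_extend_sub_le (f := (Y P).1) (g := g₁) (c := (d P).1)
        (b := -rightCoeff σ P) (by rw [← f1]; ext t; simp [sub_eq_add_neg])
      have k2 := norm_extend_sub_le (f := (Y P).2) (g := g₂) (c := (d P).2)
        (b := rightCoeff σ P) f2.symm
      refine ⟨Complex.exp (eigOne P) * (d P).1, Complex.exp (eigTwo P) * (d P).2,
        fun t => Complex.exp (eigOne P) * (Y P).1.extend (exp (-rightRate σ * (t + 1))),
        fun t => Complex.exp (eigTwo P) * (Y P).2.extend (exp (-rightRate σ * (t + 1))),
        max (‖Complex.exp (eigOne P)‖ * (‖-rightCoeff σ P‖ * ‖g₁‖))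
          (‖Complex.exp (eigTwo P)‖ * (‖rightCoeff σ P‖ * ‖g₂‖)), fun t ht => ?_⟩
      have hE : ∀ l : ℂ, Complex.exp (l * ((t + 1 : ℝ) : ℂ)) = Complex.exp (l * t) * Complex.exp l :=
        fun l => by rw [← Complex.exp_add]; congr 1; push_cast; ring
      have hm := exp_neg_rate_mem hν (show 0 < t + 1 by linarith)
      have hm' : exp (-rightRate σ * (t + 1)) ∈ Icc (0 : ℝ) 1 := ⟨hm.1.le, hm.2.le⟩
      have hle : exp (-rightRate σ * (t + 1)) ≤ exp (-rightRate σ * t) :=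
        exp_le_exp.2 (by nlinarith)
      refine ⟨?_, ?_, ?_, ?_, ?_, ?_⟩
      · simp only [rightCoord, hE]; ring
      · simp only [rightVelocity, hE]; ring
      · simp only
        rw [← mul_sub, norm_mul, UnitFun.extend_of_mem _ hm']
        calc _ ≤ ‖Complex.exp (eigOne P)‖ * (‖-rightCoeff σ P‖ * ‖g₁‖
              * exp (-rightRate σ * (t + 1))) := by gcongr; exact k1 _
          _ = ‖Complex.exp (eigOne P)‖ * (‖-rightCoeff σ P‖ * ‖g₁‖)
              * exp (-rightRate σ * (t + 1)) := by ring
          _ ≤ _ := by gcongr; exact le_max_left _ _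
      · simp only
        rw [← mul_sub, norm_mul, UnitFun.extend_of_mem _ hm']
        calc _ ≤ ‖Complex.exp (eigTwo P)‖ * (‖rightCoeff σ P‖ * ‖g₂‖
              * exp (-rightRate σ * (t + 1))) := by gcongr; exact k2 _
          _ = ‖Complex.exp (eigTwo P)‖ * (‖rightCoeff σ P‖ * ‖g₂‖)
              * exp (-rightRate σ * (t + 1)) := by ring
          _ ≤ _ := by gcongr; exact le_max_right _ _
      · have := UnitFun.norm_extend_le
          (Complex.exp (eigOne P) • (Y P).1 - (e : ℂ) • (1 : UnitFun)) (exp (-rightRate σ * (t + 1)))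
        refine le_trans (le_of_eq ?_) (this.trans hnP.1.le)
        simp [UnitFun.extend]
      · have := UnitFun.norm_extend_le (Complex.exp (eigTwo P) • (Y P).2) (exp (-rightRate σ * (t + 1)))
        exact this.trans hnP.2.le

end IsCenterPoint

/-! ### The chart equation in closed form -/

/-- The coefficient `C` of the coherent structure system as a function of `cos θ`. -/
def coeffC (P : Param) (y : ℝ) : ℂ :=
  ((P.h - P.Ω - P.μ * y : ℝ) : ℂ) + Complex.I * ((P.α * P.Ω - P.β / (1 + P.c * y) : ℝ) : ℂ)

theorem coeffC0_eq_coeffC (P : Param) : coeffC0 P = coeffC P 1 := by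
  simp [coeffC0, coeffC]

theorem coeffCpi_eq_coeffC (P : Param) : coeffCpi P = coeffC P (-1) := by
  simp [coeffCpi, coeffC, sub_eq_add_neg]

/-- The height of the point of the sphere with stereographic coordinate `x`. -/
def stereoHeight (x : ℂ) : ℝ := (1 - Complex.normSq x) / (1 + Complex.normSq x)

theorem one_add_normSq_pos (x : ℂ) : 0 < 1 + Complex.normSq x := by
  have := Complex.normSq_nonneg x; linarith

theorem abs_stereoHeight_le (x : ℂ) : |stereoHeight x| ≤ 1 := by
  have h := one_add_normSq_pos x
  have h0 := Complex.normSq_nonneg x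
  rw [stereoHeight, abs_le, le_div_iff₀ h, div_le_iff₀ h]
  constructor <;> linarith

theorem one_add_mul_pos {c y : ℝ} (hc : |c| < 1) (hy : |y| ≤ 1) : 0 < 1 + c * y := by
  have : |c * y| < 1 := by
    rw [abs_mul]
    exact lt_of_le_of_lt (mul_le_of_le_one_right (abs_nonneg _) hy) hc
  linarith [(abs_lt.1 this).1]

/-- The right hand side of the profile equation `x'' = F(x, x')` in the stereographic chart around
the pole `ε e₃`. -/
def wallField (ε : ℝ) (P : Param) (x v : ℂ) : ℂ :=
  coeffB P * v + ε * coeffC P (ε * stereoHeight x) * x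
    + 2 * conj x * v ^ 2 / (1 + Complex.normSq x : ℝ)

/-- The height differs from its value `1` at the centre of the chart by `2|x|²/(1 + |x|²)`;
therefore replacing the coefficient at the pole by the true one costs exactly the terms collected in
`cubic`. -/
theorem chartField_eq_wallField {ε : ℝ} (hε : ε = 1 ∨ ε = -1) {P : Param} (hc : |P.c| < 1)
    (x v : ℂ) : chartField ε P (ε * coeffC P ε) x v = wallField ε P x v := by
  have hN : ((1 + Complex.normSq x : ℝ) : ℂ) ≠ 0 := by
    exact_mod_cast (one_add_normSq_pos x).ne'
  obtain ⟨h1, -⟩ := abs_mul_lt_one hε hc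
  have h1' : ((1 + P.c * ε : ℝ) : ℂ) ≠ 0 := by exact_mod_cast h1.ne'
  have h2 := polarDenom_ne_zero hε hc zero_le_one x
  rw [Complex.ofReal_one, one_mul, conj_mul_self_eq] at h2
  have key : ((1 + P.c * ε : ℝ) : ℂ) + ((1 - P.c * ε : ℝ) : ℂ) * (Complex.normSq x : ℝ)
      = (1 + P.c * (ε * stereoHeight x) : ℝ) * (1 + Complex.normSq x : ℝ) := by
    have : stereoHeight x * (1 + Complex.normSq x) = 1 - Complex.normSq x :=
      div_mul_cancel₀ _ (one_add_normSq_pos x).ne'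
    norm_cast
    linear_combination (-(P.c * ε)) * this
  have h3 : ((1 + P.c * (ε * stereoHeight x) : ℝ) : ℂ) ≠ 0 := by
    rw [key] at h2; exact left_ne_zero_of_mul h2
  have hx : conj x * x = ((Complex.normSq x : ℝ) : ℂ) := conj_mul_self_eq x
  have hs : (stereoHeight x : ℂ) = (1 - Complex.normSq x) / (1 + Complex.normSq x) := by
    rw [stereoHeight]; push_cast; rfl
  have main : ε * coeffC P ε + (Complex.normSq x : ℂ) * (2 * P.μ * ((1 + Complex.normSq x : ℝ) : ℂ)⁻¹
      - polarCoeff ε P * ((1 + P.c * (ε * stereoHeight x) : ℝ) * (1 + Complex.normSq x : ℝ) : ℂ)⁻¹)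
      = ε * coeffC P (ε * stereoHeight x) := by
    have hNE : (Complex.normSq x : ℂ) * ((1 + Complex.normSq x : ℝ) : ℂ)⁻¹ = (1 - stereoHeight x) / 2 := by
      rw [hs]; push_cast at hN ⊢; field_simp; ring
    have e1 : (Complex.normSq x : ℂ) * (2 * P.μ * ((1 + Complex.normSq x : ℝ) : ℂ)⁻¹
        - polarCoeff ε P * ((1 + P.c * (ε * stereoHeight x) : ℝ) * (1 + Complex.normSq x : ℝ) : ℂ)⁻¹)
        = (1 - stereoHeight x) * (P.μ - polarCoeff ε P / 2
          * ((1 + P.c * (ε * stereoHeight x) : ℝ) : ℂ)⁻¹) := by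
      rw [mul_inv]
      linear_combination (2 * P.μ - polarCoeff ε P
        * ((1 + P.c * (ε * stereoHeight x) : ℝ) : ℂ)⁻¹) * hNE
    rw [e1]
    simp only [coeffC, polarCoeff]
    rcases hε with rfl | rfl
    · push_cast at h1' h3 ⊢
      simp only [mul_one, one_mul] at h1' h3 ⊢
      field_simp
      ring
    · push_cast at h1' h3 ⊢
      simp only [mul_neg, mul_one, neg_mul, one_mul, ← sub_eq_add_neg] at h1' h3 ⊢
      field_simp
      ring
  rw [wallField, ← main]
  simp only [chartField, cubic, Complex.ofReal_one, one_mul, hx, key]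
  rw [div_eq_mul_inv]
  push_cast
  linear_combination (x * (2 * P.μ * (1 + Complex.normSq x : ℂ)⁻¹
      - polarCoeff ε P * ((1 + P.c * (ε * stereoHeight x)) * (1 + Complex.normSq x))⁻¹)) * hx

theorem stereoHeight_inv {x : ℂ} (hx : x ≠ 0) : stereoHeight x⁻¹ = -stereoHeight x := by
  have h := one_add_normSq_pos x
  have h0 : Complex.normSq x ≠ 0 := by simpa using hx
  rw [stereoHeight, stereoHeight, Complex.normSq_inv]
  field_simp
  rw [add_comm (Complex.normSq x)]
  field_simp
  ring

/-- The inversion exchanges the two stereographic charts. -/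
theorem hasDerivAt_inv_chart (ε : ℝ) {P : Param} {ζ v : ℝ → ℂ} {ξ : ℝ} (h : HasDerivAt ζ (v ξ) ξ)
    (hv : HasDerivAt v (wallField ε P (ζ ξ) (v ξ)) ξ) (h0 : ζ ξ ≠ 0) :
    HasDerivAt (fun ξ => (ζ ξ)⁻¹) (-v ξ / ζ ξ ^ 2) ξ ∧
    HasDerivAt (fun ξ => -v ξ / ζ ξ ^ 2) (wallField (-ε) P (ζ ξ)⁻¹ (-v ξ / ζ ξ ^ 2)) ξ := by
  refine ⟨h.inv h0, ?_⟩
  have h2 := hv.neg.div (h.pow 2) (pow_ne_zero 2 h0)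
  refine h2.congr_deriv ?_
  have hN : ((1 + Complex.normSq (ζ ξ) : ℝ) : ℂ) ≠ 0 := by
    exact_mod_cast (one_add_normSq_pos (ζ ξ)).ne'
  have hN0 : ((Complex.normSq (ζ ξ) : ℝ) : ℂ) ≠ 0 := by
    exact_mod_cast (by simpa using h0 : Complex.normSq (ζ ξ) ≠ 0)
  have hc0 : conj (ζ ξ) ≠ 0 := by simpa using h0
  have hx : conj (ζ ξ) * ζ ξ = ((Complex.normSq (ζ ξ) : ℝ) : ℂ) := conj_mul_self_eq _
  simp only [wallField, stereoHeight_inv h0, map_inv₀, Pi.neg_apply, Pi.pow_apply]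
  push_cast at hN ⊢
  rw [← hx] at hN hN0 ⊢
  simp only [neg_mul_neg]
  generalize coeffC P (ε * stereoHeight (ζ ξ)) = K
  generalize coeffB P = B
  generalize ζ ξ = x at *
  generalize v ξ = w
  generalize conj x = y at *
  have hN' : 1 + (y * x)⁻¹ = (1 + y * x) / (y * x) := by field_simp; ring
  -- From here on `x` and its conjugate `y` are independent letters, and what remains is an identity
  -- of rational functions.
  have hy : y * (1 + y * x)⁻¹ * x = 1 - (1 + y * x)⁻¹ := by
    field_simp; ring
  rw [hN']
  have e : 2 * y⁻¹ * (-w / x ^ 2) ^ 2 / ((1 + y * x) / (y * x)) = 2 * w ^ 2 / x ^ 3 * (1 + y * x)⁻¹ := by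
    field_simp
  rw [e]
  have e2 : 2 * y * w ^ 2 / (1 + y * x) = 2 * w ^ 2 / x * (1 - (1 + y * x)⁻¹) := by
    rw [← hy]; field_simp
  rw [e2]
  generalize (1 + y * x)⁻¹ = E
  field_simp
  ring

theorem contDiff_wallField {ε : ℝ} (hε : ε = 1 ∨ ε = -1) {P : Param} (hc : |P.c| < 1) :
    ContDiff ℝ ω (fun x : ℂ × ℂ => wallField ε P x.1 x.2) := by
  rw [contDiff_iff_contDiffAt]
  intro x
  have hN := one_add_normSq_pos x.1
  have hns : ContDiffAt ℝ ω (fun x : ℂ × ℂ => Complex.normSq x.1) x := by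
    simp only [Complex.normSq_apply]; fun_prop
  have hh : ContDiffAt ℝ ω (fun x : ℂ × ℂ => stereoHeight x.1) x := by
    simp only [stereoHeight]
    exact ContDiffAt.div (by fun_prop) (by fun_prop) hN.ne'
  have hD : 1 + P.c * (ε * stereoHeight x.1) ≠ 0 := by
    refine (one_add_mul_pos hc ?_).ne'
    rw [abs_mul]
    rcases hε with rfl | rfl <;> simpa using abs_stereoHeight_le _
  have h2 : ContDiffAt ℝ ω (fun x : ℂ × ℂ => P.β / (1 + P.c * (ε * stereoHeight x.1))) x :=
    ContDiffAt.div (by fun_prop) (by fun_prop) hD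
  have h3 : ContDiffAt ℝ ω (fun x : ℂ × ℂ => 2 * conj x.1 * x.2 ^ 2
      / (1 + Complex.normSq x.1 : ℝ)) x :=
    contDiffAt_cdiv (by fun_prop) (by fun_prop) (by exact_mod_cast hN.ne')
  simp only [wallField, coeffC]
  fun_prop

/-- Two solutions of the chart equation with the same initial values agree. -/
theorem wallField_unique {ε : ℝ} (hε : ε = 1 ∨ ε = -1) {P : Param} (hc : |P.c| < 1) {a b t₀ : ℝ}
    (ht : t₀ ∈ Ioo a b) {x v y w : ℝ → ℂ}
    (hx : ∀ t ∈ Icc a b, HasDerivAt x (v t) t ∧ HasDerivAt v (wallField ε P (x t) (v t)) t)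
    (hy : ∀ t ∈ Icc a b, HasDerivAt y (w t) t ∧ HasDerivAt w (wallField ε P (y t) (w t)) t)
    (h0 : x t₀ = y t₀) (h1 : v t₀ = w t₀) : EqOn x y (Ioo a b) := by
  set F : ℂ × ℂ → ℂ × ℂ := fun p => (p.2, wallField ε P p.1 p.2) with hF
  have hFc : ContDiff ℝ ω F := contDiff_snd.prodMk (contDiff_wallField hε hc)
  have hbd : ∀ {x v : ℝ → ℂ}, (∀ t ∈ Icc a b, HasDerivAt x (v t) t ∧
      HasDerivAt v (wallField ε P (x t) (v t)) t) →
      ∃ R, ∀ t ∈ Icc a b, (x t, v t) ∈ Metric.closedBall (0 : ℂ × ℂ) R := by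
    intro x v h
    have hcont : ContinuousOn (fun t => (x t, v t)) (Icc a b) := fun t ht =>
      ((h t ht).1.continuousAt.prodMk (h t ht).2.continuousAt).continuousWithinAt
    obtain ⟨R, hR⟩ := (isCompact_Icc.image_of_continuousOn hcont).isBounded.subset_closedBall 0
    exact ⟨R, fun t ht => hR (mem_image_of_mem _ ht)⟩
  obtain ⟨R₁, hR₁⟩ := hbd hx
  obtain ⟨R₂, hR₂⟩ := hbd hy
  -- On a closed ball that contains both compact pieces of orbit the smooth field is Lipschitz.
  obtain ⟨K, hK⟩ := (hFc.contDiffOn (s := Metric.closedBall (0 : ℂ × ℂ) (max R₁ R₂))).exists_lipschitzOnWith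
    (by simp) (convex_closedBall _ _) (isCompact_closedBall _ _)
  have key := ODE_solution_unique_of_mem_Ioo (v := fun _ => F) (K := K)
    (s := fun _ => Metric.closedBall (0 : ℂ × ℂ) (max R₁ R₂)) (f := fun t => (x t, v t))
    (g := fun t => (y t, w t)) (fun _ _ => hK) ht
    (fun t ht => ⟨(hx t (Ioo_subset_Icc_self ht)).1.prodMk (hx t (Ioo_subset_Icc_self ht)).2,
      Metric.closedBall_subset_closedBall (le_max_left _ _) (hR₁ t (Ioo_subset_Icc_self ht))⟩)
    (fun t ht => ⟨(hy t (Ioo_subset_Icc_self ht)).1.prodMk (hy t (Ioo_subset_Icc_self ht)).2,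
      Metric.closedBall_subset_closedBall (le_max_right _ _) (hR₂ t (Ioo_subset_Icc_self ht))⟩)
    (Prod.ext h0 h1)
  exact fun t ht => congrArg Prod.fst (key ht)

/-! ### Matching the two charts -/

/-- The stereographic coordinates `ζ` and `η = 1 / ζ` of a profile at the parameters `P`, with
derivatives `v` and `w`, the first one for `ξ < T + 1`, the second one for `ξ > T - 1`. -/
structure IsWallCurve (P : Param) (T : ℝ) (ζ v η w : ℝ → ℂ) : Prop where
  left_deriv : ∀ ξ, ξ < T + 1 → HasDerivAt ζ (v ξ) ξ
  left_deriv' : ∀ ξ, ξ < T + 1 → HasDerivAt v (wallField 1 P (ζ ξ) (v ξ)) ξ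
  left_ne : ∀ ξ, ξ < T + 1 → ζ ξ ≠ 0
  right_deriv : ∀ ξ, T - 1 < ξ → HasDerivAt η (w ξ) ξ
  right_deriv' : ∀ ξ, T - 1 < ξ → HasDerivAt w (wallField (-1) P (η ξ) (w ξ)) ξ
  eq_inv : ∀ ξ, T - 1 < ξ → ξ < T + 1 → η ξ = (ζ ξ)⁻¹

/-- The behaviour of a profile at the two ends. -/
structure HasWallAsymptotics (P : Param) (σ T e : ℝ) (ζ v η w : ℝ → ℂ) : Prop where
  left : Tendsto ζ atBot (𝓝 0)
  left_wavenumber : Tendsto (fun ξ => v ξ / ζ ξ) atBot (𝓝 (zZeroMinus P))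
  right : ∃ (a₁ a₂ : ℂ) (U₁ U₂ : ℝ → ℂ) (C : ℝ), ∀ t, 0 ≤ t →
    η (T + t) = Complex.exp (eigOne P * t) * U₁ t + Complex.exp (eigTwo P * t) * U₂ t ∧
    w (T + t) = eigOne P * (Complex.exp (eigOne P * t) * U₁ t)
      + eigTwo P * (Complex.exp (eigTwo P * t) * U₂ t) ∧
    ‖U₁ t - a₁‖ ≤ C * exp (-rightRate σ * t) ∧ ‖U₂ t - a₂‖ ≤ C * exp (-rightRate σ * t) ∧
    ‖U₁ t - e‖ ≤ e / 4 ∧ ‖U₂ t‖ ≤ e / 4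

variable {P₀ : Param} {σ : ℝ}

/-- The left solution is followed until it is deep in the basin of `-e₃`; its position and velocity
there serve as data for the right solution, and uniqueness glues the two. -/
theorem IsCenterPoint.exists_wall_curves (hc : IsCenterPoint P₀ σ) :
    ∃ (T e : ℝ) (ζ v η w : Param → ℝ → ℂ), 0 < e ∧
      (∀ ξ, ζ P₀ ξ = Complex.exp (σ * ξ)) ∧ (∀ ξ, T - 1 < ξ → η P₀ ξ = Complex.exp (-(σ * ξ))) ∧
      ∀ᶠ P in 𝓝 P₀, RightAdmissible σ P ∧ IsWallCurve P T (ζ P) (v P) (η P) (w P) ∧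
        HasWallAsymptotics P σ T e (ζ P) (v P) (η P) (w P) ∧
        (∀ ξ, ξ < T + 1 → ContDiffAt ℝ ω (Function.uncurry ζ) (P, ξ)) ∧
        (∀ ξ, T - 1 < ξ → ContDiffAt ℝ ω (Function.uncurry η) (P, ξ)) := by
  obtain ⟨r, hr, hright⟩ := hc.exists_right_solution
  have hσ := hc.σ_pos
  -- The inverse coordinate of the explicit wall at `T` is `exp (-σ T)`, which must lie in the range
  -- of the local theory at the right pole.
  obtain ⟨T, hT⟩ : ∃ T : ℝ, exp (-(σ * T)) < r := by
    have h1 : Tendsto (fun T : ℝ => exp (-(σ * T))) atTop (𝓝 0) :=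
      Real.tendsto_exp_neg_atTop_nhds_zero.comp (tendsto_id.const_mul_atTop hσ)
    exact (h1.eventually (gt_mem_nhds hr)).exists
  set e := exp (-(σ * T)) with he
  have he0 : 0 < e := exp_pos _
  -- The additional `1` in the exponent absorbs the difference between `leftRate P` and `σ` up to `ξ
  -- = T + 1`.
  obtain ⟨ζ, v, hζ0, hζ⟩ := exists_left_solution hc (R := exp (2 * (σ * (T + 1) + 1))) (exp_pos _)
  have hrate : ∀ᶠ P in 𝓝 P₀, ∀ ξ, ξ < T + 1 →
      exp (2 * leftRate P * ξ) ≤ exp (2 * (σ * (T + 1) + 1)) := by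
    have hl0 : leftRate P₀ = σ := by simp [leftRate, hc.zZeroMinus_eq]
    have hlc : ContinuousAt leftRate P₀ :=
      Complex.continuous_re.continuousAt.comp (continuousAt_zZeroMinus hc)
    have h1 : ∀ᶠ P in 𝓝 P₀, leftRate P * (T + 1) < σ * (T + 1) + 1 :=
      (hlc.mul continuousAt_const).eventually (gt_mem_nhds (by simp [hl0]))
    filter_upwards [h1, leftRate_pos_eventually hc] with P h1 h2 ξ hξ
    refine exp_le_exp.2 ?_
    have := mul_lt_mul_of_pos_left hξ h2
    linarith
  have hleft0 := fun ξ hξ => hζ.self_of_nhds.1 ξ (hrate.self_of_nhds ξ hξ)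
  -- Eigencomponents of the inverted data: `b₁ + b₂ = 1/ζ` and `l₁ b₁ + l₂ b₂ = (1/ζ)'` at `T`.
  set b : Param → ℂ × ℂ := fun P =>
    ((-v P T / ζ P T ^ 2 - eigTwo P * (ζ P T)⁻¹) / (eigOne P - eigTwo P),
      (eigOne P * (ζ P T)⁻¹ - (-v P T / ζ P T ^ 2)) / (eigOne P - eigTwo P)) with hb
  have hne0 := sub_ne_zero.2 hc.eig_ne
  have hζT : ContDiffAt ℝ ω (fun P => ζ P T) P₀ :=
    (hleft0 T (by linarith)).1.comp P₀ (f := fun P => (P, T)) (contDiffAt_id.prodMk contDiffAt_const)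
  have hvT : ContDiffAt ℝ ω (fun P => v P T) P₀ :=
    (hleft0 T (by linarith)).2.1.comp P₀ (f := fun P => (P, T)) (contDiffAt_id.prodMk contDiffAt_const)
  have hζT0 : ζ P₀ T ≠ 0 := (hleft0 T (by linarith)).2.2.2.2
  have hbc : ContDiffAt ℝ ω b P₀ := by
    have h1 := hc.contDiffAt_eigOne
    have h2 := hc.contDiffAt_eigTwo
    have h3 : ContDiffAt ℝ ω (fun P => (ζ P T)⁻¹) P₀ := by
      simpa using contDiffAt_cdiv (contDiffAt_const (c := (1 : ℂ))) hζT hζT0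
    have h4 : ContDiffAt ℝ ω (fun P => -v P T / ζ P T ^ 2) P₀ :=
      contDiffAt_cdiv hvT.neg (hζT.pow 2) (pow_ne_zero 2 hζT0)
    exact (contDiffAt_cdiv (h4.sub (h2.mul h3)) (h1.sub h2) hne0).prodMk
      (contDiffAt_cdiv ((h1.mul h3).sub h4) (h1.sub h2) hne0)
  have hinv0 : (ζ P₀ T)⁻¹ = e := by
    rw [(hζ0 T).1, ← Complex.exp_neg, he]; push_cast; rfl
  have hw0 : -v P₀ T / ζ P₀ T ^ 2 = eigOne P₀ * e := by
    rw [← hinv0, (hζ0 T).2, ← (hζ0 T).1, hc.eigOne_eq]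
    field_simp
  have hb0 : b P₀ = ((e : ℂ), 0) := by
    simp only [hb]
    rw [hw0, hinv0]
    refine Prod.ext ?_ ?_
    · simp only; field_simp
    · simp
  obtain ⟨η, w, hη0, hη⟩ := hright b e he0 hT hbc hb0
  refine ⟨T, e, ζ, v, fun P ξ => η P (ξ - T), fun P ξ => w P (ξ - T), he0, fun ξ => (hζ0 ξ).1,
    fun ξ hξ => ?_, ?_⟩
  · simp only
    rw [hη0 _ (by linarith), he]
    push_cast
    rw [← Complex.exp_add]
    congr 1
    ring
  filter_upwards [hζ, hrate, hη, hc.rightAdmissible_eventually] with P hζP hrP hηP hadm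
  obtain ⟨hζ1, hζ2, hζ3⟩ := hζP
  obtain ⟨hη1, hη2, hη3, hη4⟩ := hηP
  have hc1 := hadm.c_lt
  have hK1 : ∀ x v, chartField 1 P (coeffC0 P) x v = wallField 1 P x v := fun x v => by
    rw [coeffC0_eq_coeffC, ← chartField_eq_wallField (Or.inl rfl) hc1]; simp
  have hK2 : ∀ x v, chartField (-1) P (-coeffCpi P) x v = wallField (-1) P x v := fun x v => by
    rw [coeffCpi_eq_coeffC, ← chartField_eq_wallField (Or.inr rfl) hc1]; simp
  have hL := fun ξ hξ => hζ1 ξ (hrP ξ hξ)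
  have hL2 : ∀ ξ, ξ < T + 1 → HasDerivAt (v P) (wallField 1 P (ζ P ξ) (v P ξ)) ξ := fun ξ hξ => by
    rw [← hK1]; exact (hL ξ hξ).2.2.2.1
  have hR1 : ∀ ξ, T - 1 < ξ → HasDerivAt (fun ξ => η P (ξ - T)) (w P (ξ - T)) ξ := fun ξ hξ =>
    (hη1 (ξ - T) (by linarith)).2.1.comp_sub_const ξ T
  have hR2 : ∀ ξ, T - 1 < ξ → HasDerivAt (fun ξ => w P (ξ - T))
      (wallField (-1) P (η P (ξ - T)) (w P (ξ - T))) ξ := fun ξ hξ => by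
    rw [← hK2]; exact (hη1 (ξ - T) (by linarith)).2.2.comp_sub_const ξ T
  have hne : eigOne P - eigTwo P ≠ 0 := sub_ne_zero.2 hadm.ne
  have hI : ∀ ξ, ξ < T + 1 → _ := fun ξ hξ =>
    hasDerivAt_inv_chart 1 (hL ξ hξ).2.2.1 (hL2 ξ hξ) (hL ξ hξ).2.2.2.2
  refine ⟨hadm, ⟨fun ξ hξ => (hL ξ hξ).2.2.1, hL2, fun ξ hξ => (hL ξ hξ).2.2.2.2, hR1, hR2, ?_⟩,
    ⟨hζ2, hζ3, ?_⟩, fun ξ hξ => (hL ξ hξ).1, fun ξ hξ => ?_⟩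
  · intro ξ h1 h2
    -- Uniqueness is formulated on closed intervals, while both curves are controlled only on the
    -- open overlap.
    obtain ⟨ρ, hρ0, hρ1, hρ2⟩ : ∃ ρ, 0 < ρ ∧ ρ < 1 ∧ |ξ - T| < ρ := by
      have : |ξ - T| < 1 := abs_lt.2 ⟨by linarith, by linarith⟩
      obtain ⟨ρ, h3, h4⟩ := exists_between this
      exact ⟨ρ, (abs_nonneg _).trans_lt h3, h4, h3⟩
    have hρ3 := abs_lt.1 hρ2
    refine wallField_unique (Or.inr rfl) hc1 (a := T - ρ) (b := T + ρ) (t₀ := T)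
      ⟨by linarith, by linarith⟩
      (fun t ht => ⟨hR1 t (by linarith [ht.1]), hR2 t (by linarith [ht.1])⟩)
      (fun t ht => hI t (by linarith [ht.2])) ?_ ?_ ⟨by linarith, by linarith⟩
    · simp only [sub_self, hη2, hb]
      rw [← add_div, div_eq_iff hne]
      ring
    · simp only [sub_self, hη3, hb]
      rw [mul_div_assoc', mul_div_assoc', ← add_div, div_eq_iff hne]
      ring
  · simpa only [add_sub_cancel_left] using hη4
  · exact (hη1 (ξ - T) (by linarith)).1.comp (P, ξ) (f := fun q : Param × ℝ => (q.1, q.2 - T))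
      (by fun_prop)

/-! ### Rotating and travelling profiles -/

theorem vec_ext {u v : Vec} (h0 : u 0 = v 0) (h1 : u 1 = v 1) (h2 : u 2 = v 2) : u = v := by
  ext i; fin_cases i <;> assumption

theorem cross_apply_zero (u v : Vec) : crossProduct u v 0 = u 1 * v 2 - u 2 * v 1 := by
  simp [cross_apply]

theorem cross_apply_one (u v : Vec) : crossProduct u v 1 = u 2 * v 0 - u 0 * v 2 := by
  simp [cross_apply]

theorem cross_apply_two (u v : Vec) : crossProduct u v 2 = u 0 * v 1 - u 1 * v 0 := by
  simp [cross_apply]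

theorem rot_cross (a : ℝ) (u v : Vec) :
    crossProduct (rot a u) (rot a v) = rot a (crossProduct u v) := by
  have h := sin_sq_add_cos_sq a
  apply vec_ext
  · simp only [cross_apply_zero, cross_apply_one, cross_apply_two, rot, Matrix.cons_val]
    ring
  · simp only [cross_apply_zero, cross_apply_one, cross_apply_two, rot, Matrix.cons_val]
    ring
  · simp only [cross_apply_zero, cross_apply_one, cross_apply_two, rot, Matrix.cons_val]
    linear_combination (u 0 * v 1 - u 1 * v 0) * h

theorem rot_add (a : ℝ) (u v : Vec) : rot a (u + v) = rot a u + rot a v := by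
  apply vec_ext <;> simp [rot] <;> ring

theorem rot_sub (a : ℝ) (u v : Vec) : rot a (u - v) = rot a u - rot a v := by
  apply vec_ext <;> simp [rot] <;> ring

theorem rot_smul (a c : ℝ) (u : Vec) : rot a (c • u) = c • rot a u := by
  apply vec_ext <;> simp [rot] <;> ring

theorem rot_neg (a : ℝ) (u : Vec) : rot a (-u) = -rot a u := by
  apply vec_ext <;> simp [rot] <;> ring

theorem rot_e3 (a : ℝ) : rot a e3 = e3 := by
  apply vec_ext <;> simp [rot, e3]

theorem hasDerivAt_rot {a : ℝ → ℝ} {u : ℝ → Vec} {a' t : ℝ} {u' : Vec} (ha : HasDerivAt a a' t)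
    (hu : HasDerivAt u u' t) :
    HasDerivAt (fun t => rot (a t) (u t)) (rot (a t) (u' + a' • crossProduct e3 (u t))) t := by
  have h := hasDerivAt_pi.1 hu
  rw [hasDerivAt_pi]
  intro i
  fin_cases i
  · refine ((ha.cos.mul (h 0)).sub (ha.sin.mul (h 1))).congr_deriv ?_
    simp [rot, cross_apply, e3]
    ring
  · refine ((ha.sin.mul (h 0)).add (ha.cos.mul (h 1))).congr_deriv ?_
    simp [rot, cross_apply, e3]
    ring
  · refine (h 2).congr_deriv ?_
    simp [rot, cross_apply, e3]

/-- The profile equation of relative equilibria. -/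
def IsProfileAt (P : Param) (m m' m'' : Vec) : Prop :=
  (-P.s • m' + P.Ω • crossProduct e3 m)
      - P.α • crossProduct m (-P.s • m' + P.Ω • crossProduct e3 m)
    = -crossProduct m (effField P m m'') + crossProduct m (crossProduct m (current P m))

/-- The equation is equivariant under rotations about `e₃` and invariant under translations, so it
reduces to a condition on the profile. -/
theorem solvesLLGS_of_profile {P : Param} {m m' m'' : ℝ → Vec}
    (h1 : ∀ ξ, HasDerivAt m (m' ξ) ξ) (h2 : ∀ ξ, HasDerivAt m' (m'' ξ) ξ)
    (h : ∀ ξ, IsProfileAt P (m ξ) (m' ξ) (m'' ξ)) : SolvesLLGS P (relEquilibrium P m) := by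
  intro x t
  have ht : HasDerivAt (fun τ => relEquilibrium P m x τ) (rot (P.Ω * t)
      (-P.s • m' (x - P.s * t) + P.Ω • crossProduct e3 (m (x - P.s * t)))) t := by
    have e1 : HasDerivAt (fun τ => P.Ω * τ) P.Ω t := by
      simpa using (hasDerivAt_id t).const_mul P.Ω
    have e2 : HasDerivAt (fun τ => x - P.s * τ) (-P.s) t := by
      simpa using ((hasDerivAt_id t).const_mul P.s).const_sub x
    exact hasDerivAt_rot e1 ((h1 (x - P.s * t)).scomp t e2)
  have hx : ∀ {n n' : ℝ → Vec}, (∀ ξ, HasDerivAt n (n' ξ) ξ) →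
      deriv (fun y => rot (P.Ω * t) (n (y - P.s * t))) = fun y => rot (P.Ω * t) (n' (y - P.s * t)) := by
    intro n n' hn
    ext1 y
    have := hasDerivAt_rot (hasDerivAt_const y (P.Ω * t)) ((hn (y - P.s * t)).comp_sub_const y (P.s * t))
    rw [zero_smul, add_zero] at this
    exact this.deriv
  have hxx : iteratedDeriv 2 (fun y => relEquilibrium P m y t) x
      = rot (P.Ω * t) (m'' (x - P.s * t)) := by
    rw [iteratedDeriv_succ, iteratedDeriv_one]
    change deriv (deriv (fun y => rot (P.Ω * t) (m (y - P.s * t)))) x = _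
    rw [hx h1, hx h2]
  rw [ht.deriv, hxx]
  have hm2 : relEquilibrium P m x t 2 = m (x - P.s * t) 2 := rfl
  have heff : effField P (relEquilibrium P m x t) (rot (P.Ω * t) (m'' (x - P.s * t)))
      = rot (P.Ω * t) (effField P (m (x - P.s * t)) (m'' (x - P.s * t))) := by
    simp only [effField, hm2, rot_add, rot_sub, rot_smul, rot_e3]
  have hcur : current P (relEquilibrium P m x t) = rot (P.Ω * t) (current P (m (x - P.s * t))) := by
    simp only [current, hm2, rot_smul, rot_e3]
  rw [heff, hcur]
  simp only [relEquilibrium]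
  simp only [rot_cross]
  rw [← rot_smul, ← rot_sub, ← rot_neg, ← rot_add]
  exact congrArg _ (h (x - P.s * t))

/-! ### Stereographic charts -/

/-- The point of the sphere with coordinate `x` in the stereographic chart around `ε e₃`. -/
def stereo (ε : ℝ) (x : ℂ) : Vec :=
  ![2 * x.re / (1 + Complex.normSq x), ε * (2 * x.im) / (1 + Complex.normSq x), ε * stereoHeight x]

/-- The derivative of the stereographic parametrization in the direction `v`. -/
def stereoVel (ε : ℝ) (x v : ℂ) : Vec :=
  ![(2 * v.re * (1 + Complex.normSq x) - 2 * x.re * (2 * (x.re * v.re + x.im * v.im)))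
      / (1 + Complex.normSq x) ^ 2,
    ε * (2 * v.im * (1 + Complex.normSq x) - 2 * x.im * (2 * (x.re * v.re + x.im * v.im)))
      / (1 + Complex.normSq x) ^ 2,
    ε * (-4 * (x.re * v.re + x.im * v.im)) / (1 + Complex.normSq x) ^ 2]

/-- The second derivative of `stereo ε x` along a curve with velocity `v` and acceleration `a`. -/
def stereoAcc (ε : ℝ) (x v a : ℂ) : Vec :=
  stereoVel ε x a +
  ![(2 * v.re * (2 * (x.re * v.re + x.im * v.im)) - 2 * v.re * (2 * (x.re * v.re + x.im * v.im))
      - 2 * x.re * (2 * Complex.normSq v)) / (1 + Complex.normSq x) ^ 2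
      - 2 * (2 * (x.re * v.re + x.im * v.im)) * stereoVel ε x v 0 / (1 + Complex.normSq x),
    ε * (2 * v.im * (2 * (x.re * v.re + x.im * v.im)) - 2 * v.im * (2 * (x.re * v.re + x.im * v.im))
      - 2 * x.im * (2 * Complex.normSq v)) / (1 + Complex.normSq x) ^ 2
      - 2 * (2 * (x.re * v.re + x.im * v.im)) * stereoVel ε x v 1 / (1 + Complex.normSq x),
    ε * (-4 * Complex.normSq v) / (1 + Complex.normSq x) ^ 2
      - 2 * (2 * (x.re * v.re + x.im * v.im)) * stereoVel ε x v 2 / (1 + Complex.normSq x)]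

section

variable {x v : ℝ → ℂ} {a : ℂ} {t : ℝ}

theorem hasDerivAt_re {z : ℂ} (h : HasDerivAt x z t) : HasDerivAt (fun t => (x t).re) z.re t :=
  Complex.reCLM.hasFDerivAt.comp_hasDerivAt t h

theorem hasDerivAt_im {z : ℂ} (h : HasDerivAt x z t) : HasDerivAt (fun t => (x t).im) z.im t :=
  Complex.imCLM.hasFDerivAt.comp_hasDerivAt t h

theorem hasDerivAt_normSq {z : ℂ} (h : HasDerivAt x z t) :
    HasDerivAt (fun t => Complex.normSq (x t)) (2 * ((x t).re * z.re + (x t).im * z.im)) t := by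
  simp only [Complex.normSq_apply]
  refine (((hasDerivAt_re h).mul (hasDerivAt_re h)).add
    ((hasDerivAt_im h).mul (hasDerivAt_im h))).congr_deriv ?_
  ring

theorem hasDerivAt_stereo (ε : ℝ) {z : ℂ} (h : HasDerivAt x z t) :
    HasDerivAt (fun t => stereo ε (x t)) (stereoVel ε (x t) z) t := by
  have hN := (one_add_normSq_pos (x t)).ne'
  have h1 := hasDerivAt_re h
  have h2 := hasDerivAt_im h
  have h3 := (hasDerivAt_normSq h)
  have h4 := h3.const_add 1
  rw [hasDerivAt_pi]
  intro i
  fin_cases i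
  · exact (h1.const_mul 2).div h4 hN
  · refine (((h2.const_mul 2).const_mul ε).div h4 hN).congr_deriv ?_
    simp [stereoVel]
    ring
  · refine (((h3.const_sub 1).div h4 hN).const_mul ε).congr_deriv ?_
    simp [stereoVel]
    ring

theorem hasDerivAt_stereoVel (ε : ℝ) (h : HasDerivAt x (v t) t) (hv : HasDerivAt v a t) :
    HasDerivAt (fun t => stereoVel ε (x t) (v t)) (stereoAcc ε (x t) (v t) a) t := by
  have hN := (one_add_normSq_pos (x t)).ne'
  have h1 := hasDerivAt_re h
  have h2 := hasDerivAt_im h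
  have h3 := (hasDerivAt_normSq h).const_add 1
  have h4 := hasDerivAt_re hv
  have h5 := hasDerivAt_im hv
  have h6 := ((h1.mul h4).add (h2.mul h5))
  have h7 := h3.pow 2
  have hN2 := pow_ne_zero 2 hN
  rw [hasDerivAt_pi]
  intro i
  fin_cases i
  · refine ((((h4.const_mul 2).mul h3).sub ((h1.const_mul 2).mul (h6.const_mul 2))).div h7
      hN2).congr_deriv ?_
    simp only [stereoAcc, stereoVel, Pi.add_apply, Matrix.cons_val, Pi.mul_apply, Pi.pow_apply,
      Complex.normSq_apply (v t)]
    simp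
    field_simp
    ring
  · refine (((((h5.const_mul 2).mul h3).sub ((h2.const_mul 2).mul (h6.const_mul 2))).const_mul ε).div
      h7 hN2).congr_deriv ?_
    simp only [stereoAcc, stereoVel, Pi.add_apply, Matrix.cons_val, Pi.mul_apply, Pi.pow_apply,
      Complex.normSq_apply (v t)]
    simp
    field_simp
    ring
  · refine (((h6.const_mul (-4)).const_mul ε).div h7 hN2).congr_deriv ?_
    simp only [stereoAcc, stereoVel, Pi.add_apply, Matrix.cons_val, Pi.mul_apply, Pi.pow_apply,
      Complex.normSq_apply (v t)]
    simp
    field_simp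
    ring

end

theorem stereo_sphere {ε : ℝ} (hε : ε ^ 2 = 1) (x : ℂ) :
    stereo ε x 0 ^ 2 + stereo ε x 1 ^ 2 + stereo ε x 2 ^ 2 = 1 := by
  have hN := (one_add_normSq_pos x).ne'
  simp only [stereo, stereoHeight, Matrix.cons_val, Complex.normSq_apply] at hN ⊢
  field_simp
  simp only [hε]
  ring

theorem stereoVel_add (ε : ℝ) (x u v : ℂ) :
    stereoVel ε x (u + v) = stereoVel ε x u + stereoVel ε x v := by
  apply vec_ext <;> simp [stereoVel] <;> ring

theorem stereoVel_smul (ε : ℝ) (x v : ℂ) (c : ℝ) : stereoVel ε x (c * v) = c • stereoVel ε x v := by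
  apply vec_ext <;> simp [stereoVel] <;> ring

/-- Both charts are conformal and equally oriented, so the quarter turn `m ×` of the tangent plane
is multiplication by `i`. -/
theorem cross_stereoVel {ε : ℝ} (hε : ε ^ 2 = 1) (x v : ℂ) :
    crossProduct (stereo ε x) (stereoVel ε x v) = stereoVel ε x (Complex.I * v) := by
  have hN := (one_add_normSq_pos x).ne'
  apply vec_ext <;>
  · simp only [cross_apply_zero, cross_apply_one, cross_apply_two, stereo, stereoVel, stereoHeight,
      Matrix.cons_val, Complex.normSq_apply, Complex.mul_re, Complex.mul_im, Complex.I_re,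
      Complex.I_im] at hN ⊢
    field_simp
    try simp only [hε]
    ring

/-- Rotation about `e₃` by `a` acts on the coordinate as multiplication by `exp (i ε a)`; this is
its generator. -/
theorem e3_cross_stereo {ε : ℝ} (hε : ε ^ 2 = 1) (x : ℂ) :
    crossProduct e3 (stereo ε x) = stereoVel ε x ((ε : ℂ) * (Complex.I * x)) := by
  have hN := (one_add_normSq_pos x).ne'
  rw [stereoVel_smul]
  apply vec_ext <;>
  · simp only [cross_apply_zero, cross_apply_one, cross_apply_two, stereo, stereoVel, stereoHeight, e3,
      Matrix.cons_val, Complex.normSq_apply, Complex.mul_re, Complex.mul_im, Complex.I_re,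
      Complex.I_im, Pi.smul_apply, smul_eq_mul] at hN ⊢
    field_simp
    try simp only [hε]
    ring

/-- `m ×` removes the normal part of the acceleration. The tangential part is the covariant
derivative of the round metric, whose Christoffel term is `-2 x̄ v² / (1 + |x|²)`. -/
theorem cross_stereoAcc {ε : ℝ} (hε : ε ^ 2 = 1) (x v a : ℂ) :
    crossProduct (stereo ε x) (stereoAcc ε x v a) = stereoVel ε x
      (Complex.I * (a - 2 * conj x * v ^ 2 / (1 + Complex.normSq x : ℝ))) := by
  have hN := (one_add_normSq_pos x).ne'
  have hR : Complex.I * (a - 2 * conj x * v ^ 2 / (1 + Complex.normSq x : ℝ)) = Complex.I * a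
      + ((-2 / (1 + Complex.normSq x) : ℝ) : ℂ) * (Complex.I * (conj x * v ^ 2)) := by
    push_cast; ring
  rw [hR, stereoVel_add, stereoVel_smul, stereoAcc, map_add, cross_stereoVel hε]
  congr 1
  apply vec_ext <;>
  · simp only [cross_apply_zero, cross_apply_one, cross_apply_two, stereo, stereoVel, stereoHeight,
      Matrix.cons_val, Complex.normSq_apply, Complex.mul_re, Complex.mul_im, Complex.I_re, sq,
      Complex.conj_re, Complex.conj_im,
      Complex.I_im, Pi.smul_apply, smul_eq_mul] at hN ⊢
    rw [sq] at hε
    rcases mul_self_eq_one_iff.1 hε with rfl | rfl <;>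
    · field_simp
      ring

/-- Solutions of the chart equation satisfy the profile equation. -/
theorem isProfileAt_stereo {ε : ℝ} (hε : ε ^ 2 = 1) (P : Param) (x v : ℂ) :
    IsProfileAt P (stereo ε x) (stereoVel ε x v) (stereoAcc ε x v (wallField ε P x v)) := by
  have hcur : crossProduct (stereo ε x) (current P (stereo ε x))
      = (-(P.β / (1 + P.c * (ε * stereoHeight x)))) • stereoVel ε x (ε * (Complex.I * x)) := by
    rw [current, map_smul, ← cross_anticomm, e3_cross_stereo hε, smul_neg, neg_smul]
    rfl
  have heff : crossProduct (stereo ε x) (effField P (stereo ε x)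
      (stereoAcc ε x v (wallField ε P x v)))
      = stereoVel ε x (Complex.I * (wallField ε P x v
          - 2 * conj x * v ^ 2 / (1 + Complex.normSq x : ℝ)))
        + (-(P.h - P.μ * (ε * stereoHeight x))) • stereoVel ε x (ε * (Complex.I * x)) := by
    have : effField P (stereo ε x) (stereoAcc ε x v (wallField ε P x v))
        = stereoAcc ε x v (wallField ε P x v) + (P.h - P.μ * (ε * stereoHeight x)) • e3 := by
      rw [effField, sub_smul, add_sub_assoc]; rfl
    rw [this, map_add, map_smul, cross_stereoAcc hε, ← cross_anticomm, e3_cross_stereo hε, smul_neg,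
      neg_smul]
  rw [IsProfileAt, hcur, heff, e3_cross_stereo hε]
  simp only [← stereoVel_smul, ← stereoVel_add, cross_stereoVel hε]
  have hneg : ∀ u, -stereoVel ε x u = stereoVel ε x (((-1 : ℝ) : ℂ) * u) := fun u => by
    rw [stereoVel_smul, neg_one_smul]
  rw [hneg, sub_eq_add_neg, hneg, ← stereoVel_add, ← stereoVel_add]
  -- Every term is an image under the tangent map, so it suffices to compare the complex arguments.
  congr 1
  simp only [wallField, coeffC, coeffB]
  push_cast
  linear_combination (-(P.s * v)) * Complex.I_mul_I

theorem localWavenumber_stereo {ε : ℝ} (hε : ε ^ 2 = 1) {m : ℝ → Vec} {ξ : ℝ} {x v : ℂ}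
    (hm : m ξ = stereo ε x) (h : HasDerivAt m (stereoVel ε x v) ξ) :
    localWavenumber m ξ = ε * (v / x).im := by
  rw [localWavenumber, h.deriv, hm]
  have hN := (one_add_normSq_pos x).ne'
  -- At the pole both sides are `0` by the convention for division by zero.
  by_cases hx : x = 0
  · subst hx
    simp [stereo, stereoVel]
  have h0 : Complex.normSq x ≠ 0 := by simpa using hx
  have h1 : 1 - stereo ε x 2 ^ 2 = 4 * Complex.normSq x / (1 + Complex.normSq x) ^ 2 := by
    simp only [stereo, stereoHeight, Matrix.cons_val]
    field_simp
    simp only [hε]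
    ring
  rw [h1, Complex.div_im]
  simp only [stereo, stereoVel, Matrix.cons_val]
  field_simp
  ring

theorem stereo_inv {x : ℂ} (hx : x ≠ 0) : stereo (-1) x⁻¹ = stereo 1 x := by
  have h0 : Complex.normSq x ≠ 0 := by simpa using hx
  have hN := (one_add_normSq_pos x).ne'
  have hN' : 1 + (Complex.normSq x)⁻¹ = (1 + Complex.normSq x) / Complex.normSq x := by
    field_simp; ring
  apply vec_ext
  · simp only [stereo, Matrix.cons_val, Complex.normSq_inv, Complex.inv_re, hN']
    field_simp
  · simp only [stereo, Matrix.cons_val, Complex.normSq_inv, Complex.inv_im, hN']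
    field_simp
  · simp [stereo, stereoHeight_inv hx]

theorem continuous_stereo (ε : ℝ) : Continuous (stereo ε) := by
  have hN : ∀ x, 1 + Complex.normSq x ≠ 0 := fun x => (one_add_normSq_pos x).ne'
  refine continuous_pi fun i => ?_
  have h := Complex.continuous_normSq
  fin_cases i
  · exact Continuous.div (by fun_prop) (by fun_prop) hN
  · exact Continuous.div (by fun_prop) (by fun_prop) hN
  · exact continuous_const.mul (Continuous.div (by fun_prop) (by fun_prop) hN)

theorem contDiffAt_stereo {E : Type*} [NormedAddCommGroup E] [NormedSpace ℝ E] {x₀ : E} (ε : ℝ)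
    {f : E → ℂ} (hf : ContDiffAt ℝ ω f x₀) : ContDiffAt ℝ ω (fun x => stereo ε (f x)) x₀ := by
  have hN := (one_add_normSq_pos (f x₀)).ne'
  have hn : ContDiffAt ℝ ω (fun x => Complex.normSq (f x)) x₀ := by
    simp only [Complex.normSq_apply]; fun_prop
  rw [contDiffAt_pi]
  intro i
  fin_cases i
  · exact ContDiffAt.div (by fun_prop) (by fun_prop) hN
  · exact ContDiffAt.div (by fun_prop) (by fun_prop) hN
  · exact contDiffAt_const.mul (ContDiffAt.div (by fun_prop) (by fun_prop) hN)

theorem cos_two_arctan (u : ℝ) : cos (2 * arctan u) = (1 - u ^ 2) / (1 + u ^ 2) := by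
  have h : (1 : ℝ) + u ^ 2 ≠ 0 := by positivity
  rw [cos_two_mul, cos_sq_arctan]
  field_simp
  ring

theorem sin_two_arctan (u : ℝ) : sin (2 * arctan u) = 2 * u / (1 + u ^ 2) := by
  have h : (0 : ℝ) < 1 + u ^ 2 := by positivity
  have h2 := Real.mul_self_sqrt h.le
  have h3 := (Real.sqrt_pos.2 h).ne'
  have h4 : 2 * (u / √(1 + u ^ 2)) * (1 / √(1 + u ^ 2)) = 2 * u / (√(1 + u ^ 2) * √(1 + u ^ 2)) := by
    field_simp
  rw [sin_two_mul, sin_arctan, cos_arctan, h4, h2]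

/-- The modulus of the coordinate is `tan (θ/2)` and its argument is the azimuth. -/
theorem stereo_one_polar (r φ : ℝ) :
    stereo 1 (r * Complex.exp (φ * Complex.I)) = spherical (2 * arctan r) φ := by
  have h : (1 : ℝ) + r ^ 2 ≠ 0 := by positivity
  have hn : Complex.normSq (r * Complex.exp (φ * Complex.I)) = r ^ 2 := by
    rw [Complex.normSq_eq_norm_sq, norm_mul, Complex.norm_exp_ofReal_mul_I, Complex.norm_real, mul_one,
      norm_eq_abs, sq_abs]
  have hre : ((r : ℂ) * Complex.exp (φ * Complex.I)).re = r * cos φ := by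
    rw [Complex.re_ofReal_mul, Complex.exp_ofReal_mul_I_re]
  have him : ((r : ℂ) * Complex.exp (φ * Complex.I)).im = r * sin φ := by
    rw [Complex.im_ofReal_mul, Complex.exp_ofReal_mul_I_im]
  apply vec_ext
  · simp only [stereo, spherical, Matrix.cons_val, hn, hre, sin_two_arctan]
    ring
  · simp only [stereo, spherical, Matrix.cons_val, hn, him, sin_two_arctan]
    ring
  · simp only [stereo, spherical, Matrix.cons_val, stereoHeight, hn, cos_two_arctan]
    ring

/-! ### Profiles from their stereographic coordinates -/

/-- The profile with the stereographic coordinates `ζ` left and `η` right of `T`. -/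
def wallProfile (T : ℝ) (ζ η : ℝ → ℂ) (ξ : ℝ) : Vec :=
  if ξ < T then stereo 1 (ζ ξ) else stereo (-1) (η ξ)

theorem wallProfile_eq_explicitWall {μ T : ℝ} {ζ η : ℝ → ℂ}
    (hζ : ∀ ξ, ζ ξ = Complex.exp (√(-μ) * ξ)) (hη : ∀ ξ, T - 1 < ξ → η ξ = Complex.exp (-(√(-μ) * ξ)))
    (ξ : ℝ) : wallProfile T ζ η ξ = explicitWall μ ξ := by
  have h : stereo 1 (Complex.exp (√(-μ) * ξ)) = explicitWall μ ξ := by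
    rw [explicitWall, ← stereo_one_polar]
    simp
  rw [wallProfile]
  split_ifs with h1
  · rw [hζ, h]
  · rw [hη ξ (by linarith), Complex.exp_neg, stereo_inv (Complex.exp_ne_zero _), h]

theorem wallProfile_sphere (T : ℝ) (ζ η : ℝ → ℂ) (ξ : ℝ) : wallProfile T ζ η ξ 0 ^ 2 + wallProfile T ζ η ξ 1 ^ 2
    + wallProfile T ζ η ξ 2 ^ 2 = 1 := by
  rw [wallProfile]
  split_ifs <;> exact stereo_sphere (by norm_num) _

namespace IsWallCurve

variable {P : Param} {T : ℝ} {ζ v η w : ℝ → ℂ} (hW : IsWallCurve P T ζ v η w)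
include hW

theorem profile_left {ξ : ℝ} (h : ξ < T + 1) : wallProfile T ζ η ξ = stereo 1 (ζ ξ) := by
  rw [wallProfile]
  split_ifs with h1
  · rfl
  · rw [hW.eq_inv ξ (by linarith) h, stereo_inv (hW.left_ne ξ h)]

theorem profile_right {ξ : ℝ} (h : T - 1 < ξ) : wallProfile T ζ η ξ = stereo (-1) (η ξ) := by
  rw [wallProfile]
  split_ifs with h1
  · rw [hW.eq_inv ξ h (by linarith), stereo_inv (hW.left_ne ξ (by linarith))]
  · rfl

theorem profile_left_eventuallyEq {ξ : ℝ} (h : ξ < T + 1) :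
    wallProfile T ζ η =ᶠ[𝓝 ξ] fun ξ => stereo 1 (ζ ξ) := by
  filter_upwards [gt_mem_nhds h] with y hy using hW.profile_left hy

theorem profile_right_eventuallyEq {ξ : ℝ} (h : T - 1 < ξ) :
    wallProfile T ζ η =ᶠ[𝓝 ξ] fun ξ => stereo (-1) (η ξ) := by
  filter_upwards [lt_mem_nhds h] with y hy using hW.profile_right hy

theorem hasDerivAt_profile_left {ξ : ℝ} (h : ξ < T + 1) :
    HasDerivAt (wallProfile T ζ η) (stereoVel 1 (ζ ξ) (v ξ)) ξ :=
  (hasDerivAt_stereo 1 (hW.left_deriv ξ h)).congr_of_eventuallyEq (hW.profile_left_eventuallyEq h)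

theorem hasDerivAt_profile_right {ξ : ℝ} (h : T - 1 < ξ) :
    HasDerivAt (wallProfile T ζ η) (stereoVel (-1) (η ξ) (w ξ)) ξ :=
  (hasDerivAt_stereo (-1) (hW.right_deriv ξ h)).congr_of_eventuallyEq
    (hW.profile_right_eventuallyEq h)

theorem localWavenumber_left {ξ : ℝ} (h : ξ < T + 1) :
    localWavenumber (wallProfile T ζ η) ξ = (v ξ / ζ ξ).im := by
  rw [localWavenumber_stereo (by norm_num) (hW.profile_left h) (hW.hasDerivAt_profile_left h), one_mul]

theorem localWavenumber_right {ξ : ℝ} (h : T - 1 < ξ) :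
    localWavenumber (wallProfile T ζ η) ξ = -(w ξ / η ξ).im := by
  rw [localWavenumber_stereo (by norm_num) (hW.profile_right h) (hW.hasDerivAt_profile_right h)]
  ring

theorem solvesLLGS : SolvesLLGS P (relEquilibrium P (wallProfile T ζ η)) := by
  set m := wallProfile T ζ η with hm
  have hl : ∀ ξ, ξ < T + 1 → deriv m ξ = stereoVel 1 (ζ ξ) (v ξ) := fun ξ h =>
    (hW.hasDerivAt_profile_left h).deriv
  have hr : ∀ ξ, T - 1 < ξ → deriv m ξ = stereoVel (-1) (η ξ) (w ξ) := fun ξ h =>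
    (hW.hasDerivAt_profile_right h).deriv
  have hl' : ∀ ξ, ξ < T + 1 →
      HasDerivAt (deriv m) (stereoAcc 1 (ζ ξ) (v ξ) (wallField 1 P (ζ ξ) (v ξ))) ξ := fun ξ h => by
    refine (hasDerivAt_stereoVel 1 (hW.left_deriv ξ h) (hW.left_deriv' ξ h)).congr_of_eventuallyEq ?_
    filter_upwards [gt_mem_nhds h] with y hy using hl y hy
  have hr' : ∀ ξ, T - 1 < ξ →
      HasDerivAt (deriv m) (stereoAcc (-1) (η ξ) (w ξ) (wallField (-1) P (η ξ) (w ξ))) ξ :=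
    fun ξ h => by
    refine (hasDerivAt_stereoVel (-1) (hW.right_deriv ξ h)
      (hW.right_deriv' ξ h)).congr_of_eventuallyEq ?_
    filter_upwards [lt_mem_nhds h] with y hy using hr y hy
  refine solvesLLGS_of_profile (m' := deriv m) (m'' := deriv (deriv m)) (fun ξ => ?_) (fun ξ => ?_)
    fun ξ => ?_
  · rcases lt_or_ge ξ T with h | h
    · exact (hW.hasDerivAt_profile_left (by linarith)).differentiableAt.hasDerivAt
    · exact (hW.hasDerivAt_profile_right (by linarith)).differentiableAt.hasDerivAt
  · rcases lt_or_ge ξ T with h | h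
    · exact (hl' ξ (by linarith)).differentiableAt.hasDerivAt
    · exact (hr' ξ (by linarith)).differentiableAt.hasDerivAt
  · rcases lt_or_ge ξ T with h | h
    · have h' : ξ < T + 1 := by linarith
      rw [hm, hW.profile_left h', ← hm, hl ξ h', (hl' ξ h').deriv]
      exact isProfileAt_stereo (by norm_num) P _ _
    · have h' : T - 1 < ξ := by linarith
      rw [hm, hW.profile_right h', ← hm, hr ξ h', (hr' ξ h').deriv]
      exact isProfileAt_stereo (by norm_num) P _ _

theorem isDomainWall (hζ : ∀ ξ, ξ < T + 1 → ContDiffAt ℝ ω ζ ξ)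
    (hη : ∀ ξ, T - 1 < ξ → ContDiffAt ℝ ω η ξ) (hl : Tendsto ζ atBot (𝓝 0))
    (hr : Tendsto η atTop (𝓝 0)) : IsDomainWall P (wallProfile T ζ η) where
  smooth := by
    rw [contDiff_iff_contDiffAt]
    intro ξ
    rcases lt_or_ge ξ T with h | h
    · exact ((contDiffAt_stereo 1 (hζ ξ (by linarith))).congr_of_eventuallyEq
        (hW.profile_left_eventuallyEq (by linarith))).of_le le_top
    · exact ((contDiffAt_stereo (-1) (hη ξ (by linarith))).congr_of_eventuallyEq
        (hW.profile_right_eventuallyEq (by linarith))).of_le le_top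
  sphere := wallProfile_sphere T ζ η
  solves := hW.solvesLLGS
  left := by
    have h0 : stereo 1 0 = e3 := by apply vec_ext <;> simp [stereo, stereoHeight, e3]
    rw [← h0]
    refine (((continuous_stereo 1).tendsto 0).comp hl).congr' ?_
    filter_upwards [eventually_lt_atBot (T + 1)] with ξ h using (hW.profile_left h).symm
  right := by
    have h0 : stereo (-1) 0 = -e3 := by apply vec_ext <;> simp [stereo, stereoHeight, e3]
    rw [← h0]
    refine (((continuous_stereo (-1)).tendsto 0).comp hr).congr' ?_
    filter_upwards [eventually_gt_atTop (T - 1)] with ξ h using (hW.profile_right h).symm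

end IsWallCurve

/-- The profiles depend smoothly on the parameters and the space variable. -/
theorem contDiffAt_wallProfile {T : ℝ} {ζ v η w : Param → ℝ → ℂ} {P : Param} {ξ : ℝ}
    (hW : ∀ᶠ P in 𝓝 P, IsWallCurve P T (ζ P) (v P) (η P) (w P))
    (hζ : ∀ ξ, ξ < T + 1 → ContDiffAt ℝ ω (Function.uncurry ζ) (P, ξ))
    (hη : ∀ ξ, T - 1 < ξ → ContDiffAt ℝ ω (Function.uncurry η) (P, ξ)) :
    ContDiffAt ℝ ω (Function.uncurry fun P => wallProfile T (ζ P) (η P)) (P, ξ) := by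
  have h0 := (continuousAt_fst : ContinuousAt (Prod.fst : Param × ℝ → Param) (P, ξ)).eventually hW
  rcases lt_or_ge ξ T with h | h
  · refine (contDiffAt_stereo 1 (hζ ξ (by linarith))).congr_of_eventuallyEq ?_
    have h1 : ∀ᶠ q : Param × ℝ in 𝓝 (P, ξ), q.2 < T + 1 :=
      continuousAt_snd.eventually (gt_mem_nhds (by linarith))
    filter_upwards [h0, h1] with q h2 h3 using h2.profile_left h3
  · refine (contDiffAt_stereo (-1) (hη ξ (by linarith))).congr_of_eventuallyEq ?_
    have h1 : ∀ᶠ q : Param × ℝ in 𝓝 (P, ξ), T - 1 < q.2 :=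
      continuousAt_snd.eventually (lt_mem_nhds (by linarith))
    filter_upwards [h0, h1] with q h2 h3 using h2.profile_right h3

/-! ### Profiles that avoid the poles -/

/-- The equation of `z = x' / x` for a solution of the chart equation. -/
theorem hasDerivAt_logDeriv {ε : ℝ} {P : Param} {x u : ℝ → ℂ} {ξ : ℝ} (hx : x ξ ≠ 0)
    (h1 : HasDerivAt x (u ξ) ξ) (h2 : HasDerivAt u (wallField ε P (x ξ) (u ξ)) ξ) :
    HasDerivAt (fun ξ => u ξ / x ξ) (coeffB P * (u ξ / x ξ) + ε * coeffC P (ε * stereoHeight (x ξ))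
      - stereoHeight (x ξ) * (u ξ / x ξ) ^ 2) ξ := by
  refine (h2.div h1 hx).congr_deriv ?_
  have hN : ((1 + Complex.normSq (x ξ) : ℝ) : ℂ) ≠ 0 := by
    exact_mod_cast (one_add_normSq_pos (x ξ)).ne'
  have hxx : conj (x ξ) * x ξ = ((Complex.normSq (x ξ) : ℝ) : ℂ) := conj_mul_self_eq _
  have hs : (stereoHeight (x ξ) : ℂ) = 1 - 2 * (conj (x ξ) * x ξ) / (1 + Complex.normSq (x ξ) : ℝ) := by
    rw [stereoHeight, hxx]; push_cast at hN ⊢; field_simp; ring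
  rw [wallField]
  generalize coeffC P (ε * stereoHeight (x ξ)) = K
  rw [hs]
  generalize ((1 + Complex.normSq (x ξ) : ℝ) : ℂ) = N at *
  field_simp
  ring

theorem eq_exp_of_hasDerivAt {x z Z : ℝ → ℂ} (hx : ∀ ξ, HasDerivAt x (z ξ * x ξ) ξ)
    (hZ : ∀ ξ, HasDerivAt Z (z ξ) ξ) (hZ0 : Z 0 = 0) (ξ : ℝ) : x ξ = x 0 * Complex.exp (Z ξ) := by
  have h : ∀ ξ, HasDerivAt (fun ξ => x ξ * Complex.exp (-Z ξ)) 0 ξ := fun ξ => by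
    refine ((hx ξ).mul (hZ ξ).neg.cexp).congr_deriv ?_
    simp only [Pi.neg_apply]
    ring
  have h1 := is_const_of_deriv_eq_zero (fun ξ => (h ξ).differentiableAt) (fun ξ => (h ξ).deriv) ξ 0
  simp only [hZ0, neg_zero, Complex.exp_zero, mul_one] at h1
  rw [← h1, mul_assoc, ← Complex.exp_add]
  simp

theorem coeffB_re (P : Param) : (coeffB P).re = -(P.α * P.s) := by simp [coeffB]

theorem coeffB_im (P : Param) : (coeffB P).im = -P.s := by simp [coeffB]

/-- `p + i q` is the logarithmic derivative of the coordinate; its equation is the Riccati form of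
the chart equation. -/
theorem isGivenBy_of_stereo {P : Param} {m : ℝ → Vec} {x u : ℝ → ℂ} (hx : ∀ ξ, x ξ ≠ 0)
    (h1 : ∀ ξ, HasDerivAt x (u ξ) ξ) (h2 : ∀ ξ, HasDerivAt u (wallField 1 P (x ξ) (u ξ)) ξ)
    (hm : ∀ ξ, m ξ = stereo 1 (x ξ)) :
    IsGivenBy P m (fun ξ => 2 * arctan ‖x ξ‖) (fun ξ => (u ξ / x ξ).re) (fun ξ => (u ξ / x ξ).im) := by
  have hz := fun ξ => hasDerivAt_logDeriv (hx ξ) (h1 ξ) (h2 ξ)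
  set z : ℝ → ℂ := fun ξ => u ξ / x ξ with hzdef
  have hzc : Continuous z := continuous_iff_continuousAt.2 fun ξ => (hz ξ).continuousAt
  -- A global logarithm obtained by integration; its imaginary part supplies a smooth azimuth on the
  -- whole line.
  set Z : ℝ → ℂ := fun ξ => ∫ t in (0 : ℝ)..ξ, z t with hZdef
  have hZ : ∀ ξ, HasDerivAt Z (z ξ) ξ := fun ξ => hzc.integral_hasStrictDerivAt 0 ξ |>.hasDerivAt
  have hexp := eq_exp_of_hasDerivAt (x := x) (fun ξ => by
    have := h1 ξ
    rwa [show u ξ = z ξ * x ξ from (div_mul_cancel₀ _ (hx ξ)).symm] at this) hZ (by simp [hZdef])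
  have hnorm : ∀ ξ, ‖x ξ‖ = ‖x 0‖ * exp (Z ξ).re := fun ξ => by
    rw [hexp ξ, norm_mul, Complex.norm_exp]
  have hpolar : ∀ ξ, x ξ = (‖x ξ‖ : ℝ) * Complex.exp (((x 0).arg + (Z ξ).im : ℝ) * Complex.I) := by
    intro ξ
    rw [hnorm]
    conv_lhs => rw [hexp ξ, ← Complex.norm_mul_exp_arg_mul_I (x 0), ← Complex.re_add_im (Z ξ)]
    push_cast
    rw [Complex.exp_add, add_mul, Complex.exp_add]
    ring
  have hcos : ∀ ξ, cos (2 * arctan ‖x ξ‖) = stereoHeight (x ξ) := fun ξ => by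
    rw [cos_two_arctan, stereoHeight, Complex.normSq_eq_norm_sq]
  refine ⟨⟨fun ξ => ?_, fun ξ => ?_, fun ξ => ?_⟩, fun ξ => ⟨?_, ?_⟩,
    fun ξ => (x 0).arg + (Z ξ).im, fun ξ => ?_, fun ξ => ?_⟩
  · have h3 : HasDerivAt (fun ξ => ‖x ξ‖) (‖x ξ‖ * (z ξ).re) ξ := by
      have h4 := ((hasDerivAt_re (hZ ξ)).exp.const_mul ‖x 0‖)
      rw [← mul_assoc, ← hnorm] at h4
      exact h4.congr_of_eventuallyEq (Eventually.of_forall hnorm)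
    refine (h3.arctan.const_mul 2).congr_deriv ?_
    rw [sin_two_arctan]
    ring
  · refine (hasDerivAt_re (hz ξ)).congr_deriv ?_
    rw [hcos]
    simp only [Complex.add_re, Complex.sub_re, Complex.mul_re, Complex.ofReal_re, Complex.ofReal_im,
      coeffB_re, coeffB_im, coeffC, sq, Complex.I_re, Complex.I_im, Complex.add_im, Complex.mul_im,
      Complex.ofReal_one, Complex.one_re, Complex.one_im]
    ring
  · refine (hasDerivAt_im (hz ξ)).congr_deriv ?_
    rw [hcos]
    simp only [Complex.add_re, Complex.sub_im, Complex.mul_re, Complex.ofReal_re, Complex.ofReal_im,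
      coeffB_re, coeffB_im, coeffC, sq, Complex.I_re, Complex.I_im, Complex.add_im, Complex.mul_im,
      Complex.ofReal_one, Complex.one_re, Complex.one_im]
    ring
  · have := arctan_pos.2 (norm_pos_iff.2 (hx ξ))
    simp only
    positivity
  · have := arctan_lt_pi_div_two ‖x ξ‖
    simp only
    linarith
  · exact (hasDerivAt_im (hZ ξ)).const_add _
  · rw [hm]
    conv_lhs => rw [hpolar ξ]
    exact stereo_one_polar _ _

/-- A wall that avoids `-e₃` is covered by the chart around `e₃` alone. -/
theorem IsWallCurve.exists_global {P : Param} {T : ℝ} {ζ v η w : ℝ → ℂ}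
    (hW : IsWallCurve P T ζ v η w) (hne : ∀ ξ, T - 1 < ξ → η ξ ≠ 0) :
    ∃ x u : ℝ → ℂ, (∀ ξ, x ξ ≠ 0) ∧ (∀ ξ, HasDerivAt x (u ξ) ξ) ∧
      (∀ ξ, HasDerivAt u (wallField 1 P (x ξ) (u ξ)) ξ) ∧
      (∀ ξ, wallProfile T ζ η ξ = stereo 1 (x ξ)) ∧
      (∀ ξ, ξ < T + 1 → x ξ = ζ ξ ∧ u ξ / x ξ = v ξ / ζ ξ) ∧
      ∀ ξ, T - 1 < ξ → x ξ = (η ξ)⁻¹ ∧ u ξ / x ξ = -(w ξ / η ξ) := by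
  set x : ℝ → ℂ := fun ξ => if ξ < T then ζ ξ else (η ξ)⁻¹ with hx
  have hl : ∀ ξ, ξ < T + 1 → x ξ = ζ ξ := fun ξ h => by
    simp only [hx]
    split_ifs with h1
    · rfl
    · rw [hW.eq_inv ξ (by linarith) h, inv_inv]
  have hr : ∀ ξ, T - 1 < ξ → x ξ = (η ξ)⁻¹ := fun ξ h => by
    simp only [hx]
    split_ifs with h1
    · rw [hW.eq_inv ξ h (by linarith), inv_inv]
    · rfl
  have hdl : ∀ ξ, ξ < T + 1 → HasDerivAt x (v ξ) ξ := fun ξ h =>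
    (hW.left_deriv ξ h).congr_of_eventuallyEq
      (by filter_upwards [gt_mem_nhds h] with y hy using hl y hy)
  have hinv := fun ξ (h : T - 1 < ξ) =>
    hasDerivAt_inv_chart (-1) (hW.right_deriv ξ h) (hW.right_deriv' ξ h) (hne ξ h)
  have hdr : ∀ ξ, T - 1 < ξ → HasDerivAt x (-w ξ / η ξ ^ 2) ξ := fun ξ h =>
    (hinv ξ h).1.congr_of_eventuallyEq (by filter_upwards [lt_mem_nhds h] with y hy using hr y hy)
  have hul := fun ξ h => (hdl ξ h).deriv
  have hur := fun ξ h => (hdr ξ h).deriv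
  have hx0 : ∀ ξ, x ξ ≠ 0 := fun ξ => by
    rcases lt_or_ge ξ T with h | h
    · rw [hl ξ (by linarith)]; exact hW.left_ne ξ (by linarith)
    · rw [hr ξ (by linarith)]; exact inv_ne_zero (hne ξ (by linarith))
  refine ⟨x, deriv x, hx0, fun ξ => ?_, fun ξ => ?_, fun ξ => ?_, fun ξ h => ⟨hl ξ h, ?_⟩,
    fun ξ h => ⟨hr ξ h, ?_⟩⟩
  · rcases lt_or_ge ξ T with h | h
    · exact (hdl ξ (by linarith)).differentiableAt.hasDerivAt
    · exact (hdr ξ (by linarith)).differentiableAt.hasDerivAt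
  · rcases lt_or_ge ξ T with h | h
    · have h' : ξ < T + 1 := by linarith
      rw [hl ξ h', hul ξ h']
      exact (hW.left_deriv' ξ h').congr_of_eventuallyEq
        (by filter_upwards [gt_mem_nhds h'] with y hy using hul y hy)
    · have h' : T - 1 < ξ := by linarith
      rw [hr ξ h', hur ξ h']
      have := (hinv ξ h').2
      rw [neg_neg] at this
      exact this.congr_of_eventuallyEq
        (by filter_upwards [lt_mem_nhds h'] with y hy using hur y hy)
  · rcases lt_or_ge ξ T with h | h
    · rw [hW.profile_left (by linarith), hl ξ (by linarith)]
    · rw [hW.profile_right (by linarith), hr ξ (by linarith), ← stereo_inv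
        (inv_ne_zero (hne ξ (by linarith))), inv_inv]
  · rw [hul ξ h, hl ξ h]
  · have := hne ξ h
    rw [hur ξ h, hr ξ h]
    field_simp

/-! ### The eigenvalues at the right pole -/

theorem eigOne_add_eigTwo (P : Param) : eigOne P + eigTwo P = coeffB P := by
  rw [eigOne, eigTwo]; ring

theorem eigOne_mul_eigTwo (P : Param) : eigOne P * eigTwo P = coeffCpi P := by
  linear_combination (-1) * eigOne_sq P + eigOne P * eigOne_add_eigTwo P

/-- Half the imaginary part of the discriminant `(l₁ - l₂)² = B² - 4 C^π`. This is where the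
threshold frequency enters: the decay rates coincide there as long as the imaginary parts differ. -/
theorem eig_re_mul_im {P : Param} (hα : P.α ≠ 0) :
    (eigOne P - eigTwo P).re * (eigOne P - eigTwo P).im = -2 * P.α * (P.Ω - centerFrequency P) := by
  have h : (eigOne P - eigTwo P) ^ 2 = coeffB P ^ 2 - 4 * coeffCpi P := by
    rw [← eigOne_add_eigTwo, ← eigOne_mul_eigTwo]; ring
  have h1 := congrArg Complex.im h
  rw [sq, Complex.mul_im] at h1
  have h2 : (coeffB P ^ 2 - 4 * coeffCpi P).im = 2 * P.α * P.s ^ 2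
      - 4 * (P.α * P.Ω - P.β / (1 - P.c)) := by
    have h3 : (coeffCpi P).im = P.α * P.Ω - P.β / (1 - P.c) := by
      simp only [coeffCpi, Complex.add_im, Complex.ofReal_im, Complex.mul_im, Complex.I_re,
        Complex.I_im, Complex.ofReal_re]
      ring
    have h4 : (4 * coeffCpi P).im = 4 * (coeffCpi P).im := by
      simp [Complex.mul_im]
    rw [sq, Complex.sub_im, Complex.mul_im, coeffB_re, coeffB_im, h4, h3]
    ring
  rw [h2] at h1
  rw [centerFrequency, mul_sub, mul_add, show -2 * P.α * (P.β / (1 - P.c) / P.α)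
    = -2 * (P.β / (1 - P.c)) by field_simp]
  linarith

namespace RightAdmissible

variable {σ : ℝ} {P : Param} (h : RightAdmissible σ P) (hν : 0 < rightRate σ)

theorem relExponent_re (σ : ℝ) (l : ℂ) : (relExponent σ l).re = -1 - l.re / rightRate σ := by
  rw [relExponent, Complex.sub_re, Complex.div_ofReal_re]; simp

include h hν

theorem eigOne_re : -(2 * rightRate σ) < (eigOne P).re ∧ (eigOne P).re < -rightRate σ := by
  have h1 := h.one_pos
  have h2 := h.one_lt
  rw [relExponent_re] at h1 h2
  have h3 : (eigOne P).re / rightRate σ < -1 := by linarith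
  have h4 : -2 < (eigOne P).re / rightRate σ := by linarith
  rw [div_lt_iff₀ hν] at h3
  rw [lt_div_iff₀ hν] at h4
  constructor <;> linarith

theorem eigTwo_re : -(2 * rightRate σ) < (eigTwo P).re ∧ (eigTwo P).re < -rightRate σ := by
  have h1 := h.two_pos
  have h2 := h.two_lt
  rw [relExponent_re] at h1 h2
  have h3 : (eigTwo P).re / rightRate σ < -1 := by linarith
  have h4 : -2 < (eigTwo P).re / rightRate σ := by linarith
  rw [div_lt_iff₀ hν] at h3
  rw [lt_div_iff₀ hν] at h4
  constructor <;> linarith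

end RightAdmissible

/-! ### Sums of two modes -/

theorem tendsto_cexp_mul_atTop {l : ℂ} (hl : l.re < 0) :
    Tendsto (fun t : ℝ => Complex.exp (l * t)) atTop (𝓝 0) := by
  rw [tendsto_zero_iff_norm_tendsto_zero]
  simp only [Complex.norm_exp, Complex.re_mul_ofReal]
  exact Real.tendsto_exp_atBot.comp (tendsto_id.const_mul_atTop_of_neg hl)

/-- The quotient of derivative and value of a sum of two modes, the first one dominant. -/
theorem tendsto_modes {X₁ X₂ : ℝ → ℂ} {l₁ l₂ : ℂ} (h1 : ∀ᶠ t in atTop, X₁ t ≠ 0)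
    (h2 : Tendsto (fun t => X₂ t / X₁ t) atTop (𝓝 0)) :
    Tendsto (fun t => (l₁ * X₁ t + l₂ * X₂ t) / (X₁ t + X₂ t)) atTop (𝓝 l₁) := by
  have h3 : Tendsto (fun t => (l₁ + l₂ * (X₂ t / X₁ t)) / (1 + X₂ t / X₁ t)) atTop
      (𝓝 ((l₁ + l₂ * 0) / (1 + 0))) :=
    (tendsto_const_nhds.add (h2.const_mul l₂)).div (tendsto_const_nhds.add h2) (by simp)
  rw [mul_zero, add_zero, add_zero, div_one] at h3
  refine h3.congr' ?_
  filter_upwards [h1] with t ht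
  rw [← mul_div_mul_left _ _ ht]
  congr 1 <;> field_simp

/-- Amplitudes of two modes that converge exponentially, the first one close to `e`, the second one
small. -/
structure IsAmplitudes (ν e : ℝ) (a₁ a₂ : ℂ) (U₁ U₂ : ℝ → ℂ) (C : ℝ) : Prop where
  rate_pos : 0 < ν
  e_pos : 0 < e
  one_sub : ∀ t, 0 ≤ t → ‖U₁ t - a₁‖ ≤ C * exp (-ν * t)
  two_sub : ∀ t, 0 ≤ t → ‖U₂ t - a₂‖ ≤ C * exp (-ν * t)
  one_near : ∀ t, 0 ≤ t → ‖U₁ t - e‖ ≤ e / 4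
  two_small : ∀ t, 0 ≤ t → ‖U₂ t‖ ≤ e / 4

namespace IsAmplitudes

variable {ν e C : ℝ} {a₁ a₂ : ℂ} {U₁ U₂ : ℝ → ℂ} (h : IsAmplitudes ν e a₁ a₂ U₁ U₂ C)
include h

theorem tendsto_rate : Tendsto (fun t : ℝ => C * exp (-ν * t)) atTop (𝓝 0) := by
  have h1 : Tendsto (fun t : ℝ => exp (-ν * t)) atTop (𝓝 0) :=
    Real.tendsto_exp_atBot.comp (tendsto_id.const_mul_atTop_of_neg (neg_neg_iff_pos.2 h.rate_pos))
  simpa using h1.const_mul C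

theorem tendsto_one : Tendsto U₁ atTop (𝓝 a₁) := by
  rw [tendsto_iff_norm_sub_tendsto_zero]
  refine squeeze_zero' (Eventually.of_forall fun _ => norm_nonneg _) ?_ h.tendsto_rate
  filter_upwards [eventually_ge_atTop 0] with t ht using h.one_sub t ht

theorem tendsto_two : Tendsto U₂ atTop (𝓝 a₂) := by
  rw [tendsto_iff_norm_sub_tendsto_zero]
  refine squeeze_zero' (Eventually.of_forall fun _ => norm_nonneg _) ?_ h.tendsto_rate
  filter_upwards [eventually_ge_atTop 0] with t ht using h.two_sub t ht

theorem le_norm_one {t : ℝ} (ht : 0 ≤ t) : 3 * e / 4 ≤ ‖U₁ t‖ := by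
  have h1 := h.one_near t ht
  have h2 : ‖(e : ℂ)‖ = e := by rw [Complex.norm_real, norm_eq_abs, abs_of_pos h.e_pos]
  have h3 := norm_sub_norm_le (e : ℂ) (U₁ t)
  rw [norm_sub_rev, h2] at h3
  linarith

theorem le_norm_limit_one : 3 * e / 4 ≤ ‖a₁‖ :=
  ge_of_tendsto h.tendsto_one.norm
    (by filter_upwards [eventually_ge_atTop 0] with t ht using h.le_norm_one ht)

theorem norm_limit_two_le : ‖a₂‖ ≤ e / 4 :=
  le_of_tendsto h.tendsto_two.norm
    (by filter_upwards [eventually_ge_atTop 0] with t ht using h.two_small t ht)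

theorem limit_one_ne : a₁ ≠ 0 := by
  rw [← norm_pos_iff]
  linarith [h.le_norm_limit_one, h.e_pos]

theorem tendsto_modes_of_re_lt {l₁ l₂ : ℂ} (hl : l₂.re < l₁.re) :
    Tendsto (fun t : ℝ => (l₁ * (Complex.exp (l₁ * t) * U₁ t) + l₂ * (Complex.exp (l₂ * t) * U₂ t))
      / (Complex.exp (l₁ * t) * U₁ t + Complex.exp (l₂ * t) * U₂ t)) atTop (𝓝 l₁) := by
  refine tendsto_modes ?_ ?_
  · filter_upwards [eventually_ge_atTop 0] with t ht
    have := h.le_norm_one ht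
    have h2 : U₁ t ≠ 0 := by rw [← norm_pos_iff]; linarith [h.e_pos]
    exact mul_ne_zero (Complex.exp_ne_zero _) h2
  · have h1 := (tendsto_cexp_mul_atTop (l := l₂ - l₁) (by simpa using hl)).mul
      (h.tendsto_two.div h.tendsto_one h.limit_one_ne)
    rw [zero_mul] at h1
    refine h1.congr fun t => ?_
    rw [sub_mul, Complex.exp_sub, Pi.div_apply, div_mul_div_comm]

theorem tendsto_modes_of_re_gt {l₁ l₂ : ℂ} (hl : l₁.re < l₂.re) (ha : a₂ ≠ 0) :
    Tendsto (fun t : ℝ => (l₁ * (Complex.exp (l₁ * t) * U₁ t) + l₂ * (Complex.exp (l₂ * t) * U₂ t))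
      / (Complex.exp (l₁ * t) * U₁ t + Complex.exp (l₂ * t) * U₂ t)) atTop (𝓝 l₂) := by
  have key : Tendsto (fun t : ℝ => (l₂ * (Complex.exp (l₂ * t) * U₂ t) +
      l₁ * (Complex.exp (l₁ * t) * U₁ t))
      / (Complex.exp (l₂ * t) * U₂ t + Complex.exp (l₁ * t) * U₁ t)) atTop (𝓝 l₂) := by
    refine tendsto_modes ?_ ?_
    · filter_upwards [h.tendsto_two.eventually_ne ha] with t ht
      exact mul_ne_zero (Complex.exp_ne_zero _) ht
    · have h1 := (tendsto_cexp_mul_atTop (l := l₁ - l₂) (by simpa using hl)).mul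
        (h.tendsto_one.div h.tendsto_two ha)
      rw [zero_mul] at h1
      refine h1.congr fun t => ?_
      rw [sub_mul, Complex.exp_sub, Pi.div_apply, div_mul_div_comm]
  refine key.congr fun t => ?_
  rw [add_comm (l₂ * _), add_comm (Complex.exp (l₂ * t) * U₂ t)]

/-- The second mode decays more slowly by at most a rate below `ν`, but its amplitude is `O(exp (-ν
t))`, so the first mode still dominates. -/
theorem tendsto_modes_of_limit_eq_zero {l₁ l₂ : ℂ} (hl : l₂.re - l₁.re < ν) (ha : a₂ = 0) :
    Tendsto (fun t : ℝ => (l₁ * (Complex.exp (l₁ * t) * U₁ t) + l₂ * (Complex.exp (l₂ * t) * U₂ t))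
      / (Complex.exp (l₁ * t) * U₁ t + Complex.exp (l₂ * t) * U₂ t)) atTop (𝓝 l₁) := by
  refine tendsto_modes ?_ ?_
  · filter_upwards [eventually_ge_atTop 0] with t ht
    have := h.le_norm_one ht
    have h2 : U₁ t ≠ 0 := by rw [← norm_pos_iff]; linarith [h.e_pos]
    exact mul_ne_zero (Complex.exp_ne_zero _) h2
  · have h1 : Tendsto (fun t : ℝ => Complex.exp ((l₂ - l₁) * t) * U₂ t) atTop (𝓝 0) := by
      have h2 : Tendsto (fun t : ℝ => C * exp ((l₂.re - l₁.re - ν) * t)) atTop (𝓝 0) := by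
        have h3 : Tendsto (fun t : ℝ => exp ((l₂.re - l₁.re - ν) * t)) atTop (𝓝 0) :=
          Real.tendsto_exp_atBot.comp (tendsto_id.const_mul_atTop_of_neg (by linarith))
        simpa using h3.const_mul C
      refine squeeze_zero_norm' ?_ h2
      filter_upwards [eventually_ge_atTop 0] with t ht
      have h4 := h.two_sub t ht
      rw [ha, sub_zero] at h4
      rw [norm_mul, Complex.norm_exp, Complex.re_mul_ofReal, Complex.sub_re]
      calc _ ≤ exp ((l₂.re - l₁.re) * t) * (C * exp (-ν * t)) := by gcongr
        _ = C * (exp ((l₂.re - l₁.re) * t) * exp (-ν * t)) := by ring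
        _ = _ := by rw [← Real.exp_add]; ring_nf
    have h2 := h1.mul (h.tendsto_one.inv₀ h.limit_one_ne)
    rw [zero_mul] at h2
    refine h2.congr fun t => ?_
    rw [sub_mul, Complex.exp_sub, mul_div_mul_comm, div_eq_mul_inv (U₂ t), mul_assoc]

/-- Modes with different decay rates have a limiting wavenumber. -/
theorem exists_tendsto_modes {l₁ l₂ : ℂ} (hl : l₁.re ≠ l₂.re) (hν : l₂.re - l₁.re < ν) :
    ∃ l, Tendsto (fun t : ℝ =>
      (l₁ * (Complex.exp (l₁ * t) * U₁ t) + l₂ * (Complex.exp (l₂ * t) * U₂ t))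
      / (Complex.exp (l₁ * t) * U₁ t + Complex.exp (l₂ * t) * U₂ t)) atTop (𝓝 l) := by
  rcases hl.lt_or_gt with h1 | h1
  · by_cases ha : a₂ = 0
    · exact ⟨_, h.tendsto_modes_of_limit_eq_zero hν ha⟩
    · exact ⟨_, h.tendsto_modes_of_re_gt h1 ha⟩
  · exact ⟨_, h.tendsto_modes_of_re_lt h1⟩

theorem tendsto_sum {l₁ l₂ : ℂ} (h1 : l₁.re < 0) (h2 : l₂.re < 0) :
    Tendsto (fun t : ℝ => Complex.exp (l₁ * t) * U₁ t + Complex.exp (l₂ * t) * U₂ t) atTop (𝓝 0) := by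
  simpa using ((tendsto_cexp_mul_atTop h1).mul h.tendsto_one).add
    ((tendsto_cexp_mul_atTop h2).mul h.tendsto_two)

/-- The first amplitude has modulus at least `3e/4`, the second at most `e/4`. -/
theorem sum_ne_zero {x : ℂ} (hx : ‖x‖ = 1) {t : ℝ} (ht : 0 ≤ t) : U₁ t + x * U₂ t ≠ 0 := by
  intro h0
  have h1 : U₁ t = -(x * U₂ t) := eq_neg_of_add_eq_zero_left h0
  have h2 := h.le_norm_one ht
  rw [h1, norm_neg, norm_mul, hx, one_mul] at h2
  linarith [h.two_small t ht, h.e_pos]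

end IsAmplitudes

/-! ### Modes with the same decay rate -/

/-- The logarithmic derivative of the sum of the modes `a₁ exp (l₁ t)` and `a₂ exp (l₂ t)`. -/
def modeQuotient (l₁ l₂ a₁ a₂ : ℂ) (t : ℝ) : ℂ :=
  (l₁ * a₁ + l₂ * (Complex.exp ((l₂ - l₁) * t) * a₂)) / (a₁ + Complex.exp ((l₂ - l₁) * t) * a₂)

section

variable {l₁ l₂ a₁ a₂ : ℂ}

theorem norm_cexp_mul_of_re_eq (hl : l₁.re = l₂.re) (t : ℝ) : ‖Complex.exp ((l₂ - l₁) * t)‖ = 1 := by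
  rw [Complex.norm_exp, Complex.re_mul_ofReal, Complex.sub_re, hl, sub_self, zero_mul, Real.exp_zero]

theorem modeQuotient_zero (h : a₁ ≠ 0) (t : ℝ) : modeQuotient l₁ l₂ a₁ 0 t = l₁ := by
  rw [modeQuotient]; simp [h]

theorem modes_denominator_ne (hl : l₁.re = l₂.re) (h : ‖a₂‖ < ‖a₁‖) (t : ℝ) :
    a₁ + Complex.exp ((l₂ - l₁) * t) * a₂ ≠ 0 := by
  intro h0
  rw [eq_neg_of_add_eq_zero_left h0, norm_neg, norm_mul, norm_cexp_mul_of_re_eq hl, one_mul] at h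
  exact lt_irrefl _ h

/-- The Riccati equation. -/
theorem hasDerivAt_modeQuotient (hl : l₁.re = l₂.re) (h : ‖a₂‖ < ‖a₁‖) (t : ℝ) :
    HasDerivAt (modeQuotient l₁ l₂ a₁ a₂) ((l₁ + l₂) * modeQuotient l₁ l₂ a₁ a₂ t - l₁ * l₂
      - modeQuotient l₁ l₂ a₁ a₂ t ^ 2) t := by
  have h0 := modes_denominator_ne hl h t
  have h1 : HasDerivAt (fun t : ℝ => Complex.exp ((l₂ - l₁) * t) * a₂)
      (Complex.exp ((l₂ - l₁) * t) * (l₂ - l₁) * a₂) t := by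
    have : HasDerivAt (fun t : ℝ => (l₂ - l₁) * (t : ℂ)) (l₂ - l₁) t := by
      simpa using (Complex.ofRealCLM.hasDerivAt (x := t)).const_mul (l₂ - l₁)
    exact this.cexp.mul_const a₂
  refine (((h1.const_mul l₂).const_add (l₁ * a₁)).div (h1.const_add a₁) h0).congr_deriv ?_
  rw [modeQuotient]
  generalize Complex.exp ((l₂ - l₁) * t) = X at *
  field_simp
  ring

theorem periodic_modeQuotient (hl : l₁.re = l₂.re) (hne : l₁ ≠ l₂) :
    ∃ T : ℝ, 0 < T ∧ Function.Periodic (modeQuotient l₁ l₂ a₁ a₂) T := by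
  have hγ : (l₂ - l₁) = ((l₂ - l₁).im : ℂ) * Complex.I := by
    apply Complex.ext <;> simp [hl]
  have hγ0 : (l₂ - l₁).im ≠ 0 := fun h => by
    rw [h, Complex.ofReal_zero, zero_mul, sub_eq_zero] at hγ
    exact hne hγ.symm
  have hper : ∀ n : ℤ, Function.Periodic (modeQuotient l₁ l₂ a₁ a₂) (n * (2 * π) / (l₂ - l₁).im) := by
    intro n t
    have h1 : Complex.exp ((l₂ - l₁) * ((t + n * (2 * π) / (l₂ - l₁).im : ℝ) : ℂ))
        = Complex.exp ((l₂ - l₁) * t) := by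
      rw [Complex.exp_eq_exp_iff_exists_int]
      refine ⟨n, ?_⟩
      have h2 : ((l₂ - l₁).im : ℂ) ≠ 0 := by exact_mod_cast hγ0
      rw [hγ]
      push_cast
      simp only [Complex.mul_I_im, Complex.ofReal_re]
      field_simp
    rw [modeQuotient, modeQuotient, h1]
  -- The sign of the frequency difference decides which multiple of `2π` gives a positive period.
  rcases hγ0.lt_or_gt with h | h
  · exact ⟨_, div_pos_of_neg_of_neg (by simp [pi_pos]) h, hper (-1)⟩
  · exact ⟨_, div_pos (by simp [pi_pos]) h, hper 1⟩

/-- Along a period, the absolute value of the imaginary part of the quotient is not constant. -/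
theorem abs_im_modeQuotient_ne (hl : l₁.re = l₂.re) (hne : l₁ ≠ l₂) (h : ‖a₂‖ < ‖a₁‖) (ha : a₂ ≠ 0) :
    ∃ s t : ℝ, |(modeQuotient l₁ l₂ a₁ a₂ s).im| ≠ |(modeQuotient l₁ l₂ a₁ a₂ t).im| := by
  set γ := (l₂ - l₁).im with hγdef
  have hγ : (l₂ - l₁) = (γ : ℂ) * Complex.I := by
    apply Complex.ext <;> simp [hl, hγdef]
  have hγ0 : γ ≠ 0 := fun h => by
    rw [h, Complex.ofReal_zero, zero_mul, sub_eq_zero] at hγ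
    exact hne hγ.symm
  have ha1 : a₁ ≠ 0 := by rw [← norm_pos_iff]; exact (norm_nonneg _).trans_lt h
  set k := a₂ / a₁ with hk
  set ρ := ‖k‖ with hρ
  have hρ0 : 0 < ρ := norm_pos_iff.2 (div_ne_zero ha ha1)
  have hρ1 : ρ < 1 := by rw [hρ, hk, norm_div, div_lt_one (norm_pos_iff.2 ha1)]; exact h
  -- the value of the quotient at the phase `ψ`
  have hval : ∀ ψ : ℝ, modeQuotient l₁ l₂ a₁ a₂ ((ψ - k.arg) / γ) = l₁ + γ * Complex.I
      * (ρ * Complex.exp (ψ * Complex.I) / (1 + ρ * Complex.exp (ψ * Complex.I))) := by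
    intro ψ
    have h0 := modes_denominator_ne hl h ((ψ - k.arg) / γ)
    rw [modeQuotient]
    have h1 : Complex.exp ((l₂ - l₁) * ((ψ - k.arg) / γ : ℝ)) * a₂
        = a₁ * (ρ * Complex.exp (ψ * Complex.I)) := by
      have h2 : (γ : ℂ) ≠ 0 := by exact_mod_cast hγ0
      have h3 : (l₂ - l₁) * (((ψ - k.arg) / γ : ℝ) : ℂ) = ψ * Complex.I + -(k.arg * Complex.I) := by
        rw [hγ]; push_cast; field_simp; ring
      have h4 : a₂ = a₁ * (ρ * Complex.exp (k.arg * Complex.I)) := by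
        rw [hρ, Complex.norm_mul_exp_arg_mul_I, hk, mul_div_cancel₀ _ ha1]
      rw [h3, Complex.exp_add]
      conv_lhs => rw [h4]
      have h5 : Complex.exp (-(k.arg * Complex.I)) * Complex.exp (k.arg * Complex.I) = 1 := by
        rw [← Complex.exp_add]; simp
      linear_combination (Complex.exp (ψ * Complex.I) * a₁ * ρ) * h5
    rw [h1] at h0 ⊢
    rw [show l₂ = l₁ + γ * Complex.I by rw [← hγ]; ring]
    have h2 : 1 + ρ * Complex.exp (ψ * Complex.I) ≠ 0 := fun h2 => h0 (by
      linear_combination a₁ * h2)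
    generalize (ρ : ℂ) * Complex.exp (ψ * Complex.I) = X at *
    field_simp
    ring
  have hv : ∀ ψ : ℝ, ∀ z : ℂ, Complex.exp (ψ * Complex.I) = z →
      (modeQuotient l₁ l₂ a₁ a₂ ((ψ - k.arg) / γ)).im = l₁.im + γ * (ρ * z / (1 + ρ * z)).re := by
    intro ψ z hz
    rw [hval, hz, Complex.add_im, mul_assoc, Complex.im_ofReal_mul, Complex.I_mul_im]
  -- Three phases are needed: an absolute value can identify two distinct values that are opposite,
  -- but not three distinct ones.
  have e1 := hv 0 1 (by simp)
  have e2 := hv π (-1) (by rw [Complex.exp_pi_mul_I])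
  have e3 := hv (π / 2) Complex.I (by push_cast; rw [Complex.exp_pi_div_two_mul_I])
  have r1 : ((ρ : ℂ) * 1 / (1 + ρ * 1)).re = ρ / (1 + ρ) := by
    rw [mul_one]; norm_cast
  have r2 : ((ρ : ℂ) * (-1) / (1 + ρ * (-1))).re = -ρ / (1 - ρ) := by
    rw [mul_neg_one, ← sub_eq_add_neg]; norm_cast
  have r3 : ((ρ : ℂ) * Complex.I / (1 + ρ * Complex.I)).re = ρ ^ 2 / (1 + ρ ^ 2) := by
    rw [Complex.div_re]
    simp [Complex.normSq_apply]
    ring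
  rw [r1] at e1
  rw [r2] at e2
  rw [r3] at e3
  have n12 : ρ / (1 + ρ) ≠ -ρ / (1 - ρ) := by
    have : 0 < ρ / (1 + ρ) := by positivity
    have h3 : -ρ / (1 - ρ) < 0 := div_neg_of_neg_of_pos (by linarith) (by linarith)
    exact (h3.trans this).ne'
  have n13 : ρ / (1 + ρ) ≠ ρ ^ 2 / (1 + ρ ^ 2) := by
    rw [Ne, div_eq_div_iff (by positivity) (by positivity)]
    intro h3
    nlinarith
  have n23 : -ρ / (1 - ρ) ≠ ρ ^ 2 / (1 + ρ ^ 2) := by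
    have : 0 < ρ ^ 2 / (1 + ρ ^ 2) := by positivity
    have h3 : -ρ / (1 - ρ) < 0 := div_neg_of_neg_of_pos (by linarith) (by linarith)
    exact (h3.trans this).ne
  by_contra! hcon
  have c1 := hcon ((0 - k.arg) / γ) ((π - k.arg) / γ)
  have c2 := hcon ((0 - k.arg) / γ) ((π / 2 - k.arg) / γ)
  have c3 := hcon ((π - k.arg) / γ) ((π / 2 - k.arg) / γ)
  rw [e1, e2, abs_eq_abs] at c1
  rw [e1, e3, abs_eq_abs] at c2
  rw [e2, e3, abs_eq_abs] at c3
  have inj : ∀ {u v : ℝ}, l₁.im + γ * u = l₁.im + γ * v → u = v := fun h => by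
    exact mul_left_cancel₀ hγ0 (add_left_cancel h)
  have c1' := c1.resolve_left fun h => n12 (inj h)
  have c2' := c2.resolve_left fun h => n13 (inj h)
  exact c3.elim (fun h => n23 (inj h)) fun h => n23 (inj (by linarith))

theorem modeQuotient_nonconstant (hl : l₁.re = l₂.re) (hne : l₁ ≠ l₂) (h : ‖a₂‖ < ‖a₁‖)
    (ha : a₂ ≠ 0) : ∃ s t : ℝ, modeQuotient l₁ l₂ a₁ a₂ s ≠ modeQuotient l₁ l₂ a₁ a₂ t := by
  obtain ⟨s, t, hst⟩ := abs_im_modeQuotient_ne hl hne h ha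
  exact ⟨s, t, fun h => hst (by rw [h])⟩

end

/-- After cancelling `exp (l₁ t)` the difference of the two quotients is proportional to `U₁ a₂ - a₁
U₂ → 0`, over denominators of modulus at least `e/2` each. -/
theorem IsAmplitudes.tendsto_modes_sub {ν e C : ℝ} {a₁ a₂ : ℂ} {U₁ U₂ : ℝ → ℂ}
    (h : IsAmplitudes ν e a₁ a₂ U₁ U₂ C) {l₁ l₂ : ℂ} (hl : l₁.re = l₂.re) :
    Tendsto (fun t : ℝ =>
      (l₁ * (Complex.exp (l₁ * t) * U₁ t) + l₂ * (Complex.exp (l₂ * t) * U₂ t))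
      / (Complex.exp (l₁ * t) * U₁ t + Complex.exp (l₂ * t) * U₂ t)
      - modeQuotient l₁ l₂ a₁ a₂ t) atTop (𝓝 0) := by
  have he := h.e_pos
  have ha : ‖a₂‖ < ‖a₁‖ := by linarith [h.le_norm_limit_one, h.norm_limit_two_le]
  have h1 : Tendsto (fun t => ‖l₁ - l₂‖ * ‖U₁ t * a₂ - a₁ * U₂ t‖ / (e / 2 * (e / 2))) atTop
      (𝓝 (‖l₁ - l₂‖ * ‖a₁ * a₂ - a₁ * a₂‖ / (e / 2 * (e / 2)))) :=
    (((h.tendsto_one.mul_const a₂).sub (h.tendsto_two.const_mul a₁)).norm.const_mul _).div_const _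
  rw [sub_self, norm_zero, mul_zero, zero_div] at h1
  refine squeeze_zero_norm' ?_ h1
  filter_upwards [eventually_ge_atTop 0] with t ht
  have hX := norm_cexp_mul_of_re_eq hl t
  have hE : Complex.exp (l₂ * t) = Complex.exp (l₁ * t) * Complex.exp ((l₂ - l₁) * t) := by
    rw [← Complex.exp_add]; ring_nf
  have hE0 := Complex.exp_ne_zero (l₁ * t)
  have hD := h.sum_ne_zero hX ht
  have hD' := modes_denominator_ne hl ha t
  have low : ∀ b c : ℂ, 3 * e / 4 ≤ ‖b‖ → ‖c‖ ≤ e / 4 →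
      e / 2 ≤ ‖b + Complex.exp ((l₂ - l₁) * t) * c‖ := fun b c hb hc => by
    have := norm_sub_le_norm_add b (Complex.exp ((l₂ - l₁) * t) * c)
    rw [norm_mul, hX, one_mul] at this
    linarith
  have b1 := low _ _ (h.le_norm_one ht) (h.two_small t ht)
  have b2 := low _ _ h.le_norm_limit_one h.norm_limit_two_le
  rw [hE, modeQuotient]
  generalize Complex.exp ((l₂ - l₁) * t) = X at *
  have key : (l₁ * (Complex.exp (l₁ * t) * U₁ t) + l₂ * (Complex.exp (l₁ * t) * X * U₂ t))
      / (Complex.exp (l₁ * t) * U₁ t + Complex.exp (l₁ * t) * X * U₂ t)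
      - (l₁ * a₁ + l₂ * (X * a₂)) / (a₁ + X * a₂)
      = (l₁ - l₂) * X * (U₁ t * a₂ - a₁ * U₂ t) / ((U₁ t + X * U₂ t) * (a₁ + X * a₂)) := by
    rw [show l₁ * (Complex.exp (l₁ * t) * U₁ t) + l₂ * (Complex.exp (l₁ * t) * X * U₂ t)
      = Complex.exp (l₁ * t) * (l₁ * U₁ t + l₂ * (X * U₂ t)) by ring,
      show Complex.exp (l₁ * t) * U₁ t + Complex.exp (l₁ * t) * X * U₂ t
      = Complex.exp (l₁ * t) * (U₁ t + X * U₂ t) by ring, mul_div_mul_left _ _ hE0,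
      div_sub_div _ _ hD hD']
    congr 1
    ring
  rw [key, norm_div, norm_mul, norm_mul, norm_mul, hX, mul_one]
  gcongr

/-! ### Flatness -/

theorem exists_tendsto_abs_ereal {l : Filter ℝ} {q : ℝ → ℝ} {a : ℝ} (h : Tendsto q l (𝓝 a)) :
    ∃ L : EReal, Tendsto (fun ξ => ((|q ξ| : ℝ) : EReal)) l (𝓝 L) :=
  ⟨_, (continuous_coe_real_ereal.tendsto _).comp h.abs⟩

/-- A function asymptotic to a periodic one with non-constant absolute value has no limiting
absolute value. -/
theorem not_tendsto_abs_of_periodic {q g : ℝ → ℝ} {T : ℝ} (hT : 0 < T) (hg : Function.Periodic g T)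
    (hq : Tendsto (fun t => q t - g t) atTop (𝓝 0)) (hne : ∃ s t, |g s| ≠ |g t|) :
    ¬ ∃ L : EReal, Tendsto (fun ξ => ((|q ξ| : ℝ) : EReal)) atTop (𝓝 L) := by
  rintro ⟨L, hL⟩
  -- Sampling along `t + n T` shows that the limit would equal `|g t|` for every phase `t`.
  have key : ∀ t, L = ((|g t| : ℝ) : EReal) := fun t => by
    have h1 : Tendsto (fun n : ℕ => t + n * T) atTop atTop :=
      tendsto_atTop_add_const_left _ _ (tendsto_natCast_atTop_atTop.atTop_mul_const hT)
    have h2 : Tendsto (fun n : ℕ => q (t + n * T)) atTop (𝓝 (g t)) := by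
      have h3 := (hq.comp h1).add_const (g t)
      rw [zero_add] at h3
      refine h3.congr fun n => ?_
      have := hg.nat_mul n t
      simp only [Function.comp_apply, this]
      ring
    exact tendsto_nhds_unique (hL.comp h1) ((continuous_coe_real_ereal.tendsto _).comp h2.abs)
  obtain ⟨s, t, hst⟩ := hne
  have := (key s).symm.trans (key t)
  exact hst (by exact_mod_cast this)

section

variable {P : Param} {σ T e : ℝ} {ζ v η w : ℝ → ℂ}

theorem tendsto_of_shift {X : Type*} {l : Filter X} {f : ℝ → X} (T : ℝ)
    (h : Tendsto (fun t => f (T + t)) atTop l) : Tendsto f atTop l := by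
  have h1 : Tendsto (fun ξ : ℝ => ξ - T) atTop atTop := tendsto_atTop_add_const_right _ _ tendsto_id
  refine (h.comp h1).congr fun ξ => ?_
  simp

theorem HasWallAsymptotics.exists_amplitudes (hA : HasWallAsymptotics P σ T e ζ v η w)
    (hν : 0 < rightRate σ) (he : 0 < e) : ∃ (a₁ a₂ : ℂ) (U₁ U₂ : ℝ → ℂ) (C : ℝ),
    IsAmplitudes (rightRate σ) e a₁ a₂ U₁ U₂ C ∧ (∀ t : ℝ, 0 ≤ t →
      η (T + t) = Complex.exp (eigOne P * t) * U₁ t + Complex.exp (eigTwo P * t) * U₂ t) ∧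
    ∀ t : ℝ, 0 ≤ t → w (T + t) / η (T + t) = (eigOne P * (Complex.exp (eigOne P * t) * U₁ t)
      + eigTwo P * (Complex.exp (eigTwo P * t) * U₂ t))
      / (Complex.exp (eigOne P * t) * U₁ t + Complex.exp (eigTwo P * t) * U₂ t) := by
  obtain ⟨a₁, a₂, U₁, U₂, C, h⟩ := hA.right
  refine ⟨a₁, a₂, U₁, U₂, C, ⟨hν, he, fun t ht => (h t ht).2.2.1, fun t ht => (h t ht).2.2.2.1,
    fun t ht => (h t ht).2.2.2.2.1, fun t ht => (h t ht).2.2.2.2.2⟩, fun t ht => (h t ht).1,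
    fun t ht => ?_⟩
  rw [(h t ht).1, (h t ht).2.1]

theorem HasWallAsymptotics.tendsto_right (hA : HasWallAsymptotics P σ T e ζ v η w)
    (hν : 0 < rightRate σ) (he : 0 < e) (hadm : RightAdmissible σ P) : Tendsto η atTop (𝓝 0) := by
  obtain ⟨a₁, a₂, U₁, U₂, C, h, hη, -⟩ := hA.exists_amplitudes hν he
  refine tendsto_of_shift T ((h.tendsto_sum (l₁ := eigOne P) (l₂ := eigTwo P) ?_ ?_).congr' ?_)
  · linarith [(hadm.eigOne_re hν).2]
  · linarith [(hadm.eigTwo_re hν).2]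
  · filter_upwards [eventually_ge_atTop 0] with t ht using (hη t ht).symm

theorem IsWallCurve.tendsto_wavenumber_left (hW : IsWallCurve P T ζ v η w)
    (hA : HasWallAsymptotics P σ T e ζ v η w) :
    Tendsto (localWavenumber (wallProfile T ζ η)) atBot (𝓝 (zZeroMinus P).im) := by
  refine ((Complex.continuous_im.tendsto _).comp hA.left_wavenumber).congr' ?_
  filter_upwards [eventually_lt_atBot (T + 1)] with ξ h using (hW.localWavenumber_left h).symm

theorem IsWallCurve.flat_of_tendsto (hW : IsWallCurve P T ζ v η w)
    (hA : HasWallAsymptotics P σ T e ζ v η w) {l : ℂ}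
    (h : Tendsto (fun ξ => w ξ / η ξ) atTop (𝓝 l)) : Flat (wallProfile T ζ η) := by
  refine ⟨exists_tendsto_abs_ereal (hW.tendsto_wavenumber_left hA),
    exists_tendsto_abs_ereal (a := -l.im) ?_⟩
  refine ((Complex.continuous_im.tendsto _).comp h).neg.congr' ?_
  filter_upwards [eventually_gt_atTop (T - 1)] with ξ h using (hW.localWavenumber_right h).symm

theorem IsWallCurve.flat_of_re_ne (hW : IsWallCurve P T ζ v η w)
    (hA : HasWallAsymptotics P σ T e ζ v η w) (hν : 0 < rightRate σ) (he : 0 < e)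
    (hadm : RightAdmissible σ P) (hl : (eigOne P).re ≠ (eigTwo P).re) :
    Flat (wallProfile T ζ η) := by
  obtain ⟨a₁, a₂, U₁, U₂, C, h, -, hq⟩ := hA.exists_amplitudes hν he
  -- Both real parts lie in `(-2ν, -ν)`, so their gap is smaller than `ν`.
  obtain ⟨l, hlim⟩ := h.exists_tendsto_modes hl
    (by linarith [(hadm.eigOne_re hν).1, (hadm.eigTwo_re hν).2])
  refine hW.flat_of_tendsto hA (tendsto_of_shift T (hlim.congr' ?_))
  filter_upwards [eventually_ge_atTop 0] with t ht using (hq t ht).symm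

/-! ### The center case -/

/-- In the plane `θ = π` the system for `p + i q` is the complex Riccati equation of the
linearization at the pole. The minus sign comes from inverting the coordinate. -/
theorem isChartPeriodicOrbit_modeQuotient {a₁ a₂ : ℂ} (hl : (eigOne P).re = (eigTwo P).re)
    (hne : eigOne P ≠ eigTwo P) (h : ‖a₂‖ < ‖a₁‖) (ha : a₂ ≠ 0) (T : ℝ) :
    IsChartPeriodicOrbit P (fun ξ => -(modeQuotient (eigOne P) (eigTwo P) a₁ a₂ (ξ - T)).re)
      (fun ξ => -(modeQuotient (eigOne P) (eigTwo P) a₁ a₂ (ξ - T)).im) := by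
  have hd := fun ξ => (hasDerivAt_modeQuotient hl h (ξ - T)).comp_sub_const ξ T
  rw [eigOne_add_eigTwo, eigOne_mul_eigTwo] at hd
  obtain ⟨τ, hτ, hper⟩ := periodic_modeQuotient (a₁ := a₁) (a₂ := a₂) hl hne
  obtain ⟨s, t, hst⟩ := modeQuotient_nonconstant hl hne h ha
  set W := modeQuotient (eigOne P) (eigTwo P) a₁ a₂ with hW
  have hper' : ∀ ξ, W (ξ + τ - T) = W (ξ - T) := fun ξ => by
    rw [show ξ + τ - T = ξ - T + τ by ring, hper]
  refine ⟨⟨fun ξ => ?_, fun ξ => ?_, fun ξ => ?_⟩, ⟨τ, hτ, fun ξ => ?_, fun ξ => ?_⟩,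
    s + T, t + T, fun hc => ?_⟩
  · rw [sin_pi, zero_mul]
    exact hasDerivAt_const ξ π
  · refine (hasDerivAt_re (hd ξ)).neg.congr_deriv ?_
    rw [cos_pi]
    simp only [Complex.sub_re, Complex.mul_re, coeffB_re, coeffB_im, coeffCpi, sq,
      Complex.add_re, Complex.ofReal_re, Complex.ofReal_im, Complex.I_re, Complex.I_im]
    ring
  · refine (hasDerivAt_im (hd ξ)).neg.congr_deriv ?_
    rw [cos_pi, mul_neg_one, ← sub_eq_add_neg]
    simp only [Complex.sub_im, Complex.mul_im, coeffB_re, coeffB_im, coeffCpi, sq,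
      Complex.add_im, Complex.ofReal_re, Complex.ofReal_im, Complex.I_re, Complex.I_im]
    ring
  · simp only [hper']
  · simp only [hper']
  · simp only [add_sub_cancel_right, Prod.mk.injEq, neg_inj] at hc
    exact hst (Complex.ext hc.1 hc.2)

/-- With equal rates the quotient of the modes does not settle unless the limiting second amplitude
vanishes. Its smallness relative to the first keeps the wall away from `-e₃` at finite `ξ`. -/
theorem IsWallCurve.pointToPointOrCycle (hW : IsWallCurve P T ζ v η w)
    (hA : HasWallAsymptotics P σ T e ζ v η w) (hν : 0 < rightRate σ) (he : 0 < e)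
    (hadm : RightAdmissible σ P) (hl : (eigOne P).re = (eigTwo P).re) :
    PointToPointOrCycle P (wallProfile T ζ η) := by
  obtain ⟨a₁, a₂, U₁, U₂, C, h, hη, hq⟩ := hA.exists_amplitudes hν he
  have ha : ‖a₂‖ < ‖a₁‖ := by
    linarith [h.le_norm_limit_one, h.norm_limit_two_le, h.e_pos]
  have hη0 : ∀ ξ, T - 1 < ξ → η ξ ≠ 0 := fun ξ hξ => by
    rcases lt_or_ge ξ T with h1 | h1
    · rw [hW.eq_inv ξ hξ (by linarith)]
      exact inv_ne_zero (hW.left_ne ξ (by linarith))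
    · have h2 := hη (ξ - T) (by linarith)
      rw [add_sub_cancel] at h2
      rw [h2]
      have hE : Complex.exp (eigTwo P * (ξ - T : ℝ)) = Complex.exp (eigOne P * (ξ - T : ℝ))
          * Complex.exp ((eigTwo P - eigOne P) * (ξ - T : ℝ)) := by
        rw [← Complex.exp_add]; ring_nf
      rw [hE, mul_assoc, ← mul_add]
      exact mul_ne_zero (Complex.exp_ne_zero _)
        (h.sum_ne_zero (norm_cexp_mul_of_re_eq hl _) (by linarith))
  obtain ⟨x, u, hx0, hx1, hx2, hm, hleft, hright⟩ := hW.exists_global hη0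
  have hlim := h.tendsto_modes_sub hl
  set W := modeQuotient (eigOne P) (eigTwo P) a₁ a₂ with hWdef
  have hlim' : Tendsto (fun ξ => w ξ / η ξ - W (ξ - T)) atTop (𝓝 0) := by
    refine tendsto_of_shift T (hlim.congr' ?_)
    filter_upwards [eventually_ge_atTop 0] with t ht
    rw [hq t ht, add_sub_cancel_left]
  have hz : Tendsto (fun ξ => u ξ / x ξ + W (ξ - T)) atTop (𝓝 0) := by
    have := hlim'.neg
    rw [neg_zero] at this
    refine this.congr' ?_
    filter_upwards [eventually_gt_atTop (T - 1)] with ξ hξ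
    rw [(hright ξ hξ).2]
    ring
  have hηlim := hA.tendsto_right hν he hadm
  refine ⟨_, _, _, isGivenBy_of_stereo hx0 hx1 hx2 hm, ?_, ?_, ?_⟩
  · have h1 : Tendsto x atBot (𝓝 0) := by
      refine hA.left.congr' ?_
      filter_upwards [eventually_lt_atBot (T + 1)] with ξ hξ using (hleft ξ hξ).1.symm
    have h2 : Tendsto (fun ξ => u ξ / x ξ) atBot (𝓝 (zZeroMinus P)) := by
      refine hA.left_wavenumber.congr' ?_
      filter_upwards [eventually_lt_atBot (T + 1)] with ξ hξ using (hleft ξ hξ).2.symm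
    have h3 : Tendsto (fun ξ => 2 * arctan ‖x ξ‖) atBot (𝓝 0) := by
      have := ((continuous_arctan.tendsto _).comp h1.norm).const_mul 2
      simpa using this
    exact h3.prodMk_nhds (((Complex.continuous_re.tendsto _).comp h2).prodMk_nhds
      ((Complex.continuous_im.tendsto _).comp h2))
  -- `|x| = 1/|η|` tends to infinity, so `2 arctan |x| → π`.
  · have h1 : Tendsto (fun ξ => ‖x ξ‖) atTop atTop := by
      have h2 : Tendsto (fun ξ => ‖η ξ‖) atTop (𝓝[>] 0) := by
        refine tendsto_nhdsWithin_iff.2 ⟨by simpa using hηlim.norm, ?_⟩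
        filter_upwards [eventually_gt_atTop (T - 1)] with ξ hξ using norm_pos_iff.2 (hη0 ξ hξ)
      refine (tendsto_inv_nhdsGT_zero.comp h2).congr' ?_
      filter_upwards [eventually_gt_atTop (T - 1)] with ξ hξ
      rw [(hright ξ hξ).1, norm_inv]
      rfl
    have h2 := (tendsto_nhds_of_tendsto_nhdsWithin tendsto_arctan_atTop).comp h1
    have h3 := h2.const_mul 2
    rwa [mul_div_cancel₀ _ (two_ne_zero' ℝ)] at h3
  · by_cases ha2 : a₂ = 0
    · left
      have hW1 : ∀ t, W t = eigOne P := fun t => by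
        rw [hWdef, ha2, modeQuotient_zero h.limit_one_ne]
      simp only [hW1] at hlim' hz
      have h1 : Tendsto (fun ξ => w ξ / η ξ) atTop (𝓝 (eigOne P)) := tendsto_sub_nhds_zero_iff.1 hlim'
      refine ⟨hW.flat_of_tendsto hA h1, ?_⟩
      have h2 : Tendsto (fun ξ => u ξ / x ξ) atTop (𝓝 (zPiMinus P)) := by
        rw [← tendsto_sub_nhds_zero_iff]
        refine hz.congr fun ξ => ?_
        rw [eigOne, sub_eq_add_neg]
      exact ((Complex.continuous_re.tendsto _).comp h2).prodMk_nhds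
        ((Complex.continuous_im.tendsto _).comp h2)
    · right
      refine ⟨fun hflat => ?_, _, _, isChartPeriodicOrbit_modeQuotient hl hadm.ne ha ha2 T, ?_⟩
      · obtain ⟨τ, hτ, hper⟩ := periodic_modeQuotient (a₁ := a₁) (a₂ := a₂) hl hadm.ne
        obtain ⟨s, t, hst⟩ := abs_im_modeQuotient_ne hl hadm.ne ha ha2
        refine not_tendsto_abs_of_periodic (g := fun ξ => -(W (ξ - T)).im) hτ (fun ξ => ?_) ?_
          ⟨s + T, t + T, by simpa using hst⟩ hflat.2
        · simp only
          rw [show ξ + τ - T = ξ - T + τ by ring, hWdef, hper]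
        · have h1 := (Complex.continuous_im.tendsto _).comp hz
          rw [Complex.zero_im] at h1
          refine h1.congr' ?_
          filter_upwards [eventually_gt_atTop (T - 1)] with ξ hξ
          rw [hW.localWavenumber_right hξ, Function.comp_apply, (hright ξ hξ).2]
          simp
      · refine (((Complex.continuous_re.tendsto _).comp hz).prodMk_nhds
          ((Complex.continuous_im.tendsto _).comp hz)).congr fun ξ => ?_
        simp [hWdef]

end

/-! ### Homogeneous profiles -/

theorem stereoHeight_lt_one {x : ℂ} (hx : x ≠ 0) : stereoHeight x < 1 := by
  have h0 : 0 < Complex.normSq x := Complex.normSq_pos.2 hx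
  rw [stereoHeight, div_lt_one (one_add_normSq_pos x)]
  linarith

theorem hasDerivAt_stereoHeight {x : ℝ → ℂ} {u : ℂ} {ξ : ℝ} (hx : x ξ ≠ 0) (h : HasDerivAt x u ξ) :
    HasDerivAt (fun ξ => stereoHeight (x ξ))
      (-(1 - stereoHeight (x ξ) ^ 2) * (u / x ξ).re) ξ := by
  have hN := (one_add_normSq_pos (x ξ)).ne'
  have h0 : Complex.normSq (x ξ) ≠ 0 := by simpa using hx
  have h1 := hasDerivAt_normSq h
  refine ((h1.const_sub 1).div (h1.const_add 1) hN).congr_deriv ?_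
  rw [Complex.div_re, stereoHeight]
  field_simp
  ring

/-- A polynomial in the height of a nonconstant profile that vanishes identically is zero. -/
theorem polynomial_eq_zero_of_height {ζ : ℝ → ℂ} {T : ℝ} (hne : ∀ ξ, ξ < T → ζ ξ ≠ 0)
    (h0 : Tendsto ζ atBot (𝓝 0)) (Q : Polynomial ℝ)
    (hQ : ∀ ξ, ξ < T → Q.eval (stereoHeight (ζ ξ)) = 0) : Q = 0 := by
  refine Polynomial.eq_zero_of_infinite_isRoot Q ?_
  have hsub : (fun ξ => stereoHeight (ζ ξ)) '' Iio T ⊆ {y | Q.IsRoot y} := by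
    rintro _ ⟨ξ, hξ, rfl⟩
    exact hQ ξ hξ
  -- A finite set of heights would be closed and hence contain the limit `1`, which is attained only
  -- at the pole.
  refine Infinite.mono hsub fun hfin => ?_
  have hlim : Tendsto (fun ξ => stereoHeight (ζ ξ)) atBot (𝓝 1) := by
    have h1 : Tendsto (fun ξ => Complex.normSq (ζ ξ)) atBot (𝓝 0) := by
      have := (Complex.continuous_normSq.tendsto 0).comp h0
      rwa [map_zero] at this
    have h2 : Tendsto (fun ξ => stereoHeight (ζ ξ)) atBot (𝓝 ((1 - 0) / (1 + 0))) :=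
      (h1.const_sub 1).div (h1.const_add 1) (by norm_num)
    simpa using h2
  have hmem := hfin.isClosed.mem_of_tendsto hlim
    (by filter_upwards [eventually_lt_atBot T] with ξ hξ using mem_image_of_mem _ hξ)
  obtain ⟨ξ, hξ, h1⟩ := hmem
  exact (stereoHeight_lt_one (hne ξ hξ)).ne h1

/-- For `q ≡ 0` two real equations remain for the single function `p`. Eliminating `p` leaves a
polynomial in the height `y`, which must vanish identically. -/
theorem IsWallCurve.inhomogeneous {P : Param} {σ T e : ℝ} {ζ v η w : ℝ → ℂ}
    (hW : IsWallCurve P T ζ v η w) (hA : HasWallAsymptotics P σ T e ζ v η w) (hc : |P.c| < 1)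
    (hs : P.s ≠ 0) (hrate : 0 < (zZeroMinus P).re) (hoff : OffHomogeneous P) :
    Inhomogeneous (wallProfile T ζ η) := by
  intro hhom
  have hlt : ∀ {ξ}, ξ < T → ξ < T + 1 := fun h => by linarith
  have hz := fun ξ (h : ξ < T) => hasDerivAt_logDeriv (hW.left_ne ξ (hlt h))
    (hW.left_deriv ξ (hlt h)) (hW.left_deriv' ξ (hlt h))
  set z : ℝ → ℂ := fun ξ => v ξ / ζ ξ with hzdef
  set y : ℝ → ℝ := fun ξ => stereoHeight (ζ ξ) with hydef
  have hq : ∀ ξ, ξ < T → (z ξ).im = 0 := fun ξ h => by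
    rw [← hhom ξ, hW.localWavenumber_left (hlt h)]
  have hy : ∀ ξ, ξ < T → 0 < 1 + P.c * y ξ := fun ξ h =>
    one_add_mul_pos hc (abs_stereoHeight_le _)
  have hy' : ∀ ξ, ξ < T → HasDerivAt y (-(1 - y ξ ^ 2) * (z ξ).re) ξ := fun ξ h =>
    hasDerivAt_stereoHeight (hW.left_ne ξ (hlt h)) (hW.left_deriv ξ (hlt h))
  have him : ∀ ξ, ξ < T → P.s * (z ξ).re = P.α * P.Ω - P.β / (1 + P.c * y ξ) := fun ξ h => by
    have h1 := hasDerivAt_im (hz ξ h)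
    have h2 : HasDerivAt (fun ξ => (z ξ).im) 0 ξ :=
      (hasDerivAt_const ξ (0 : ℝ)).congr_of_eventuallyEq
        (by filter_upwards [gt_mem_nhds h] with t ht using hq t ht)
    have h3 := h1.unique h2
    have h4 : (v ξ / ζ ξ).im = 0 := hq ξ h
    simp only [Complex.add_im, Complex.sub_im, Complex.mul_im, Complex.mul_re, Complex.ofReal_re,
      Complex.ofReal_im, coeffB_re, coeffB_im, coeffC, sq, Complex.I_re, Complex.I_im,
      Complex.ofReal_one, h4, one_mul] at h3
    simp only [hzdef, hydef]
    linarith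
  have hre : ∀ ξ, ξ < T → HasDerivAt (fun ξ => (z ξ).re) (-P.α * P.s * (z ξ).re
      + (P.h - P.Ω - P.μ * y ξ) - y ξ * (z ξ).re ^ 2) ξ := fun ξ h => by
    refine (hasDerivAt_re (hz ξ h)).congr_deriv ?_
    have h4 : (v ξ / ζ ξ).im = 0 := hq ξ h
    simp only [Complex.add_re, Complex.sub_re, Complex.mul_im, Complex.mul_re, Complex.ofReal_re,
      Complex.ofReal_im, coeffB_re, coeffB_im, coeffC, sq, Complex.I_re, Complex.I_im,
      Complex.ofReal_one, h4, hzdef, hydef, one_mul]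
    ring
  -- Differentiate `s p = αΩ - β/(1 + c y)` along `y' = -(1 - y²) p`, compare with the equation for
  -- `p'`, and multiply by `s (1 + c y)³`.
  have hpoly : ∀ ξ, ξ < T → P.β * P.c * (1 - y ξ ^ 2) * (P.α * P.Ω * (1 + P.c * y ξ) - P.β)
      + P.s ^ 2 * (1 + P.c * y ξ) ^ 3 * (P.h - P.Ω - P.μ * y ξ)
      - P.α * P.s ^ 2 * (1 + P.c * y ξ) ^ 2 * (P.α * P.Ω * (1 + P.c * y ξ) - P.β)
      - y ξ * (1 + P.c * y ξ) * (P.α * P.Ω * (1 + P.c * y ξ) - P.β) ^ 2 = 0 := fun ξ h => by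
    have hD := (hy ξ h).ne'
    have h1 : HasDerivAt (fun ξ => P.s * (z ξ).re) (-(0 * (1 + P.c * y ξ) - P.β *
        (P.c * (-(1 - y ξ ^ 2) * (z ξ).re))) / (1 + P.c * y ξ) ^ 2) ξ := by
      have h2 := ((hasDerivAt_const ξ P.β).div (((hy' ξ h).const_mul P.c).const_add 1) hD).const_sub
        (P.α * P.Ω)
      rw [neg_div]
      refine h2.congr_of_eventuallyEq ?_
      filter_upwards [gt_mem_nhds h] with t ht using him t ht
    have h2 := h1.unique ((hre ξ h).const_mul P.s)
    have h3 := him ξ h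
    rw [eq_sub_iff_add_eq, ← eq_sub_iff_add_eq', div_eq_iff hD] at h3
    rw [div_eq_iff (pow_ne_zero 2 hD)] at h2
    generalize (z ξ).re = p at *
    generalize y ξ = Y at *
    have h4 : P.α * P.Ω * (1 + P.c * Y) - P.β = P.s * p * (1 + P.c * Y) := by
      rw [h3]; ring
    rw [h4]
    linear_combination (-(P.s * (1 + P.c * Y))) * h2
  have hne := fun ξ (h : ξ < T) => hW.left_ne ξ (hlt h)
  -- If `β c = 0`, the torque does not depend on the height and `p` is constant, which leads back to
  -- the explicit family.
  by_cases hβc : P.β * P.c = 0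
  · have hp : ∀ ξ, ξ < T → P.s * (z ξ).re = P.α * P.Ω - P.β := fun ξ h => by
      rw [him ξ h]
      rcases mul_eq_zero.1 hβc with h1 | h1 <;> simp [h1]
    set p₀ := (P.α * P.Ω - P.β) / P.s with hp₀
    have hp' : ∀ ξ, ξ < T → (z ξ).re = p₀ := fun ξ h => by
      rw [hp₀, eq_div_iff hs, mul_comm, hp ξ h]
    have hp0 : 0 < p₀ := by
      have h1 : Tendsto (fun ξ => (z ξ).re) atBot (𝓝 (zZeroMinus P).re) :=
        (Complex.continuous_re.tendsto _).comp hA.left_wavenumber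
      have h2 : Tendsto (fun ξ => (z ξ).re) atBot (𝓝 p₀) :=
        tendsto_const_nhds.congr' (by
          filter_upwards [eventually_lt_atBot T] with ξ h using (hp' ξ h).symm)
      rwa [tendsto_nhds_unique h1 h2] at hrate
    have hlin : ∀ ξ, ξ < T → (P.h - P.Ω - P.α * P.s * p₀) - (P.μ + p₀ ^ 2) * y ξ = 0 := fun ξ h => by
      have h1 := hre ξ h
      have h2 : HasDerivAt (fun ξ => (z ξ).re) 0 ξ :=
        (hasDerivAt_const ξ p₀).congr_of_eventuallyEq
          (by filter_upwards [gt_mem_nhds h] with t ht using hp' t ht)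
      have h3 := h1.unique h2
      rw [hp' ξ h] at h3
      linarith
    have hQ := polynomial_eq_zero_of_height hne hA.left
      (Polynomial.C (P.h - P.Ω - P.α * P.s * p₀) - Polynomial.C (P.μ + p₀ ^ 2) * Polynomial.X)
      (fun ξ h => by simpa using hlin ξ h)
    have k0 := congrArg (Polynomial.eval 0) hQ
    have k1 := congrArg (Polynomial.eval 1) hQ
    simp only [Polynomial.eval_sub, Polynomial.eval_mul, Polynomial.eval_C, Polynomial.eval_X,
      Polynomial.eval_zero, mul_zero, sub_zero, mul_one] at k0 k1
    rw [k0, zero_sub, neg_eq_zero] at k1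
    have hsp : P.s * p₀ = P.α * P.Ω - P.β := by rw [hp₀]; field_simp
    -- The coefficients give `p₀² = -μ`; growth of the wall at `-∞` selects the positive root.
    have hsq : √(-P.μ) = p₀ := by
      rw [show -P.μ = p₀ ^ 2 by linarith, Real.sqrt_sq hp0.le]
    have ha : (1 : ℝ) + P.α ^ 2 ≠ 0 := by positivity
    have hΩ : P.Ω = wallFrequency P.α P.β P.h := by
      rw [wallFrequency, eq_div_iff ha]
      linear_combination (-1) * k0 - P.α * hsp
    have hsw : P.s = wallSpeed P.α P.β P.h P.μ := by
      rw [wallSpeed, hsq, eq_div_iff (mul_ne_zero hp0.ne' ha)]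
      linear_combination (1 + P.α ^ 2) * hsp + P.α * (-1) * k0 - P.α ^ 2 * hsp
    rcases hoff with h | h
    · exact h hβc
    · exact h (Prod.ext hsw hΩ)
  · have hβ : P.β ≠ 0 := left_ne_zero_of_mul hβc
    have hc0 : P.c ≠ 0 := right_ne_zero_of_mul hβc
    let X : Polynomial ℝ := Polynomial.X
    let D : Polynomial ℝ := 1 + Polynomial.C P.c * X
    let E : Polynomial ℝ := Polynomial.C (P.α * P.Ω) * D - Polynomial.C P.β
    have hQ := polynomial_eq_zero_of_height hne hA.left
      (Polynomial.C (P.β * P.c) * (1 - X ^ 2) * E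
        + Polynomial.C (P.s ^ 2) * D ^ 3 * (Polynomial.C (P.h - P.Ω) - Polynomial.C P.μ * X)
        - Polynomial.C (P.α * P.s ^ 2) * D ^ 2 * E - X * D * E ^ 2)
      (fun ξ h => by
        rw [← hpoly ξ h]
        simp [X, D, E, hydef])
    -- At the pole `y = -1/c` of the torque `D = 0` and `E = -β`; only `-β² c (1 - 1/c²)` survives,
    -- which forces `c² = 1`.
    have k0 := congrArg (Polynomial.eval (-1 / P.c)) hQ
    have hD : 1 + P.c * (-1 / P.c) = 0 := by field_simp; ring
    simp only [Polynomial.eval_sub, Polynomial.eval_add, Polynomial.eval_mul, Polynomial.eval_C,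
      Polynomial.eval_X, Polynomial.eval_pow, Polynomial.eval_one, Polynomial.eval_zero, X, D, E,
      hD] at k0
    have k1 : P.c ^ 2 = 1 := by
      field_simp at k0
      have : P.β * P.β * (P.c ^ 2 - 1) = 0 := by
        linear_combination -k0
      rcases mul_eq_zero.1 this with h | h
      · exact absurd h (mul_ne_zero hβ hβ)
      · linarith
    have k2 : |P.c| = 1 := by
      rwa [← pow_eq_one_iff_of_nonneg (abs_nonneg _) two_ne_zero, sq_abs]
    exact hc.ne k2

/-! ### The family of walls -/

theorem IsCenterPoint.exists_wall_family {P₀ : Param} {σ : ℝ} (hc : IsCenterPoint P₀ σ) :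
    ∃ M : Param → ℝ → Vec, (∀ ξ, M P₀ ξ = explicitWall P₀.μ ξ) ∧
      ∀ᶠ P in 𝓝 P₀, (∀ ξ, ContDiffAt ℝ ω (Function.uncurry M) (P, ξ)) ∧ IsDomainWall P (M P) ∧
        (OffHomogeneous P → Inhomogeneous (M P)) ∧ (P.Ω ≠ centerFrequency P → Flat (M P)) ∧
        (P.Ω = centerFrequency P → PointToPointOrCycle P (M P)) := by
  obtain ⟨T, e, ζ, v, η, w, he, hζ0, hη0, hall⟩ := hc.exists_wall_curves
  have hν := hc.rightRate_pos
  have hσ : √(-P₀.μ) = σ := by rw [hc.μ_eq, neg_neg, Real.sqrt_sq hc.σ_pos.le]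
  have hα : ∀ᶠ P : Param in 𝓝 P₀, 0 < P.α :=
    (continuous_apply (1 : Fin 7)).continuousAt.eventually (lt_mem_nhds hc.α_pos)
  have hs : ∀ᶠ P : Param in 𝓝 P₀, 0 < P.s :=
    (continuous_apply (5 : Fin 7)).continuousAt.eventually
      (lt_mem_nhds (by change 0 < P₀.s; rw [hc.s_eq]; exact hc.div_pos'))
  -- The imaginary gap is `2σ/α` at `P₀`. As long as it stays positive, the product in
  -- `eig_re_mul_im` vanishes only if the real parts agree.
  have him : ∀ᶠ P : Param in 𝓝 P₀, 0 < (eigOne P - eigTwo P).im := by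
    have h1 : ContinuousAt (fun P => (eigOne P - eigTwo P).im) P₀ :=
      Complex.continuous_im.continuousAt.comp
        (hc.contDiffAt_eigOne.continuousAt.sub hc.contDiffAt_eigTwo.continuousAt)
    refine h1.eventually (lt_mem_nhds ?_)
    simpa [hc.eigOne_eq, hc.eigTwo_eq] using hc.div_pos'
  refine ⟨fun P => wallProfile T (ζ P) (η P), fun ξ => wallProfile_eq_explicitWall
    (fun ξ => by rw [hζ0, hσ]) (fun ξ hξ => by rw [hη0 ξ hξ, hσ]) ξ, ?_⟩
  filter_upwards [hall.eventually_nhds, hα, hs, him, leftRate_pos_eventually hc]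
    with P hP hαP hsP himP hrP
  obtain ⟨hadm, hW, hA, hζ, hη⟩ := hP.self_of_nhds
  have hprod := eig_re_mul_im hαP.ne'
  refine ⟨fun ξ => contDiffAt_wallProfile (hP.mono fun P h => h.2.1) hζ hη,
    hW.isDomainWall (fun ξ hξ => ?_) (fun ξ hξ => ?_) hA.left (hA.tendsto_right hν he hadm),
    hW.inhomogeneous hA hadm.c_lt hsP.ne' hrP, fun hΩ => ?_, fun hΩ => ?_⟩
  · exact (hζ ξ hξ).comp ξ (f := fun ξ => (P, ξ)) (by fun_prop)
  · exact (hη ξ hξ).comp ξ (f := fun ξ => (P, ξ)) (by fun_prop)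
  · refine hW.flat_of_re_ne hA hν he hadm fun hre => ?_
    rw [Complex.sub_re, hre, sub_self, zero_mul] at hprod
    exact mul_ne_zero (mul_ne_zero (by norm_num) hαP.ne') (sub_ne_zero.2 hΩ) hprod.symm
  · refine hW.pointToPointOrCycle hA hν he hadm ?_
    rw [hΩ, sub_self, mul_zero] at hprod
    have := (mul_eq_zero.1 hprod).resolve_right himP.ne'
    rwa [Complex.sub_re, sub_eq_zero] at this

end LLGS

end

theorem mainTheorem2 (α₀ β₀ h₀ μ₀ : ℝ) (hα : 0 < α₀) (hβ : 0 ≤ β₀) (hμ : μ₀ < 0)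
    (hcenter : h₀ = β₀ / α₀ - 2 * μ₀ - 2 * μ₀ / α₀ ^ 2) :
    ∃ (U : Set LLGS.Param) (M : LLGS.Param → ℝ → LLGS.Vec),
      IsOpen U ∧ LLGS.wallParam α₀ β₀ h₀ μ₀ ∈ U ∧
      ContDiffOn ℝ ∞ (Function.uncurry M) (U ×ˢ (Set.univ : Set ℝ)) ∧
      (∀ ξ : ℝ, M (LLGS.wallParam α₀ β₀ h₀ μ₀) ξ = LLGS.explicitWall μ₀ ξ) ∧
      (∀ P ∈ U, P.Ω > LLGS.centerFrequency P ∨ P.Ω < LLGS.centerFrequency P →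
        LLGS.IsDomainWall P (M P) ∧ LLGS.Flat (M P) ∧
        (LLGS.OffHomogeneous P → LLGS.Inhomogeneous (M P))) ∧
      (∀ P ∈ U, P.Ω = LLGS.centerFrequency P →
        P.Ω < P.h + P.μ + P.s ^ 2 / 4 * (1 + P.α ^ 2) →
        LLGS.IsDomainWall P (M P) ∧ LLGS.PointToPointOrCycle P (M P) ∧
        (LLGS.OffHomogeneous P → LLGS.Inhomogeneous (M P))) := by
  obtain ⟨M, hM0, hM⟩ := (LLGS.isCenterPoint_wallParam hα hμ hcenter).exists_wall_family
  obtain ⟨U, hU, hUo, hUP⟩ := eventually_nhds_iff.1 hM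
  refine ⟨U, M, hUo, hUP, fun q hq => ?_, hM0, fun P hP h => ?_, fun P hP h _ => ?_⟩
  · exact (((hU q.1 hq.1).1 q.2).of_le le_top).contDiffWithinAt
  · obtain ⟨-, h1, h2, h3, -⟩ := hU P hP
    exact ⟨h1, h3 (h.elim ne_of_gt ne_of_lt), h2⟩
  · obtain ⟨-, h1, h2, -, h3⟩ := hU P hP
    exact ⟨h1, h3 h, h2⟩
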